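/- Let $N\ge 0$ and let $\mathcal A=\{1,\dots,N\}\sqcup\{\bar 1,\dots,\bar N\}$ be the alphabet of unbarred and barred letters, totally ordered by $1<\bar 1<2<\bar 2<\cdots<N<\bar N$. Put $\bar a{\downarrow}=a$ for $1\le a\le N$ and $a{\downarrow}=\overline{a-1}$ for $2\le a\le N$ (and leave $1{\downarrow}$ undefined). A colored word is a word in $\mathcal A$. Let $\mathcal U$ be the free associative $\mathbb Z$-algebra on $\mathcal A$, whose monomials are the colored words, and let $I_{\mathrm{kron}}$ be the two-sided ideal of $\mathcal U$ generated by the relations (for $x,y,z\in\mathcal A$) - $yyx=yxy$ for $x<y$ and $zyy=yzy$ for $y<z$, where $y$ is unbarred; - $yyz=yzy$ for $y<z$ and $xyy=yxy$ for $x<y$, where $y$ is barred; - $(xz-zx)y=y(xz-zx)$ for $x=y{\downarrow}=z{\downarrow}{\downarrow}$; - $xz=zx$ for $x<z{\downarrow}{\downarrow}$. Let $\langle\cdot,\cdot\rangle$ be the pairing for which the colored words are orthonormal, that is, $\langle f,\gamma\rangle=\sum_w f_w\gamma_w$ for $f\in\mathcal U$ and any (finite or infinite) formal $\mathbb Z$-linear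 combination $\gamma=\sum_w\gamma_w w$ of colored words, and let $(I_{\mathrm{kron}})^\perp$ be the set of those $\gamma$ with $\langle f,\gamma\rangle=0$ for all $f\in I_{\mathrm{kron}}$. For a colored word $w=w_1\cdots w_t$ let $\mathrm{Des}_<(w)$ be the set of $j\in\{1,\dots,t-1\}$ such that $w_j>w_{j+1}$ or $w_j=w_{j+1}$ is barred, and for a set $W$ of colored words let $$F^<_W(\mathbf x)=\sum_{w\in W}\ \sum_{\substack{1\le i_1\le\cdots\le i_t\\ j\in \mathrm{Des}_<(w)\Rightarrow i_j<i_{j+1}}}x_{i_1}\cdots x_{i_t}\in\mathbb Z[[x_1,x_2,\dots]],$$ where $t$ is the length of $w$. A $<$-colored tableau of shape $\nu$ is a filling $T$ of the Young diagram of the partition $\nu$ (English convention) by elements of $\mathcal A$ such that rows and columns are weakly increasing, the unbarred letters in each column are strictly increasing, and the barred letters in each row are strictly increasing. The colored word $\mathrm{sqread}(T)$ is obtained by going through the northwest-southeast diagonals of $T$, starting from the southwest, and reading in each diagonal first its unbarred entries from southeast to northwest and then its barred entries from northwest to southeast. **Corollary 2.4.** Let $W$ be a set of colored words with $\sum_{w\in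 W}w\in(I_{\mathrm{kron}})^\perp$. Then $F^<_W(\mathbf x)$ has a unique expansion $F^<_W(\mathbf x)=\sum_\nu c_\nu s_\nu(\mathbf x)$ in Schur functions with integer coefficients $c_\nu$ ($\nu$ running over all partitions), and for every partition $\nu$ the coefficient of $s_\nu(\mathbf x)$ is $$c_\nu=\big|\{T : T\text{ is a }{<}\text{-colored tableau of shape }\nu\text{ with }\mathrm{sqread}(T)\in W\}\big|.$$ -/

import Mathlib

/-! ### Colored words -/

/-- The total alphabet `{1, …, N} ⊔ {1̄, …, N̄}`; `plain a` and `bar a` stand for the unbarred and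
the barred letter with value `a + 1`. -/
inductive Letter (N : ℕ) : Type
  | plain (a : Fin N) : Letter N
  | bar (a : Fin N) : Letter N

namespace Letter

variable {N : ℕ}

/-- The position of a letter in the list `1, 1̄, 2, 2̄, …, N, N̄`. -/
def pos : Letter N → ℕ
  | plain a => 2 * (a : ℕ)
  | bar a => 2 * (a : ℕ) + 1

theorem pos_injective : Function.Injective (pos : Letter N → ℕ) := by
  rintro (a | a) (b | b) h <;> simp only [pos] at h
  · congr 1; ext; omega
  · omega
  · omega
  · congr 1; ext; omega

/-- The natural order `1 < 1̄ < 2 < 2̄ < ⋯ < N < N̄`. -/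
noncomputable instance : LinearOrder (Letter N) := LinearOrder.lift' pos pos_injective

instance : Finite (Letter N) :=
  Finite.of_injective (fun x : Letter N => (⟨x.pos, by
    rcases x with a | a <;> have := a.2 <;> simp only [pos] <;> omega⟩ : Fin (2 * N)))
    fun x y h => pos_injective (congrArg Fin.val h)

/-- The letter is barred. -/
def IsBarred : Letter N → Bool
  | plain _ => false
  | bar _ => true

/-- "Going down by one": `a ↦ (a-1)‾` for an unbarred letter `a ≥ 2`, and `ā ↦ a`;
it is undefined at the unbarred letter `1`. -/
def down : Letter N → Option (Letter N)
  | plain ⟨0, _⟩ => none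
  | plain ⟨a + 1, h⟩ => some (bar ⟨a, Nat.lt_of_succ_lt h⟩)
  | bar a => some (plain a)

/-- Going down by two, where this is defined. -/
def downTwo (z : Letter N) : Option (Letter N) := z.down.bind down

end Letter

/-- Colored words. -/
abbrev ColoredWord (N : ℕ) : Type := FreeMonoid (Letter N)

/-! ### The free algebra, the ideal and its orthogonal complement -/

/-- The free associative `ℤ`-algebra on the letters, as the algebra of the free monoid: its
elements are the finite `ℤ`-linear combinations of colored words, multiplied by concatenation. -/
abbrev FreeU (N : ℕ) : Type := MonoidAlgebra ℤ (ColoredWord N)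

/-- The noncommuting variable attached to a letter. -/
noncomputable def u {N : ℕ} (x : Letter N) : FreeU N := MonoidAlgebra.of ℤ _ (FreeMonoid.of x)

/-- The defining relations (as pairs of a left and a right side) of the quotient of the free
algebra by the ideal `I_kron`. -/
inductive KronRel (N : ℕ) : FreeU N → FreeU N → Prop
  | yyx (x y : Letter N) : y.IsBarred = false → x < y →
      KronRel N (u y * u y * u x) (u y * u x * u y)
  | zyy (y z : Letter N) : y.IsBarred = false → y < z →
      KronRel N (u z * u y * u y) (u y * u z * u y)
  | yyz (y z : Letter N) : y.IsBarred = true → y < z →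
      KronRel N (u y * u y * u z) (u y * u z * u y)
  | xyy (x y : Letter N) : y.IsBarred = true → x < y →
      KronRel N (u x * u y * u y) (u y * u x * u y)
  | rotate (x y z : Letter N) : y.down = some x → z.downTwo = some x →
      KronRel N ((u x * u z - u z * u x) * u y) (u y * (u x * u z - u z * u x))
  | far (x z z' : Letter N) : z.downTwo = some z' → x < z' →
      KronRel N (u x * u z) (u z * u x)

/-- The two-sided ideal `I_kron`. -/
noncomputable def Ikron (N : ℕ) : TwoSidedIdeal (FreeU N) :=
  TwoSidedIdeal.span {r | ∃ f g, KronRel N f g ∧ r = f - g}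

/-- The pairing `⟨f, γ⟩ = ∑_w f_w γ_w` for which the colored words are orthonormal. The second
argument is allowed to be an arbitrary (possibly infinite) formal combination `∑_w γ_w w`; the sum
is finite as `f` is a finite combination of words. -/
noncomputable def pairing {N : ℕ} (f : FreeU N) (γ : ColoredWord N → ℤ) : ℤ :=
  f.coeff.sum fun w a => a * γ w

/-- The orthogonal complement of `I_kron`. -/
def kronPerp (N : ℕ) : Set (ColoredWord N → ℤ) :=
  {γ | ∀ f ∈ Ikron N, pairing f γ = 0}

/-- The formal sum `∑_{w ∈ W} w`. -/
noncomputable def wordSum {N : ℕ} (W : Set (ColoredWord N)) : ColoredWord N → ℤ :=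
  W.indicator 1

/-! ### Quasisymmetric generating functions -/

/-- The descent set of a colored word `w_1 ⋯ w_t` for the natural order, with positions counted
from `0`: those `j` with `j + 1 < t` such that the `j`-th letter is greater than the next one, or
both are the same barred letter. -/
def descents {N : ℕ} (w : ColoredWord N) : Set ℕ :=
  {j | ∃ h : j + 1 < w.toList.length,
    w.toList[j + 1] < w.toList[j] ∨
      (w.toList[j] = w.toList[j + 1] ∧ w.toList[j].IsBarred = true)}

/-- The sequences `i_1 ≤ ⋯ ≤ i_t` with `i_j < i_{j+1}` for all `j ∈ D` (positions counted
from `0`). -/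
def gesselSeqs (t : ℕ) (D : Set ℕ) : Set (Fin t → ℕ) :=
  {i | Monotone i ∧ ∀ j : ℕ, ∀ h : j + 1 < t, j ∈ D → i ⟨j, Nat.lt_of_succ_lt h⟩ < i ⟨j + 1, h⟩}

/-- Gessel's fundamental quasisymmetric function of degree `t` attached to a descent set `D`: the
formal sum of the monomials `x_{i_1} ⋯ x_{i_t}` over all `i ∈ gesselSeqs t D`, in the commuting
variables `x_k`, `k ∈ ℕ`. -/
noncomputable def fundamentalQSym (t : ℕ) (D : Set ℕ) : MvPowerSeries ℕ ℤ :=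
  fun m => (({i ∈ gesselSeqs t D | ∑ k, Finsupp.single (i k) 1 = m}.ncard : ℕ) : ℤ)

/-- `F_γ = ∑_w γ_w Q_{Des(w)}` for the natural order. The sum is taken coefficientwise; each
coefficient is a finite sum, see `finite_support_quasiGen`. -/
noncomputable def quasiGen {N : ℕ} (γ : ColoredWord N → ℤ) : MvPowerSeries ℕ ℤ :=
  fun m => ∑ᶠ w : ColoredWord N,
    γ w * MvPowerSeries.coeff m (fundamentalQSym w.toList.length (descents w))

theorem finite_support_quasiGen {N : ℕ} (γ : ColoredWord N → ℤ) (m : ℕ →₀ ℕ) :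
    (Function.support fun w : ColoredWord N =>
      γ w * MvPowerSeries.coeff m (fundamentalQSym w.toList.length (descents w))).Finite := by
  refine (List.finite_length_eq (Letter N) m.degree).subset fun (w : ColoredWord N) hw => ?_
  have h1 : MvPowerSeries.coeff m (fundamentalQSym w.toList.length (descents w)) ≠ 0 :=
    right_ne_zero_of_mul hw
  have h2 : ({i ∈ gesselSeqs w.toList.length (descents w) |
      ∑ k, Finsupp.single (i k) 1 = m}.ncard : ℤ) ≠ 0 := h1
  obtain ⟨i, -, hi⟩ := Set.nonempty_of_ncard_ne_zero (by exact_mod_cast h2)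
  show w.toList.length = m.degree
  rw [← hi]
  simp

/-! ### Schur functions -/

/-- The weight of a semistandard Young tableau: the exponent of `∏_c x_{T(c)}`. -/
noncomputable def ssytWeight {ν : YoungDiagram} (T : SemistandardYoungTableau ν) : ℕ →₀ ℕ :=
  ∑ c ∈ ν.cells, Finsupp.single (T c.1 c.2) 1

/-- The Schur function `s_ν`: the formal sum of `∏_c x_{T(c)}` over all semistandard Young
tableaux `T` of shape `ν` with entries in `ℕ`, in the commuting variables `x_k`, `k ∈ ℕ`. -/
noncomputable def schur (ν : YoungDiagram) : MvPowerSeries ℕ ℤ :=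
  fun m => (({T : SemistandardYoungTableau ν | ssytWeight T = m}.ncard : ℕ) : ℤ)

/-- `f = ∑_ν c_ν s_ν`, the sum over all partitions (Young diagrams) being taken coefficientwise;
each coefficient is a finite sum, see `finite_support_schur`. -/
def IsSchurExpansion (f : MvPowerSeries ℕ ℤ) (c : YoungDiagram → ℤ) : Prop :=
  ∀ m : ℕ →₀ ℕ, MvPowerSeries.coeff m f =
    ∑ᶠ ν : YoungDiagram, c ν * MvPowerSeries.coeff m (schur ν)

theorem finite_youngDiagram_card (n : ℕ) : {ν : YoungDiagram | ν.card = n}.Finite := by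
  refine Set.Finite.of_finite_image (f := YoungDiagram.cells)
    ((Finset.finite_toSet (Finset.range n ×ˢ Finset.range n).powerset).subset ?_)
    fun a _ b _ h => YoungDiagram.ext h
  rintro _ ⟨ν, rfl, rfl⟩
  simp only [Finset.coe_powerset, Set.mem_preimage, Set.mem_powerset_iff, Finset.coe_subset]
  rintro ⟨i, j⟩ hc
  have hc' : (i, j) ∈ ν := by simpa using hc
  have hi : (Finset.range (i + 1)).card ≤ ν.cells.card :=
    Finset.card_le_card_of_injOn (fun k => (k, j))
      (fun k hk => by
        have hk' : k < i + 1 := by simpa using hk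
        simpa using ν.up_left_mem (by omega : k ≤ i) le_rfl hc')
      (fun a _ b _ h => (Prod.ext_iff.1 h).1)
  have hj : (Finset.range (j + 1)).card ≤ ν.cells.card :=
    Finset.card_le_card_of_injOn (fun k => (i, k))
      (fun k hk => by
        have hk' : k < j + 1 := by simpa using hk
        simpa using ν.up_left_mem le_rfl (by omega : k ≤ j) hc')
      (fun a _ b _ h => (Prod.ext_iff.1 h).2)
  simp only [Finset.card_range] at hi hj
  simp only [Finset.mem_product, Finset.mem_range, YoungDiagram.card]
  omega

theorem finite_support_schur (c : YoungDiagram → ℤ) (m : ℕ →₀ ℕ) :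
    (Function.support fun ν : YoungDiagram =>
      c ν * MvPowerSeries.coeff m (schur ν)).Finite := by
  refine (finite_youngDiagram_card m.degree).subset fun ν hν => ?_
  have h1 : MvPowerSeries.coeff m (schur ν) ≠ 0 := right_ne_zero_of_mul hν
  have h2 : ({T : SemistandardYoungTableau ν | ssytWeight T = m}.ncard : ℤ) ≠ 0 := h1
  obtain ⟨T, hT⟩ := Set.nonempty_of_ncard_ne_zero (by exact_mod_cast h2)
  show ν.card = m.degree
  rw [← show ssytWeight T = m from hT]
  simp [ssytWeight]

/-! ### Colored tableaux -/

/-- A colored tableau of shape `ν` for the natural order `<`: a filling of the cells of `ν`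
(matrix coordinates, row first) by letters such that rows and columns are weakly increasing, the
barred letters in each row are strictly increasing, and the unbarred letters in each column are
strictly increasing. -/
@[ext]
structure ColoredTableau (N : ℕ) (ν : YoungDiagram) where
  entry : {c // c ∈ ν.cells} → Letter N
  row_weak : ∀ c d, c.1.1 = d.1.1 → c.1.2 < d.1.2 → entry c ≤ entry d
  col_weak : ∀ c d, c.1.2 = d.1.2 → c.1.1 < d.1.1 → entry c ≤ entry d
  row_strict : ∀ c d, c.1.1 = d.1.1 → c.1.2 < d.1.2 →
    (entry c).IsBarred = true → (entry d).IsBarred = true → entry c < entry d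
  col_strict : ∀ c d, c.1.2 = d.1.2 → c.1.1 < d.1.1 →
    (entry c).IsBarred = false → (entry d).IsBarred = false → entry c < entry d

namespace ColoredTableau

variable {N : ℕ} {ν : YoungDiagram}

instance : Finite (ColoredTableau N ν) :=
  Finite.of_injective (fun T : ColoredTableau N ν => T.entry) fun _ _ h => ColoredTableau.ext h

/-- The entries in the diagonal of the cells `(i, j)` with `j + r = i + k`, where `r` is the number
of rows of `ν`, listed from northwest to southeast. As `k` runs through `0, 1, 2, …`, the
diagonals are listed starting from the southwest (and the diagonal for `k = 0` is empty). -/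
def diagonal (T : ColoredTableau N ν) (k : ℕ) : List (Letter N) :=
  (List.range (ν.colLen 0)).filterMap fun i =>
    if h : ν.colLen 0 ≤ i + k ∧ (i, i + k - ν.colLen 0) ∈ ν.cells then
      some (T.entry ⟨_, h.2⟩)
    else none

/-- The word `sqread(T)`: for each diagonal, starting from the southwest, read its unbarred entries
from southeast to northwest and then its barred entries from northwest to southeast. -/
def sqread (T : ColoredTableau N ν) : ColoredWord N :=
  FreeMonoid.ofList <| (List.range (ν.colLen 0 + ν.rowLen 0)).flatMap fun k =>
    ((T.diagonal k).filter fun x => !x.IsBarred).reverse ++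
      (T.diagonal k).filter fun x => x.IsBarred

end ColoredTableau

/-! Write h_k for the sum of all words of length k without descents (`csum`) and J_ν for the sum of
the reading words of the colored tableaux of shape ν (`tableauSum`). The words contributing to the
coefficient of x^m in F_γ are exactly the words occurring in h_{m_0} h_{m_1} ⋯, each once, so this
coefficient is the pairing of γ with that product (`coeff_quasiGen`). If γ is orthogonal to I_kron,
the product may be computed modulo I_kron. There it equals the sum of K_{ν,m} J_ν with the ordinary
Kostka numbers (`csumProd_eq_sum`). Pairing J_ν with the indicator of W counts tableaux, and K_{ν,m}
is the coefficient of x^m in s_ν. Uniqueness is the triangularity of the Kostka numbers.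

The expansion modulo I_kron iterates a Pieri rule: h_k J_ν is the sum of J_λ over horizontal strips
λ/ν of size k (`csum_mul_tableauSum`). This rests on two facts: the h_k commute (`csum_comm`), and
J_ν is the Jacobi–Trudi determinant of the h_{ν_i - i + p} (`prodDesc_complForm_eq`). Determinants
are handled by adjoining anticommuting ψ_p that commute with the letters: the determinant is the
coefficient of ψ_{L-1} ⋯ ψ_0 in a product of the linear forms ∑_p h_{ν_i - i + p} ψ_p, and row
operations become the fact that such a form squares to zero.

For the Jacobi–Trudi formula every row gets a flag bounding its letters, and cells are removed one
at a time, along diagonals from northeast to southwest and upwards in each (`peelState_cell`). A row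
is expanded by its last letter; the choices violating the column condition form a copy of the row
above and vanish. The rest of the row must then move left past the word of the diagonal; the
correction terms die by the Kronecker relations or because a form is repeated
(`complForm_mul_diagWord`). An exhausted row leaves only ψ_i, so a sum over fillings remains.

For the Pieri rule the determinant in the series ∑_m t^m h_{c+m}, with one extra row, is evaluated
twice. Column operations give (∑_k t^k h_k) J_ν (`prodDesc_geometric`). Row operations cut each
series to the lengths allowed by a horizontal strip (`prodDesc_truncate`). -/

/-! ### Letters satisfying the Kronecker relations -/

/-- The commutator `[y_j, y_i]`. -/
def commLetters {B : Type*} [Ring B] (y : ℕ → B) (i j : ℕ) : B := y j * y i - y i * y j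

/-- A sequence of elements of a ring satisfying the relations of the quotient by `I_kron`; the odd
indices stand for the unbarred letters and the even indices for the barred ones. -/
structure KronLetters {B : Type*} [Ring B] (y : ℕ → B) : Prop where
  far : ∀ i j, i + 3 ≤ j → y j * y i = y i * y j
  rotate : ∀ i, commLetters y i (i + 2) * y (i + 1) = y (i + 1) * commLetters y i (i + 2)
  odd_mul : ∀ i j, i < j → j % 2 = 1 → y j * commLetters y i j = 0
  mul_even : ∀ i j, i < j → j % 2 = 0 → commLetters y i j * y j = 0
  even_mul : ∀ i j, i < j → i % 2 = 0 → y i * commLetters y i j = 0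
  mul_odd : ∀ i j, i < j → i % 2 = 1 → commLetters y i j * y i = 0

/-- The sum of all words of length `k` in the letters with index less than `n` that are weakly
increasing, and strictly so at the even letters. -/
def csumNat {B : Type*} [Ring B] (y : ℕ → B) : ℕ → ℕ → B
  | 0, 0 => 1
  | 0, _ + 1 => 0
  | _ + 1, 0 => 1
  | n + 1, k + 1 => csumNat y n (k + 1) +
      (if n % 2 = 0 then csumNat y n k else csumNat y (n + 1) k) * y n

/-- `csumNat` with integer degrees, zero in negative degrees. -/
def csum {B : Type*} [Ring B] (y : ℕ → B) (n : ℕ) : ℤ → B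
  | Int.ofNat k => csumNat y n k
  | Int.negSucc _ => 0

/-! ### Recursions for the complete sums. -/

section CompleteSums

variable {B : Type*} [Ring B] (y : ℕ → B)

@[simp] theorem csumNat_zero_right (n : ℕ) : csumNat y n 0 = 1 := by
  cases n <;> simp [csumNat]

theorem csum_natCast (n k : ℕ) : csum y n k = csumNat y n k := rfl

theorem csum_of_neg (n : ℕ) {k : ℤ} (hk : k < 0) : csum y n k = 0 := by
  cases k with
  | ofNat k => exact absurd hk (by simp)
  | negSucc k => rfl

@[simp] theorem csum_zero_right (n : ℕ) : csum y n 0 = 1 := csumNat_zero_right y n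

theorem csum_zero_left {k : ℤ} (hk : k ≠ 0) : csum y 0 k = 0 := by
  rcases k with (_ | k) | k
  · exact absurd rfl hk
  · simp [csum, csumNat]
  · rfl

theorem csum_succ_of_even {n : ℕ} (hn : n % 2 = 0) (k : ℤ) :
    csum y (n + 1) k = csum y n k + csum y n (k - 1) * y n := by
  rcases k with (_ | k) | k
  · simp [csum_of_neg]
  · have h : (Int.ofNat (k + 1) - 1 : ℤ) = k := by simp
    rw [h]
    simp only [csum, csumNat, hn]
    simp
  · rw [csum_of_neg, csum_of_neg, csum_of_neg] <;> simp

theorem csum_succ_of_odd {n : ℕ} (hn : n % 2 = 1) (k : ℤ) :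
    csum y (n + 1) k = csum y n k + csum y (n + 1) (k - 1) * y n := by
  rcases k with (_ | k) | k
  · simp [csum_of_neg]
  · have h : (Int.ofNat (k + 1) - 1 : ℤ) = k := by simp
    rw [h]
    simp only [csum, csumNat, hn]
    simp
  · rw [csum_of_neg, csum_of_neg, csum_of_neg] <;> simp

/-- Induction principle for identities between the `csum y n k`: induction on the degree, which is
trivial below zero. -/
theorem csum_int_induction {P : ℤ → Prop} (h0 : ∀ k < 0, P k) (hs : ∀ k, P (k - 1) → P k)
    (k : ℤ) : P k := by
  rcases k with k | k
  · induction k with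
    | zero => exact hs _ (h0 _ (by simp))
    | succ k ih =>
      refine hs _ ?_
      have h : (Int.ofNat (k + 1) - 1 : ℤ) = Int.ofNat k := by simp
      rwa [h]
  · exact h0 _ (Int.negSucc_lt_zero k)

variable {y}

/-- An element commuting with the letters below `n` commutes with `csum y n k`. -/
theorem csum_commute {n : ℕ} {b : B} (hb : ∀ i < n, b * y i = y i * b) (k : ℤ) :
    b * csum y n k = csum y n k * b := by
  induction n generalizing k with
  | zero =>
    by_cases hk : k = 0
    · simp [hk]
    · simp [csum_zero_left y hk]
  | succ n ih =>
    have ih' := fun k => ih (fun i hi => hb i (by omega)) k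
    have hn := hb n (by omega)
    rcases Nat.mod_two_eq_zero_or_one n with h | h
    · rw [csum_succ_of_even y h, mul_add, add_mul, ih', ← mul_assoc, ih', mul_assoc, hn,
        mul_assoc]
    · induction k using csum_int_induction with
      | h0 k hk => simp [csum_of_neg _ _ hk]
      | hs k ihk =>
        rw [csum_succ_of_odd y h, mul_add, add_mul, ih', ← mul_assoc, ihk, mul_assoc, hn,
          mul_assoc]

/-- The sum of the commutators of `y_j` with the letters below `n`. -/
def commSum (y : ℕ → B) (n j : ℕ) : B := ∑ i ∈ Finset.range n, commLetters y i j

end CompleteSums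

/-! ### Commutation of letters and complete sums under the Kronecker relations. -/

namespace KronLetters

variable {B : Type*} [Ring B] {y : ℕ → B} (hy : KronLetters y)
include hy

theorem comm_eq_zero {i j : ℕ} (h : i + 3 ≤ j) : commLetters y i j = 0 := by
  simp [commLetters, hy.far i j h]

/-- The commutator vanishes unless `j = i + 2`; then `n` is the index in between and this is the
rotation relation. -/
theorem comm_commute {i n j : ℕ} (hi : i < n) (hn : n < j) :
    commLetters y i j * y n = y n * commLetters y i j := by
  by_cases h : i + 3 ≤ j
  · simp [hy.comm_eq_zero h]
  · obtain rfl : n = i + 1 := by omega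
    obtain rfl : j = i + 2 := by omega
    exact hy.rotate i

theorem commSum_commute {n j : ℕ} (hn : n < j) :
    commSum y n j * y n = y n * commSum y n j := by
  rw [commSum, Finset.sum_mul, Finset.mul_sum]
  exact Finset.sum_congr rfl fun i hi => hy.comm_commute (Finset.mem_range.1 hi) hn

theorem commSum_eq_zero {n j : ℕ} (hn : n + 2 ≤ j) : commSum y n j = 0 :=
  Finset.sum_eq_zero fun i hi => hy.comm_eq_zero (by have := Finset.mem_range.1 hi; omega)

/-- Moving a large letter through a complete sum. -/
theorem mul_csum {n j : ℕ} (hn : n ≤ j) (k : ℤ) :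
    y j * csum y n k = csum y n k * y j + csum y n (k - 1) * commSum y n j := by
  induction n generalizing k with
  | zero =>
    by_cases hk : k = 0
    · simp [hk, commSum]
    · simp [csum_zero_left y hk, commSum]
  | succ n ih =>
    have ih' := fun k => ih (by omega) k
    have hc := hy.commSum_commute (n := n) (j := j) (by omega)
    have hS : commSum y (n + 1) j = commSum y n j + (y j * y n - y n * y j) := by
      rw [commSum, Finset.sum_range_succ]; rfl
    rcases Nat.mod_two_eq_zero_or_one n with h | h
    · have h2 := hy.even_mul n j (by omega) h
      rw [commLetters] at h2
      simp only [csum_succ_of_even y h, hS, mul_add, add_mul, ih', ← mul_assoc]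
      simp only [mul_assoc, hc, mul_sub]
      simp only [mul_sub] at h2
      rw [sub_eq_zero.1 h2]
      noncomm_ring
    · have h2 := hy.mul_odd n j (by omega) h
      rw [commLetters] at h2
      induction k using csum_int_induction with
      | h0 k hk => simp [csum_of_neg y (n + 1) hk, csum_of_neg y (n + 1) (by omega : k - 1 < 0)]
      | hs k ihk =>
        have e2 := csum_succ_of_odd y h (k - 1)
        rw [csum_succ_of_odd y h, mul_add, ih', ← mul_assoc, ihk, add_mul, add_mul]
        -- Here [y_j, y_n] y_n = 0 drops the new commutator, and the recursion in degree k - 1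
        -- absorbs the remaining y_n.
        have h3 : csum y (n + 1) (k - 1 - 1) * commSum y (n + 1) j * y n =
            (csum y (n + 1) (k - 1) - csum y n (k - 1)) * commSum y n j := by
          rw [hS, mul_add, add_mul, mul_assoc, mul_assoc, h2, hc, mul_zero, add_zero, ← mul_assoc]
          rw [e2]; noncomm_ring
        rw [h3, hS]
        noncomm_ring

/-- Induction on the number of letters. For even n the product of two sums expands, by `mul_csum`,
into an expression symmetric in k and l. For odd n the recursion is inverted: the products for n,
known to commute, are written through products for n + 1, of which all but one have smaller total
degree. -/
theorem csum_comm (n : ℕ) (k l : ℤ) :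
    csum y n k * csum y n l = csum y n l * csum y n k := by
  induction n generalizing k l with
  | zero =>
    by_cases hk : k = 0
    · simp [hk]
    · simp [csum_zero_left y hk]
  | succ n ih =>
    have hm := hy.mul_csum (le_refl n)
    rcases Nat.mod_two_eq_zero_or_one n with h | h
    · have hz : commSum y n n * y n = 0 := by
        rw [commSum, Finset.sum_mul]
        exact Finset.sum_eq_zero fun i hi => hy.mul_even i n (Finset.mem_range.1 hi) h
      have key : ∀ k l, csum y (n + 1) k * csum y (n + 1) l =
          csum y n k * csum y n l +
          (csum y n k * csum y n (l - 1) + csum y n (k - 1) * csum y n l) * y n +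
          csum y n (k - 1) * csum y n (l - 1) * (commSum y n n + y n * y n) := by
        intro k l
        simp only [csum_succ_of_even y h, mul_add, add_mul]
        rw [mul_assoc _ (y n), hm, mul_assoc _ (y n), ← mul_assoc (y n), hm, add_mul,
          mul_assoc _ (commSum y n n), hz]
        noncomm_ring
      rw [key, key, ih k l, ih k (l - 1), ih (k - 1) l, ih (k - 1) (l - 1)]
      noncomm_ring
    · have hz : y n * commSum y n n = 0 := by
        rw [commSum, Finset.mul_sum]
        exact Finset.sum_eq_zero fun i hi => hy.odd_mul i n (Finset.mem_range.1 hi) h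
      have e := csum_succ_of_odd y h
      have key : ∀ k l, csum y n k * csum y n l =
          csum y (n + 1) k * csum y (n + 1) l
          - (csum y (n + 1) (k - 1) * csum y (n + 1) l +
            csum y (n + 1) k * csum y (n + 1) (l - 1)) * y n
          + csum y (n + 1) (k - 1) * csum y (n + 1) (l - 1) * (y n * y n - commSum y n n) := by
        intro k l
        have e1 : csum y n k = csum y (n + 1) k - csum y (n + 1) (k - 1) * y n := by
          rw [e k]; noncomm_ring
        have e2 : csum y n l = csum y (n + 1) l - csum y (n + 1) (l - 1) * y n := by
          rw [e l]; noncomm_ring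
        have e3 : csum y n (l - 1) * commSum y n n = csum y (n + 1) (l - 1) * commSum y n n := by
          rw [e (l - 1), add_mul, mul_assoc _ (y n), hz, mul_zero, add_zero]
        calc csum y n k * csum y n l
            = csum y (n + 1) k * csum y n l - csum y (n + 1) (k - 1) * (y n * csum y n l) := by
              rw [e1]; noncomm_ring
          _ = csum y (n + 1) k * csum y n l - csum y (n + 1) (k - 1) * (csum y n l * y n)
              - csum y (n + 1) (k - 1) * (csum y (n + 1) (l - 1) * commSum y n n) := by
              rw [hm, e3]; noncomm_ring
          _ = _ := by rw [e2]; noncomm_ring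
      -- Second induction, on a bound for k + l. If k + l < 0, one of the degrees is negative and
      -- both products vanish.
      have main : ∀ s : ℕ, ∀ k l : ℤ, k + l < s →
          csum y (n + 1) k * csum y (n + 1) l = csum y (n + 1) l * csum y (n + 1) k := by
        intro s
        induction s with
        | zero =>
          intro k l hkl
          rcases (by push_cast at hkl; omega : k < 0 ∨ l < 0) with hk | hk <;>
            simp [csum_of_neg _ _ hk]
        | succ s ihs =>
          intro k l hkl
          push_cast at hkl
          have a1 := key k l
          have a2 := key l k
          rw [ih k l, a2, ihs (l - 1) k (by omega), ihs l (k - 1) (by omega),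
            ihs (l - 1) (k - 1) (by omega)] at a1
          have a3 := sub_eq_zero.2 a1
          rw [← sub_eq_zero, ← neg_eq_zero, ← a3]
          noncomm_ring
      exact main (k + l + 1).toNat k l (by omega)

end KronLetters


/-! ### Anticommuting variables -/

/-- A sequence of anticommuting elements with square zero that commute with given letters. -/
structure GrassmannFor {B : Type*} [Ring B] (y ψ : ℕ → B) : Prop where
  sq : ∀ p, ψ p * ψ p = 0
  anti : ∀ p q, p ≠ q → ψ p * ψ q = -(ψ q * ψ p)
  comm : ∀ i p, y i * ψ p = ψ p * y i

/-- The linear form `∑_{p < L} g_p ψ_p`. -/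
def linForm {B : Type*} [Ring B] (ψ : ℕ → B) (L : ℕ) (g : ℕ → B) : B :=
  ∑ p ∈ Finset.range L, g p * ψ p

/-- The linear form `∑_{p < L} h_{K+p} ψ_p`, where `h` is the complete sum in the first `2 n`
letters. -/
def complForm {B : Type*} [Ring B] (y ψ : ℕ → B) (L n : ℕ) (K : ℤ) : B :=
  linForm ψ L fun p => csum y (2 * n) (K + p)

/-- The reading order on a diagonal: the odd letters backwards, then the even letters. -/
def diagWord (D : List ℕ) : List ℕ :=
  (D.filter fun i => i % 2 = 1).reverse ++ D.filter fun i => i % 2 = 0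

/-- The monomial of a word. -/
def monomialOf {B : Type*} [Ring B] (y : ℕ → B) (w : List ℕ) : B := (w.map y).prod

/-- Exchanging p and q keeps the coefficient and changes the sign of `ψ p * ψ q`; the terms with p =
q vanish. For g = g' this is the vanishing of a determinant with two equal rows. -/
theorem linForm_mul_linForm_eq_zero {B : Type*} [Ring B] {ψ : ℕ → B} {L : ℕ} {g g' : ℕ → B}
    (sq : ∀ p, ψ p * ψ p = 0) (anti : ∀ p q, p ≠ q → ψ p * ψ q = -(ψ q * ψ p))
    (hg : ∀ p q, g p * g' q = g q * g' p) (hc : ∀ p q, ψ p * g' q = g' q * ψ p) :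
    linForm ψ L g * linForm ψ L g' = 0 := by
  have e : ∀ p q, g p * ψ p * (g' q * ψ q) = g p * g' q * (ψ p * ψ q) := by
    intro p q
    rw [mul_assoc, ← mul_assoc (ψ p), hc]; simp only [mul_assoc]
  rw [linForm, linForm, Finset.sum_mul_sum, ← Finset.sum_product']
  refine Finset.sum_involution (fun x _ => (x.2, x.1)) ?_ ?_ ?_ ?_
  · rintro ⟨p, q⟩ _
    simp only [e]
    by_cases h : p = q
    · subst h; simp [sq]
    · rw [hg p q, anti p q h]; simp
  · rintro ⟨p, q⟩ _ hne heq
    obtain rfl : q = p := congrArg Prod.fst heq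
    exact hne (by simp only [e, sq, mul_zero])
  · rintro ⟨p, q⟩ h
    simp only [Finset.mem_product, Finset.mem_range] at h ⊢
    exact ⟨h.2, h.1⟩
  · rintro ⟨p, q⟩ _; rfl

/-! ### Monomials of diagonals. -/

section DiagWord

variable {B : Type*} [Ring B] (y : ℕ → B)

/-- The odd part of the monomial of a diagonal. -/
def oddPart (D : List ℕ) : B := monomialOf y (D.filter fun i => i % 2 = 1).reverse

/-- The even part of the monomial of a diagonal. -/
def evenPart (D : List ℕ) : B := monomialOf y (D.filter fun i => i % 2 = 0)

theorem monomialOf_append (u v : List ℕ) :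
    monomialOf y (u ++ v) = monomialOf y u * monomialOf y v := by
  simp [monomialOf]

theorem monomialOf_diagWord (D : List ℕ) :
    monomialOf y (diagWord D) = oddPart y D * evenPart y D := monomialOf_append _ _ _

@[simp] theorem monomialOf_diagWord_nil : monomialOf y (diagWord []) = 1 := by
  simp [monomialOf, diagWord]

theorem oddPart_cons_odd {d : ℕ} (h : d % 2 = 1) (D : List ℕ) :
    oddPart y (d :: D) = oddPart y D * y d := by
  simp [oddPart, monomialOf, h]

theorem oddPart_cons_even {d : ℕ} (h : d % 2 = 0) (D : List ℕ) :
    oddPart y (d :: D) = oddPart y D := by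
  simp [oddPart, monomialOf, h]

theorem evenPart_cons_odd {d : ℕ} (h : d % 2 = 1) (D : List ℕ) :
    evenPart y (d :: D) = evenPart y D := by
  simp [evenPart, monomialOf, h]

theorem evenPart_cons_even {d : ℕ} (h : d % 2 = 0) (D : List ℕ) :
    evenPart y (d :: D) = y d * evenPart y D := by
  simp [evenPart, monomialOf, h]

/-- A new northwest entry always lands between the odd and the even part: it ends the reversed list
of odd letters or starts the list of even ones. -/
theorem monomialOf_diagWord_cons (d : ℕ) (D : List ℕ) :
    monomialOf y (diagWord (d :: D)) = oddPart y D * y d * evenPart y D := by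
  rw [monomialOf_diagWord]
  rcases Nat.mod_two_eq_zero_or_one d with h | h
  · rw [oddPart_cons_even y h, evenPart_cons_even y h, mul_assoc]
  · rw [oddPart_cons_odd y h, evenPart_cons_odd y h]

variable {y}

theorem commute_monomialOf {b : B} {w : List ℕ} (h : ∀ i ∈ w, b * y i = y i * b) :
    b * monomialOf y w = monomialOf y w * b :=
  (Commute.list_prod_right (w.map y) b fun x hx => by
    obtain ⟨i, hi, rfl⟩ := List.mem_map.1 hx
    exact h i hi).eq

theorem commute_oddPart {b : B} {D : List ℕ} (h : ∀ i ∈ D, b * y i = y i * b) :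
    b * oddPart y D = oddPart y D * b :=
  commute_monomialOf fun i hi => h i (by simp at hi; exact hi.1)

theorem commute_evenPart {b : B} {D : List ℕ} (h : ∀ i ∈ D, b * y i = y i * b) :
    b * evenPart y D = evenPart y D * b :=
  commute_monomialOf fun i hi => h i (by simp at hi; exact hi.1)

end DiagWord

/-! ### Linear forms with complete sums as coefficients. -/

namespace GrassmannFor

variable {B : Type*} [Ring B] {y ψ : ℕ → B} (hψ : GrassmannFor y ψ)

theorem sum_Ico_two_mul_succ {M : Type*} [AddCommMonoid M] (f : ℕ → M) {a b : ℕ} (h : a ≤ b) :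
    ∑ d ∈ Finset.Ico (2 * a) (2 * (b + 1)), f d =
      ∑ d ∈ Finset.Ico (2 * a) (2 * b), f d + f (2 * b) + f (2 * b + 1) := by
  rw [show 2 * (b + 1) = 2 * b + 1 + 1 by ring, Finset.sum_Ico_succ_top (by omega),
    Finset.sum_Ico_succ_top (by omega)]

theorem complForm_commute (L : ℕ) {n : ℕ} {b : B} (hb : ∀ i < 2 * n, b * y i = y i * b)
    (hbψ : ∀ p, b * ψ p = ψ p * b) (K : ℤ) :
    b * complForm y ψ L n K = complForm y ψ L n K * b := by
  rw [complForm, linForm, Finset.mul_sum, Finset.sum_mul]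
  refine Finset.sum_congr rfl fun p _ => ?_
  rw [← mul_assoc, csum_commute hb, mul_assoc, hbψ, mul_assoc]

include hψ

theorem csum_comm_psi (n : ℕ) (k : ℤ) (p : ℕ) : ψ p * csum y n k = csum y n k * ψ p :=
  csum_commute (fun i _ => (hψ.comm i p).symm) k

theorem monomialOf_comm_psi (w : List ℕ) (p : ℕ) :
    ψ p * monomialOf y w = monomialOf y w * ψ p :=
  commute_monomialOf fun i _ => (hψ.comm i p).symm

theorem complForm_succ (L n : ℕ) (K : ℤ) :
    complForm y ψ L (n + 1) K = complForm y ψ L n K + complForm y ψ L n (K - 1) * y (2 * n) +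
      complForm y ψ L (n + 1) (K - 1) * y (2 * n + 1) := by
  simp only [complForm, linForm, Finset.sum_mul, ← Finset.sum_add_distrib]
  refine Finset.sum_congr rfl fun p _ => ?_
  have e1 := csum_succ_of_odd y (n := 2 * n + 1) (by omega) (K + p)
  have e2 := csum_succ_of_even y (n := 2 * n) (by omega) (K + p)
  have e3 : K - 1 + (p : ℤ) = K + p - 1 := by ring
  rw [show 2 * (n + 1) = 2 * n + 1 + 1 by ring, e1, e2, e3]
  rw [add_mul, add_mul, mul_assoc _ (y _), hψ.comm, mul_assoc _ (y _), hψ.comm]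
  simp only [mul_assoc]

/-- Words are sorted by their last letter d. The letters before it have index below d if d is even
and at most d if d is odd, that is, index below 2⌊(d + 1)/2⌋ in both cases; this is the origin of
the flags `(d + 1) / 2`. -/
theorem complForm_sub (L : ℕ) {lo n : ℕ} (h : lo ≤ n) (K : ℤ) :
    complForm y ψ L n (K + 1) - complForm y ψ L lo (K + 1) =
      ∑ d ∈ Finset.Ico (2 * lo) (2 * n), complForm y ψ L ((d + 1) / 2) K * y d := by
  induction n, h using Nat.le_induction with
  | base => simp
  | succ n hn ih =>
    have e1 : (2 * n + 1) / 2 = n := by omega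
    have e2 : (2 * n + 1 + 1) / 2 = n + 1 := by omega
    rw [sum_Ico_two_mul_succ _ hn, ← ih, hψ.complForm_succ, e1, e2, add_sub_cancel_right]
    abel

variable (hy : KronLetters y)
include hy

theorem complForm_sq (L n : ℕ) (K : ℤ) : complForm y ψ L n K * complForm y ψ L n K = 0 := by
  refine linForm_mul_linForm_eq_zero hψ.sq hψ.anti (fun p q => hy.csum_comm _ _ _)
    fun p q => hψ.csum_comm_psi _ _ _

theorem mul_complForm (L : ℕ) {n j : ℕ} (hn : 2 * n ≤ j) (K : ℤ) :
    y j * complForm y ψ L n K =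
      complForm y ψ L n K * y j + complForm y ψ L n (K - 1) * commSum y (2 * n) j := by
  have hc : ∀ p, commSum y (2 * n) j * ψ p = ψ p * commSum y (2 * n) j := by
    intro p
    rw [commSum, Finset.sum_mul, Finset.mul_sum]
    refine Finset.sum_congr rfl fun i _ => ?_
    simp only [commLetters, sub_mul, mul_sub, mul_assoc, hψ.comm]
    simp only [← mul_assoc, hψ.comm]
  simp only [complForm, linForm, Finset.sum_mul, Finset.mul_sum, ← Finset.sum_add_distrib]
  refine Finset.sum_congr rfl fun p _ => ?_
  have e3 : K - 1 + (p : ℤ) = K + p - 1 := by ring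
  rw [← mul_assoc, hy.mul_csum hn, e3, add_mul, mul_assoc, hψ.comm, mul_assoc _ _ (ψ p), hc]
  simp only [mul_assoc]

/-- Adding a cell in the middle of a diagonal. -/
theorem complForm_mul_diagWord (L : ℕ) {D : List ℕ} {a lo n : ℕ} (hlo : lo ≤ n) (hn : 2 * n ≤ a)
    (hD : ∀ z ∈ D, 2 * n + 2 ≤ z) (K : ℤ) :
    complForm y ψ L ((a + 1) / 2) K * monomialOf y (diagWord (a :: D)) *
        (complForm y ψ L n (K + 1) - complForm y ψ L lo (K + 1)) =
      ∑ d ∈ Finset.Ico (2 * lo) (2 * n), complForm y ψ L ((a + 1) / 2) K *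
        complForm y ψ L ((d + 1) / 2) K * monomialOf y (diagWord (d :: a :: D)) := by
  rcases hlo.eq_or_lt with rfl | hlo
  · simp
  -- The entries of D exceed the letters of the form by at least 3, so only y_a can obstruct the
  -- passage of the form to the left.
  have hsmall : ∀ i < 2 * n, ∀ z ∈ D, y i * y z = y z * y i := fun i hi z hz =>
    (hy.far i z (by have := hD z hz; omega)).symm
  have hU : ∀ m ≤ n, ∀ k, oddPart y D * complForm y ψ L m k =
      complForm y ψ L m k * oddPart y D := fun m hm k =>
    complForm_commute L (fun i hi => (commute_oddPart (hsmall i (by omega))).symm)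
      (fun p => (hψ.monomialOf_comm_psi _ p).symm) k
  have hV : ∀ m ≤ n, ∀ k, evenPart y D * complForm y ψ L m k =
      complForm y ψ L m k * evenPart y D := fun m hm k =>
    complForm_commute L (fun i hi => (commute_evenPart (hsmall i (by omega))).symm)
      (fun p => (hψ.monomialOf_comm_psi _ p).symm) k
  set U := oddPart y D
  set V := evenPart y D
  set G := complForm y ψ L ((a + 1) / 2) K
  have hPV : V * (complForm y ψ L n (K + 1) - complForm y ψ L lo (K + 1)) =
      (complForm y ψ L n (K + 1) - complForm y ψ L lo (K + 1)) * V := by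
    rw [mul_sub, sub_mul, hV _ le_rfl, hV _ hlo.le]
  rw [monomialOf_diagWord_cons, mul_assoc, mul_assoc _ V, hPV]
  rcases Nat.mod_two_eq_zero_or_one a with ha | ha
  · have h0 : G * (U * (complForm y ψ L n K * commSum y (2 * n) a)) = 0 := by
      by_cases h : a = 2 * n
      · subst h
        have e : (2 * n + 1) / 2 = n := by omega
        simp only [G, e]
        rw [← mul_assoc U, hU _ le_rfl, mul_assoc _ U, ← mul_assoc, hψ.complForm_sq hy, zero_mul]
      · rw [hy.commSum_eq_zero (by omega)]; simp
    have h1 : y a * (complForm y ψ L n (K + 1) - complForm y ψ L lo (K + 1)) =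
        (complForm y ψ L n (K + 1) - complForm y ψ L lo (K + 1)) * y a +
          complForm y ψ L n K * commSum y (2 * n) a := by
      rw [mul_sub, hψ.mul_complForm hy L hn, hψ.mul_complForm hy L (by omega : 2 * lo ≤ a),
        hy.commSum_eq_zero (n := 2 * lo) (by omega), mul_zero, add_zero, add_sub_cancel_right]
      noncomm_ring
    calc G * (U * y a * ((complForm y ψ L n (K + 1) - complForm y ψ L lo (K + 1)) * V))
        = G * U * (y a * (complForm y ψ L n (K + 1) - complForm y ψ L lo (K + 1))) * V := by
          simp only [mul_assoc]
      _ = G * U * ((complForm y ψ L n (K + 1) - complForm y ψ L lo (K + 1)) * y a) * V +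
            G * (U * (complForm y ψ L n K * commSum y (2 * n) a)) * V := by
          rw [h1]; simp only [mul_add, add_mul, mul_assoc]
      _ = _ := by
          rw [h0, zero_mul, add_zero, hψ.complForm_sub L hlo.le, Finset.sum_mul, Finset.mul_sum,
            Finset.sum_mul]
          refine Finset.sum_congr rfl fun d hd => ?_
          have hd := Finset.mem_Ico.1 hd
          rw [monomialOf_diagWord_cons, oddPart_cons_even y ha, evenPart_cons_even y ha,
            mul_assoc G U, mul_assoc _ (y d), ← mul_assoc U, hU _ (by omega)]
          simp only [mul_assoc, U, V]
  · rw [hψ.complForm_sub L hlo.le, Finset.sum_mul, Finset.mul_sum, Finset.mul_sum]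
    refine Finset.sum_congr rfl fun d hd => ?_
    have hd := Finset.mem_Ico.1 hd
    -- For odd a the letter y_d comes right after y_a. The only index i close enough to a is i = d =
    -- a - 2, where [y_a, y_d] y_d = 0.
    have h0 : commSum y (2 * ((d + 1) / 2)) a * y d = 0 := by
      rw [commSum, Finset.sum_mul]
      refine Finset.sum_eq_zero fun i hi => ?_
      have hi := Finset.mem_range.1 hi
      by_cases h : i + 3 ≤ a
      · rw [hy.comm_eq_zero h, zero_mul]
      · obtain rfl : i = d := by omega
        exact hy.mul_odd i a (by omega) (by omega)
    have h1 : y a * (complForm y ψ L ((d + 1) / 2) K * y d) =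
        complForm y ψ L ((d + 1) / 2) K * (y a * y d) := by
      rw [← mul_assoc, hψ.mul_complForm hy L (by omega), add_mul, mul_assoc _ (commSum _ _ _), h0,
        mul_zero, add_zero, mul_assoc]
    rw [monomialOf_diagWord_cons, oddPart_cons_odd y ha, evenPart_cons_odd y ha,
      mul_assoc U, ← mul_assoc (y a), h1, mul_assoc _ _ V, ← mul_assoc U, hU _ (by omega)]
    simp only [mul_assoc, U, V]

end GrassmannFor

/-! ### Vanishing of products of too many linear forms. -/

section Pigeonhole

variable {B : Type*} [Ring B] {ψ : ℕ → B} (sq : ∀ p, ψ p * ψ p = 0)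
  (anti : ∀ p q, p ≠ q → ψ p * ψ q = -(ψ q * ψ p))
include sq anti

theorem psi_mul_prod_eq_zero {a : ℕ} {l : List ℕ} (h : a ∈ l) : ψ a * (l.map ψ).prod = 0 := by
  induction l with
  | nil => simp at h
  | cons b l ih =>
    rw [List.map_cons, List.prod_cons, ← mul_assoc]
    by_cases hab : a = b
    · subst hab; rw [sq, zero_mul]
    · rw [anti a b hab, neg_mul, mul_assoc, ih ((List.mem_cons.1 h).resolve_left hab), mul_zero,
        neg_zero]

theorem prod_psi_eq_zero {l : List ℕ} (h : ¬ l.Nodup) : (l.map ψ).prod = 0 := by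
  induction l with
  | nil => simp at h
  | cons b l ih =>
    rw [List.map_cons, List.prod_cons]
    by_cases hb : b ∈ l
    · exact psi_mul_prod_eq_zero sq anti hb
    · rw [ih (fun hl => h (List.nodup_cons.2 ⟨hb, hl⟩)), mul_zero]

/-- A product of more than `m` linear forms in `m` anticommuting variables vanishes. -/
theorem prod_linForm_eq_zero (S : Finset ℕ) (l : List (ℕ → B)) (hl : S.card < l.length)
    (hc : ∀ g ∈ l, ∀ p q, ψ p * g q = g q * ψ p) :
    (l.map fun g => ∑ p ∈ S, g p * ψ p).prod = 0 := by
  -- Expanded, the product is a sum of terms b ψ_{p_1} ⋯ ψ_{p_s} with all p_i in `S` and s the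
  -- number of factors. The additive closure avoids naming the expansion; a repeated index then
  -- kills each term.
  have key : ∀ l : List (ℕ → B), (∀ g ∈ l, ∀ p q, ψ p * g q = g q * ψ p) →
      (l.map fun g => ∑ p ∈ S, g p * ψ p).prod ∈ AddSubgroup.closure
        {x | ∃ (b : B) (s : List ℕ), (∀ p, ψ p * b = b * ψ p) ∧ s.length = l.length ∧
          (∀ p ∈ s, p ∈ S) ∧ x = b * (s.map ψ).prod} := by
    intro l
    induction l with
    | nil =>
      intro _
      exact AddSubgroup.subset_closure ⟨1, [], by simp⟩
    | cons g l ih =>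
      intro hc
      rw [List.map_cons, List.prod_cons]
      have h := ih fun g' hg' => hc g' (List.mem_cons_of_mem _ hg')
      refine AddSubgroup.closure_induction (p := fun x _ => (∑ p ∈ S, g p * ψ p) * x ∈ _)
        ?_ ?_ ?_ ?_ h
      · rintro x ⟨b, s, hb, hs, hS, rfl⟩
        rw [Finset.sum_mul]
        refine AddSubgroup.sum_mem _ fun p hp => AddSubgroup.subset_closure
          ⟨g p * b, p :: s, ?_, by simp [hs], ?_, ?_⟩
        · intro q
          rw [← mul_assoc, hc g (List.mem_cons_self ..), mul_assoc, hb, mul_assoc]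
        · simpa [hp] using hS
        · rw [List.map_cons, List.prod_cons, mul_assoc, ← mul_assoc (ψ p), hb]
          simp only [mul_assoc]
      · simp
      · intro x z _ _ hx hz
        rw [mul_add]; exact AddSubgroup.add_mem _ hx hz
      · intro x _ hx
        rw [mul_neg]; exact AddSubgroup.neg_mem _ hx
  have h := key l hc
  rw [← AddSubgroup.mem_bot]
  refine (AddSubgroup.closure_le _).2 ?_ h
  rintro x ⟨b, s, -, hs, hS, rfl⟩
  refine AddSubgroup.mem_bot.2 ?_
  rw [prod_psi_eq_zero sq anti, mul_zero]
  intro hnd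
  have h1 := Finset.card_le_card (fun p hp => hS p (List.mem_toFinset.1 hp) : s.toFinset ⊆ S)
  rw [List.toFinset_card_of_nodup hnd] at h1
  omega

end Pigeonhole


/-! ### Descending products -/

/-- The product `g (i + m - 1) ⋯ g (i + 1) g i`. -/
def prodDesc {B : Type*} [Ring B] (g : ℕ → B) (i m : ℕ) : B :=
  ((List.range' i m).reverse.map g).prod

section ProdDesc

variable {B : Type*} [Ring B] (g : ℕ → B)

@[simp] theorem prodDesc_zero (i : ℕ) : prodDesc g i 0 = 1 := by simp [prodDesc]

theorem prodDesc_succ (i m : ℕ) : prodDesc g i (m + 1) = prodDesc g (i + 1) m * g i := by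
  simp [prodDesc, List.range'_succ]

theorem prodDesc_succ_top (i m : ℕ) : prodDesc g i (m + 1) = g (i + m) * prodDesc g i m := by
  simp [prodDesc, List.range'_concat]

theorem prodDesc_congr {g g' : ℕ → B} {i m : ℕ} (h : ∀ j, i ≤ j → j < i + m → g j = g' j) :
    prodDesc g i m = prodDesc g' i m := by
  rw [prodDesc, prodDesc]
  congr 1
  refine List.map_congr_left fun j hj => ?_
  simp only [List.mem_reverse, List.mem_range'_1] at hj
  exact h j hj.1 hj.2

end ProdDesc

/-! ### Fillings of a shape, built cell by cell -/

/-- The lower bound for half the entry in the cell `z`, coming from the cell above. -/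
def loFlag (f : ℕ × ℕ → ℕ) (z : ℕ × ℕ) : ℕ :=
  if z.1 = 0 then 0 else (f (z.1 - 1, z.2) + 1) / 2

/-- The upper bound for half the entry in the cell `z`, coming from the cell to the right. -/
def hiFlag (lam : ℕ → ℕ) (M : ℕ) (f : ℕ × ℕ → ℕ) (z : ℕ × ℕ) : ℕ :=
  if z.2 + 1 < lam z.1 then (f (z.1, z.2 + 1) + 1) / 2 else M

/-- The entry in the cell `z` is compatible with the entries above and to the right. -/
def Fits (lam : ℕ → ℕ) (M : ℕ) (f : ℕ × ℕ → ℕ) (z : ℕ × ℕ) : Prop :=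
  2 * loFlag f z ≤ f z ∧ f z < 2 * hiFlag lam M f z

/-- The sum of `Ψ` over all ways to fill the listed cells one after the other. -/
def fillSum {B : Type*} [Ring B] (lam : ℕ → ℕ) (M : ℕ) :
    List (ℕ × ℕ) → (ℕ × ℕ → ℕ) → ((ℕ × ℕ → ℕ) → B) → B
  | [], f, Ψ => Ψ f
  | z :: zs, f, Ψ => ∑ d ∈ Finset.Ico (2 * loFlag f z) (2 * hiFlag lam M f z),
      fillSum lam M zs (Function.update f z d) Ψ

/-- The cells on the `k`-th diagonal in the rows above row `i`, from bottom to top, followed by the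
cells on the earlier diagonals. -/
def remCells (lam : ℕ → ℕ) (L : ℕ) : ℕ → ℕ → List (ℕ × ℕ)
  | 0, 0 => []
  | k + 1, 0 => remCells lam L k L
  | k, i + 1 => (if L ≤ i + k ∧ i + k - L < lam i then [(i, i + k - L)] else []) ++
      remCells lam L k i
termination_by k i => (k, i)

/-- The entries on the `k`-th diagonal in the rows from row `i` on, from northwest to southeast. -/
def diagFrom (lam : ℕ → ℕ) (L : ℕ) (f : ℕ × ℕ → ℕ) (k i : ℕ) : List ℕ :=
  (List.range' i (L - i)).filterMap fun i =>
    if L ≤ i + k ∧ i + k - L < lam i then some (f (i, i + k - L)) else none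

/-- The reading word of the diagonals `0, …, k`. -/
def readWord (lam : ℕ → ℕ) (L : ℕ) (f : ℕ × ℕ → ℕ) (k : ℕ) : List ℕ :=
  (List.range (k + 1)).flatMap fun k => diagWord (diagFrom lam L f k 0)

/-! ### Iterated sums over fillings. -/

section FillSum

variable {B : Type*} [Ring B] {lam : ℕ → ℕ} {M : ℕ}

theorem fillSum_congr {zs : List (ℕ × ℕ)} {f : ℕ × ℕ → ℕ} {Ψ Ψ' : (ℕ × ℕ → ℕ) → B}
    (h : ∀ f', (∀ z ∉ zs, f' z = f z) → Ψ f' = Ψ' f') :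
    fillSum lam M zs f Ψ = fillSum lam M zs f Ψ' := by
  induction zs generalizing f with
  | nil => exact h f fun _ _ => rfl
  | cons z zs ih =>
    refine Finset.sum_congr rfl fun d _ => ih fun f' hf' => h f' fun w hw => ?_
    rw [List.mem_cons, not_or] at hw
    rw [hf' w hw.2, Function.update_of_ne hw.1]

theorem fillSum_mul (zs : List (ℕ × ℕ)) (f : ℕ × ℕ → ℕ) (Ψ : (ℕ × ℕ → ℕ) → B) (b : B) :
    fillSum lam M zs f Ψ * b = fillSum lam M zs f fun f' => Ψ f' * b := by
  induction zs generalizing f with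
  | nil => rfl
  | cons z zs ih => simp only [fillSum, Finset.sum_mul, ih]

theorem mul_fillSum (zs : List (ℕ × ℕ)) (f : ℕ × ℕ → ℕ) (Ψ : (ℕ × ℕ → ℕ) → B) (b : B) :
    b * fillSum lam M zs f Ψ = fillSum lam M zs f fun f' => b * Ψ f' := by
  induction zs generalizing f with
  | nil => rfl
  | cons z zs ih => simp only [fillSum, Finset.mul_sum, ih]

theorem hiFlag_congr {f f' : ℕ × ℕ → ℕ} {z : ℕ × ℕ} (h : f (z.1, z.2 + 1) = f' (z.1, z.2 + 1)) :
    hiFlag lam M f z = hiFlag lam M f' z := by simp [hiFlag, h]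

theorem loFlag_update {f : ℕ × ℕ → ℕ} {z w : ℕ × ℕ} {d : ℕ} (h : z.1 ≠ 0 → (z.1 - 1, z.2) ≠ w) :
    loFlag (Function.update f w d) z = loFlag f z := by
  unfold loFlag
  split_ifs with h0
  · rfl
  · rw [Function.update_of_ne (h h0)]

theorem hiFlag_update {f : ℕ × ℕ → ℕ} {z w : ℕ × ℕ} {d : ℕ} (h : (z.1, z.2 + 1) ≠ w) :
    hiFlag lam M (Function.update f w d) z = hiFlag lam M f z := by
  unfold hiFlag
  rw [Function.update_of_ne h]

/-- The iterated sum over fillings is a sum over the set of all compatible fillings. -/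
theorem exists_fillSum_eq_sum {zs : List (ℕ × ℕ)} (hnd : zs.Nodup)
    (hord : zs.Pairwise fun z w => (z.1 ≠ 0 → (z.1 - 1, z.2) ≠ w) ∧ (z.1, z.2 + 1) ≠ w)
    (f : ℕ × ℕ → ℕ) :
    ∃ S : Finset (ℕ × ℕ → ℕ),
      (∀ f', f' ∈ S ↔ (∀ z ∉ zs, f' z = f z) ∧ ∀ z ∈ zs, Fits lam M f' z) ∧
      ∀ Ψ : (ℕ × ℕ → ℕ) → B, fillSum lam M zs f Ψ = ∑ f' ∈ S, Ψ f' := by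
  classical
  induction zs generalizing f with
  | nil =>
    refine ⟨{f}, fun f' => ?_, fun Ψ => by simp [fillSum]⟩
    simp [funext_iff]
  | cons z zs ih =>
    rw [List.nodup_cons] at hnd
    rw [List.pairwise_cons] at hord
    choose S hS hΨ using fun d => ih hnd.2 hord.2 (Function.update f z d)
    have hval : ∀ d f', f' ∈ S d → f' z = d := fun d f' h => by
      rw [((hS d f').1 h).1 z hnd.1, Function.update_self]
    -- By `hord` no later cell lies directly above or to the right of z, so later choices do not
    -- affect the bounds at z.
    have hflag : ∀ d f', f' ∈ S d → loFlag f' z = loFlag f z ∧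
        hiFlag lam M f' z = hiFlag lam M f z := by
      intro d f' h
      have h1 := ((hS d f').1 h).1
      constructor
      · unfold loFlag
        split_ifs with h0
        · rfl
        · rw [h1 _ fun hm => (hord.1 _ hm).1 h0 rfl, Function.update_of_ne]
          intro e
          have := congrArg Prod.fst e
          simp only at this
          omega
      · apply hiFlag_congr
        rw [h1 _ fun hm => (hord.1 _ hm).2 rfl, Function.update_of_ne]
        intro e
        simpa using congrArg Prod.snd e
    refine ⟨(Finset.Ico (2 * loFlag f z) (2 * hiFlag lam M f z)).biUnion S, fun f' => ?_,
      fun Ψ => ?_⟩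
    · simp only [Finset.mem_biUnion, Finset.mem_Ico]
      constructor
      · rintro ⟨d, hd, hf'⟩
        have h1 := (hS d f').1 hf'
        have h2 := hflag d f' hf'
        refine ⟨fun w hw => ?_, fun w hw => ?_⟩
        · rw [List.mem_cons, not_or] at hw
          rw [h1.1 w hw.2, Function.update_of_ne hw.1]
        · rcases List.mem_cons.1 hw with rfl | hw
          · rw [Fits, h2.1, h2.2, hval d f' hf']; exact hd
          · exact h1.2 w hw
      · rintro ⟨h1, h2⟩
        have hmem : f' ∈ S (f' z) := by
          refine (hS _ _).2 ⟨fun w hw => ?_, fun w hw => h2 w (List.mem_cons_of_mem _ hw)⟩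
          by_cases hwz : w = z
          · rw [hwz, Function.update_self]
          · rw [Function.update_of_ne hwz, h1 w (by simp [hwz, hw])]
        have h3 := h2 z (List.mem_cons_self ..)
        have h4 := hflag _ _ hmem
        rw [Fits, h4.1, h4.2] at h3
        exact ⟨f' z, h3, hmem⟩
    · rw [Finset.sum_biUnion]
      · exact Finset.sum_congr rfl fun d _ => hΨ d Ψ
      · intro d _ d' _ hne
        refine Finset.disjoint_left.2 fun f' h h' => hne ?_
        rw [← hval d f' h, ← hval d' f' h']

end FillSum

/-! ### The order in which the cells are filled. -/

section Cells

variable {lam : ℕ → ℕ} {L : ℕ}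

theorem remCells_zero_zero : remCells lam L 0 0 = [] := by rw [remCells]

theorem remCells_succ_zero (k : ℕ) : remCells lam L (k + 1) 0 = remCells lam L k L := by
  rw [remCells]

theorem remCells_succ (k i : ℕ) : remCells lam L k (i + 1) =
    (if L ≤ i + k ∧ i + k - L < lam i then [(i, i + k - L)] else []) ++ remCells lam L k i := by
  rw [remCells]

/-- Induction along the order in which the cells are filled. -/
theorem reading_induction {P : ℕ → ℕ → Prop} (L : ℕ) (h00 : P 0 0)
    (hk : ∀ k, P k L → P (k + 1) 0) (hi : ∀ k i, i < L → P k i → P k (i + 1)) (k i : ℕ)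
    (h : i ≤ L) : P k i := by
  have hrow : ∀ k, P k 0 → ∀ i ≤ L, P k i := by
    intro k h0 i
    induction i with
    | zero => exact fun _ => h0
    | succ i ih => exact fun h => hi k i h (ih (by omega))
  induction k generalizing i with
  | zero => exact hrow 0 h00 i h
  | succ k ih => exact hrow _ (hk k (ih L le_rfl)) i h

/-- The cell (a, b) lies on the diagonal b + L - a; writing b + L against k + a avoids truncated
subtraction. -/
theorem mem_remCells {k i : ℕ} (h : i ≤ L) (z : ℕ × ℕ) : z ∈ remCells lam L k i ↔
    z.1 < L ∧ z.2 < lam z.1 ∧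
      (z.2 + L < k + z.1 ∨ (z.2 + L = k + z.1 ∧ z.1 < i)) := by
  refine reading_induction (P := fun k i => z ∈ remCells lam L k i ↔ z.1 < L ∧ z.2 < lam z.1 ∧
      (z.2 + L < k + z.1 ∨ (z.2 + L = k + z.1 ∧ z.1 < i))) L ?_ ?_ ?_ k i h
  · rw [remCells_zero_zero]; simp; omega
  · intro k ih
    rw [remCells_succ_zero, ih]
    refine and_congr_right fun h1 => and_congr_right fun h2 => ?_
    omega
  · intro k i hi ih
    rw [remCells_succ, List.mem_append, ih]
    obtain ⟨a, b⟩ := z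
    dsimp only
    split_ifs with hc
    · rw [List.mem_singleton, Prod.mk.injEq]
      constructor
      · rintro (⟨rfl, rfl⟩ | ⟨h1, h2, h3⟩)
        · exact ⟨hi, hc.2, Or.inr (by omega)⟩
        · exact ⟨h1, h2, by omega⟩
      · rintro ⟨h1, h2, h3⟩
        by_cases ha : a = i ∧ b + L = k + a
        · left; omega
        · right; exact ⟨h1, h2, by omega⟩
    · constructor
      · rintro (h | ⟨h1, h2, h3⟩)
        · simp at h
        · exact ⟨h1, h2, by omega⟩
      · rintro ⟨h1, h2, h3⟩
        refine Or.inr ⟨h1, h2, ?_⟩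
        by_contra hcon
        obtain rfl : a = i := by omega
        exact hc ⟨by omega, by rwa [show a + k - L = b by omega]⟩

theorem nodup_remCells {k i : ℕ} (h : i ≤ L) : (remCells lam L k i).Nodup := by
  refine reading_induction (P := fun k i => (remCells lam L k i).Nodup) L ?_ ?_ ?_ k i h
  · rw [remCells_zero_zero]; simp
  · intro k ih; rwa [remCells_succ_zero]
  · intro k i hi ih
    rw [remCells_succ]
    split_ifs with hc
    · rw [List.singleton_append, List.nodup_cons, mem_remCells hi.le]
      exact ⟨by dsimp only; omega, ih⟩
    · simpa using ih

/-- The cells directly above and to the right of a given cell both lie on the next diagonal to the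
northeast, and those diagonals come earlier in the list. -/
theorem pairwise_remCells {k i : ℕ} (h : i ≤ L) : (remCells lam L k i).Pairwise
    fun z w => (z.1 ≠ 0 → (z.1 - 1, z.2) ≠ w) ∧ (z.1, z.2 + 1) ≠ w := by
  refine reading_induction (P := fun k i => (remCells lam L k i).Pairwise
    fun z w => (z.1 ≠ 0 → (z.1 - 1, z.2) ≠ w) ∧ (z.1, z.2 + 1) ≠ w) L ?_ ?_ ?_ k i h
  · rw [remCells_zero_zero]; simp
  · intro k ih; rwa [remCells_succ_zero]
  · intro k i hi ih
    rw [remCells_succ]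
    split_ifs with hc
    · rw [List.singleton_append, List.pairwise_cons]
      refine ⟨fun w hw => ?_, ih⟩
      rw [mem_remCells hi.le] at hw
      obtain ⟨a, b⟩ := w
      dsimp only at hw ⊢
      simp only [ne_eq, Prod.mk.injEq, not_and]
      omega
    · simpa using ih

theorem diagFrom_of_lt {f : ℕ × ℕ → ℕ} {k i : ℕ} (h : i < L) : diagFrom lam L f k i =
    (if L ≤ i + k ∧ i + k - L < lam i then [f (i, i + k - L)] else []) ++
      diagFrom lam L f k (i + 1) := by
  rw [diagFrom, diagFrom, show L - i = L - (i + 1) + 1 by omega, List.range'_succ]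
  split_ifs with hc <;> simp [hc]

@[simp] theorem diagFrom_self (f : ℕ × ℕ → ℕ) (k : ℕ) : diagFrom lam L f k L = [] := by
  simp [diagFrom]

theorem mem_diagFrom {f : ℕ × ℕ → ℕ} {k i e : ℕ} : e ∈ diagFrom lam L f k i ↔
    ∃ a, i ≤ a ∧ a < L ∧ L ≤ a + k ∧ a + k - L < lam a ∧ f (a, a + k - L) = e := by
  simp only [diagFrom, List.mem_filterMap, List.mem_range'_1]
  constructor
  · rintro ⟨a, ha, h⟩
    split_ifs at h with hc
    exact ⟨a, ha.1, by omega, hc.1, hc.2, by simpa using h⟩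
  · rintro ⟨a, h1, h2, h3, h4, h5⟩
    exact ⟨a, by omega, by simp [h3, h4, h5]⟩

theorem diagFrom_congr {f f' : ℕ × ℕ → ℕ} {k i : ℕ}
    (h : ∀ a, i ≤ a → L ≤ a + k → f (a, a + k - L) = f' (a, a + k - L)) :
    diagFrom lam L f k i = diagFrom lam L f' k i := by
  rw [diagFrom, diagFrom]
  refine List.filterMap_congr fun a ha => ?_
  have ha := (List.mem_range'_1.1 ha).1
  split_ifs with hc
  · rw [h a ha hc.1]
  · rfl

end Cells


/-! ### Peeling off the diagonals -/

section Peel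

variable {B : Type*} [Ring B]

/-- The flag of row `i` when the diagonals from the `k`-th one on have been filled. -/
def rowFlag (lam : ℕ → ℕ) (M L : ℕ) (f : ℕ × ℕ → ℕ) (k i : ℕ) : ℕ :=
  if L ≤ i + k ∧ i + k - L < lam i then (f (i, i + k - L) + 1) / 2 else M

/-- The linear form of row `i` when the diagonals from the `k`-th one on have been filled. -/
def rowForm (y ψ : ℕ → B) (lam : ℕ → ℕ) (M L : ℕ) (f : ℕ × ℕ → ℕ) (k i : ℕ) : B :=
  -- Row i has its columns below i + k - L still unfilled, hence min(λ_i, i + k - L) cells;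
  -- subtracting i gives the shift. When i + k < L nothing is left and the row is represented by
  -- ψ_i.
  if L ≤ i + k then
    complForm y ψ L (rowFlag lam M L f k i) (min ((lam i : ℤ) - i) ((k : ℤ) - L))
  else ψ i

/-- The product of the row forms when the diagonals after the `k`-th one and the rows from row `i`
on of the `k`-th one have been filled. -/
def peelState (y ψ : ℕ → B) (lam : ℕ → ℕ) (M L : ℕ) (f : ℕ × ℕ → ℕ) (k i : ℕ) : B :=
  prodDesc (rowForm y ψ lam M L f k) i (L - i) *
    monomialOf y (diagWord (diagFrom lam L f k i)) *
    prodDesc (rowForm y ψ lam M L f (k + 1)) 0 i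

/-- The entries outside the remaining cells are compatible with their neighbours. -/
def FitsFrom (lam : ℕ → ℕ) (M L : ℕ) (f : ℕ × ℕ → ℕ) (k i : ℕ) : Prop :=
  ∀ a b, a < L → b < lam a → (k + a < b + L ∨ (b + L = k + a ∧ i ≤ a)) → Fits lam M f (a, b)

variable {lam : ℕ → ℕ} {M L : ℕ} {f : ℕ × ℕ → ℕ} {k i : ℕ}

theorem FitsFrom.lt_two_mul (hf : FitsFrom lam M L f k i) {a b : ℕ} (ha : a < L) (hb : b < lam a)
    (h : k + a < b + L ∨ (b + L = k + a ∧ i ≤ a)) : f (a, b) < 2 * M := by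
  obtain ⟨n, hn⟩ : ∃ n, n = lam a - b := ⟨_, rfl⟩
  induction n generalizing b with
  | zero => omega
  | succ n ih =>
    have h1 := (hf a b ha hb h).2
    rw [hiFlag] at h1
    split_ifs at h1 with hc
    · have h2 := ih hc (by omega) (by omega)
      dsimp only at h1 h2
      omega
    · exact h1

variable (hlam : Antitone lam)
include hlam

omit hlam in
theorem FitsFrom.update (hf : FitsFrom lam M L f k (i + 1)) {d : ℕ} (hL : L ≤ i + k)
    (hd : d ∈ Finset.Ico (2 * loFlag f (i, i + k - L)) (2 * hiFlag lam M f (i, i + k - L))) :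
    FitsFrom lam M L (Function.update f (i, i + k - L) d) k i := by
  intro a b ha hb hab
  by_cases h : a = i ∧ b = i + k - L
  · obtain ⟨rfl, rfl⟩ := h
    rw [Fits, Function.update_self, loFlag_update, hiFlag_update]
    · exact Finset.mem_Ico.1 hd
    · simp
    · simp only [ne_eq, Prod.mk.injEq, not_and]; omega
  · have h1 := hf a b ha hb (by omega)
    rw [Fits, Function.update_of_ne, loFlag_update, hiFlag_update]
    · exact h1
    · simp only [ne_eq, Prod.mk.injEq, not_and]; omega
    · simp only [ne_eq, Prod.mk.injEq, not_and]; omega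
    · simp only [ne_eq, Prod.mk.injEq]; exact h

/-- The entries on a diagonal are separated by the flags of the previous diagonal. -/
theorem FitsFrom.le_diag (hf : FitsFrom lam M L f k (i + 1)) (hL : L ≤ i + k) {a : ℕ}
    (hia : i < a) (ha : a < L) (hc : a + k - L < lam a) :
    2 * hiFlag lam M f (i, i + k - L) ≤ f (a, a + k - L) ∧
      (i + 1 < a → 2 * hiFlag lam M f (i, i + k - L) + 2 ≤ f (a, a + k - L)) := by
  induction a, hia using Nat.le_induction with
  | base =>
    refine ⟨?_, fun h => absurd h (by omega)⟩
    simp only [Nat.succ_eq_add_one] at ha hc ⊢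
    have h1 := (hf (i + 1) (i + 1 + k - L) ha hc (by omega)).1
    have h2 := hlam (Nat.le_succ i)
    have e : i + 1 + k - L = i + k - L + 1 := by omega
    have h3 : i + k - L + 1 < lam i := by simp only [Nat.succ_eq_add_one] at h2; omega
    rw [loFlag, if_neg (by simp)] at h1
    rw [hiFlag, if_pos h3]
    simp only [e, Nat.add_sub_cancel] at h1 ⊢
    exact h1
  | succ a hia ih =>
    have h2 := hlam (Nat.le_succ a)
    simp only [Nat.succ_eq_add_one] at h2 hia
    have h0 := (ih (by omega) (by omega)).1
    have h1 := (hf (a + 1) (a + 1 + k - L) ha hc (by omega)).1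
    have e : a + 1 + k - L = a + k - L + 1 := by omega
    have h3 : a + k - L + 1 < lam a := by omega
    have h4 := (hf a (a + k - L) (by omega) (by omega) (by omega)).2
    rw [loFlag, if_neg (by simp)] at h1
    rw [hiFlag, if_pos h3] at h4
    simp only [e, Nat.add_sub_cancel] at h1 h4 ⊢
    omega

/-- The cell to the northeast separates the entry above from the entry to the right; at the end of a
row the bound is M. `complForm_sub` needs this inequality, since an interval with reversed ends
would not telescope. -/
theorem FitsFrom.loFlag_le (hf : FitsFrom lam M L f k (i + 1)) (hi : i < L) (hL : L ≤ i + k)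
    (hc : i + k - L < lam i) :
    loFlag f (i, i + k - L) ≤ hiFlag lam M f (i, i + k - L) := by
  rw [loFlag]
  split_ifs with h0
  · exact Nat.zero_le _
  · obtain ⟨a, rfl⟩ : ∃ a, i = a + 1 := ⟨i - 1, by dsimp only at h0; omega⟩
    have h2 := hlam (Nat.le_succ a)
    simp only [Nat.succ_eq_add_one] at h2
    simp only [Nat.add_sub_cancel]
    have h5 := hf.lt_two_mul (a := a) (b := a + 1 + k - L) (by omega) (by omega) (by omega)
    rw [hiFlag]
    dsimp only
    split_ifs with h3
    · have h1 := (hf (a + 1) (a + 1 + k - L + 1) hi h3 (by omega)).1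
      have h4 := (hf a (a + 1 + k - L) (by omega) (by omega) (by omega)).2
      rw [loFlag, if_neg (by simp)] at h1
      rw [hiFlag, if_pos (by dsimp only; omega)] at h4
      simp only [Nat.add_sub_cancel] at h1 h4
      omega
    · omega

theorem diagFrom_eq_nil (h : lam i ≤ i + k - L) (hL : L ≤ i + k) :
    diagFrom lam L f k i = [] := by
  refine List.eq_nil_iff_forall_not_mem.2 fun e he => ?_
  obtain ⟨a, h1, h2, h3, h4, -⟩ := mem_diagFrom.1 he
  have := hlam h1
  omega

omit hlam in
theorem rowForm_congr (y ψ : ℕ → B) {f f' : ℕ × ℕ → ℕ} {k i : ℕ}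
    (h : f (i, i + k - L) = f' (i, i + k - L)) :
    rowForm y ψ lam M L f k i = rowForm y ψ lam M L f' k i := by
  simp only [rowForm, rowFlag, h]

variable {y ψ : ℕ → B} (hψ : GrassmannFor y ψ) (hy : KronLetters y)
include hψ hy

/-- The entry above the cell defines both the lower flag and the flag of the preceding row, so the
first two factors are the same form. In the top row the lower flag is 0, and complete sums of
positive degree in no letters vanish. -/
theorem complForm_mul_rows_eq_zero (hL : L ≤ i + k) (hc : i + k - L < lam i) :
    complForm y ψ L (loFlag f (i, i + k - L)) ((k : ℤ) - L + 1) *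
      prodDesc (rowForm y ψ lam M L f (k + 1)) 0 i = 0 := by
  rcases i with _ | i
  · have h : complForm y ψ L (loFlag f (0, 0 + k - L)) ((k : ℤ) - L + 1) = 0 := by
      rw [complForm, linForm]
      refine Finset.sum_eq_zero fun p _ => ?_
      rw [loFlag, if_pos rfl, mul_zero, csum_zero_left _ (by omega), zero_mul]
    rw [h, zero_mul]
  · have h2 := hlam (Nat.le_succ i)
    simp only [Nat.succ_eq_add_one] at h2
    have e : i + (k + 1) - L = i + 1 + k - L := by omega
    have h : rowForm y ψ lam M L f (k + 1) i =
        complForm y ψ L (loFlag f (i + 1, i + 1 + k - L)) ((k : ℤ) - L + 1) := by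
      rw [rowForm, if_pos (by omega), rowFlag, if_pos (by omega), loFlag, if_neg (by simp), e]
      congr 1
      push_cast
      rw [min_eq_right (by omega)]
      ring
    rw [prodDesc_succ_top, zero_add, h, ← mul_assoc, hψ.complForm_sq hy, zero_mul]

/-- Adding one cell. -/
theorem peelState_cell (hf : FitsFrom lam M L f k (i + 1)) (hi : i < L) (hL : L ≤ i + k)
    (hc : i + k - L < lam i) :
    peelState y ψ lam M L f k (i + 1) =
      ∑ d ∈ Finset.Ico (2 * loFlag f (i, i + k - L)) (2 * hiFlag lam M f (i, i + k - L)),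
        peelState y ψ lam M L (Function.update f (i, i + k - L) d) k i := by
  set n := hiFlag lam M f (i, i + k - L) with hn
  set lo := loFlag f (i, i + k - L) with hlo
  set R := prodDesc (rowForm y ψ lam M L f (k + 1)) 0 i with hR
  set D := diagFrom lam L f k (i + 1) with hD
  set A := prodDesc (rowForm y ψ lam M L f k) (i + 1) (L - (i + 1)) with hA
  have hlon : lo ≤ n := hf.loFlag_le hlam hi hL hc
  have hrow : rowForm y ψ lam M L f (k + 1) i = complForm y ψ L n ((k : ℤ) - L + 1) := by
    rw [rowForm, if_pos (by omega), rowFlag, hn, hiFlag]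
    have e : i + (k + 1) - L = i + k - L + 1 := by omega
    have h1 : L ≤ i + (k + 1) := by omega
    simp only [h1, e, true_and]
    congr 1
    push_cast
    rw [min_eq_right (by omega)]
    ring
  have hstate : ∀ d, peelState y ψ lam M L (Function.update f (i, i + k - L) d) k i =
      A * complForm y ψ L ((d + 1) / 2) ((k : ℤ) - L) * monomialOf y (diagWord (d :: D)) * R := by
    intro d
    have e1 : prodDesc (rowForm y ψ lam M L (Function.update f (i, i + k - L) d) k) (i + 1)
        (L - (i + 1)) = A := by
      refine prodDesc_congr fun j hj _ => rowForm_congr y ψ (Function.update_of_ne ?_ _ _)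
      simp only [ne_eq, Prod.mk.injEq, not_and]; omega
    have e2 : prodDesc (rowForm y ψ lam M L (Function.update f (i, i + k - L) d) (k + 1)) 0 i =
        R := by
      refine prodDesc_congr fun j hj _ => rowForm_congr y ψ (Function.update_of_ne ?_ _ _)
      simp only [ne_eq, Prod.mk.injEq, not_and]; omega
    have e3 : diagFrom lam L (Function.update f (i, i + k - L) d) k (i + 1) = D := by
      refine diagFrom_congr fun a ha _ => Function.update_of_ne ?_ _ _
      simp only [ne_eq, Prod.mk.injEq, not_and]; omega
    have e4 : rowForm y ψ lam M L (Function.update f (i, i + k - L) d) k i =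
        complForm y ψ L ((d + 1) / 2) ((k : ℤ) - L) := by
      rw [rowForm, if_pos hL, rowFlag, if_pos ⟨hL, hc⟩, Function.update_self]
      congr 1
      exact min_eq_right (by omega)
    rw [peelState, show L - i = L - (i + 1) + 1 by omega, prodDesc_succ, e1, e2, e4,
      diagFrom_of_lt hi, if_pos ⟨hL, hc⟩, e3, Function.update_self]
    rfl
  have hz : complForm y ψ L lo ((k : ℤ) - L + 1) * R = 0 :=
    complForm_mul_rows_eq_zero hlam hψ hy hL hc
  -- A row operation: subtracting the form with flag `lo` does not change the product and removes
  -- the entries too small for the cell above.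
  have hstart : peelState y ψ lam M L f k (i + 1) = A * monomialOf y (diagWord D) *
      (complForm y ψ L n ((k : ℤ) - L + 1) - complForm y ψ L lo ((k : ℤ) - L + 1)) * R := by
    rw [mul_assoc, sub_mul, hz, sub_zero, ← hrow, peelState, prodDesc_succ_top, zero_add]
  rw [hstart]
  simp only [hstate]
  by_cases hnext : i + 1 < L ∧ i + 1 + k - L < lam (i + 1)
  · obtain ⟨a, ha⟩ : ∃ a, a = f (i + 1, i + 1 + k - L) := ⟨_, rfl⟩
    have hDa : D = a :: diagFrom lam L f k (i + 1 + 1) := by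
      rw [hD, diagFrom_of_lt hnext.1, if_pos ⟨by omega, hnext.2⟩, ha]; rfl
    have hAa : A = prodDesc (rowForm y ψ lam M L f k) (i + 1 + 1) (L - (i + 1 + 1)) *
        complForm y ψ L ((a + 1) / 2) ((k : ℤ) - L) := by
      rw [hA, show L - (i + 1) = L - (i + 1 + 1) + 1 by omega, prodDesc_succ]
      congr 1
      rw [rowForm, if_pos (by omega), rowFlag, if_pos ⟨by omega, hnext.2⟩, ha]
      congr 1
      exact min_eq_right (by omega)
    have h1 : 2 * n ≤ a := by
      rw [ha]; exact (hf.le_diag hlam hL (by omega) hnext.1 hnext.2).1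
    have h2 : ∀ z ∈ diagFrom lam L f k (i + 1 + 1), 2 * n + 2 ≤ z := by
      intro z hz
      obtain ⟨b, hb1, hb2, hb3, hb4, rfl⟩ := mem_diagFrom.1 hz
      exact (hf.le_diag hlam hL (by omega) hb2 hb4).2 (by omega)
    have key := hψ.complForm_mul_diagWord hy L hlon h1 h2 ((k : ℤ) - L)
    rw [hAa, hDa, mul_assoc, mul_assoc, mul_assoc, ← mul_assoc (monomialOf _ _),
      ← mul_assoc (complForm _ _ _ _ _), ← mul_assoc (complForm _ _ _ _ _), key, Finset.sum_mul,
      Finset.mul_sum]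
    refine Finset.sum_congr rfl fun d _ => ?_
    simp only [mul_assoc]
  -- If the next cell of the diagonal is outside the shape, so are all later ones, and there is no
  -- letter to pass.
  · have hDn : D = [] := by
      by_cases hi1 : i + 1 = L
      · rw [hD, hi1, diagFrom_self]
      · exact diagFrom_eq_nil hlam (by omega) (by omega)
    rw [hDn, monomialOf_diagWord_nil, mul_one, hψ.complForm_sub L hlon, Finset.mul_sum,
      Finset.sum_mul]
    refine Finset.sum_congr rfl fun d _ => ?_
    rw [monomialOf_diagWord_cons]
    simp [oddPart, evenPart, monomialOf, mul_assoc]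

omit hy hψ hlam in
theorem complForm_eq_sum_Ico (n : ℕ) {i : ℕ} {K : ℤ} (hK : K ≤ -i) :
    complForm y ψ L n K = ∑ p ∈ Finset.Ico i L, csum y (2 * n) (K + p) * ψ p := by
  rw [complForm, linForm, ← Finset.sum_subset (s₁ := Finset.Ico i L)]
  · intro p hp
    simp only [Finset.mem_Ico, Finset.mem_range] at hp ⊢
    exact hp.2
  · intro p hp hp'
    simp only [Finset.mem_Ico, Finset.mem_range] at hp hp'
    rw [csum_of_neg _ _ (by omega), zero_mul]

omit hy hlam in
/-- An exhausted row contributes a single anticommuting variable. -/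
theorem peelState_exhausted (hi : i < L) (hik : i + k + 1 = L) :
    peelState y ψ lam M L f k (i + 1) = peelState y ψ lam M L f k i := by
  set R := prodDesc (rowForm y ψ lam M L f (k + 1)) 0 i with hR
  set A := prodDesc (rowForm y ψ lam M L f k) (i + 1) (L - (i + 1)) with hA
  set w := monomialOf y (diagWord (diagFrom lam L f k (i + 1))) with hw
  have hrowk : rowForm y ψ lam M L f k i = ψ i := by rw [rowForm, if_neg (by omega)]
  have hrow : rowForm y ψ lam M L f (k + 1) i =
      complForm y ψ L (rowFlag lam M L f (k + 1) i) (-(i : ℤ)) := by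
    rw [rowForm, if_pos (by omega)]
    congr 1
    push_cast
    rw [min_eq_right (by omega)]
    omega
  -- The L - i - 1 rows below row i start in degree at most -i - 1 and so involve only ψ_p with i <
  -- p < L. One more form in these variables is one too many.
  have hAz : ∀ g : ℕ → B, (∀ p q, ψ p * g q = g q * ψ p) →
      A * (∑ p ∈ Finset.Ico (i + 1) L, g p * ψ p) = 0 := by
    intro g hg
    have h1 := prod_linForm_eq_zero hψ.sq hψ.anti (Finset.Ico (i + 1) L)
      (((List.range' (i + 1) (L - (i + 1))).reverse.map fun (j p : ℕ) =>
        csum y (2 * rowFlag lam M L f k j) (min ((lam j : ℤ) - j) ((k : ℤ) - L) + p)) ++ [g])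
      (by simp) ?_
    · rw [List.map_append, List.prod_append, List.map_map, List.map_singleton,
        List.prod_singleton] at h1
      rw [← h1, hA, prodDesc]
      congr 2
      refine List.map_congr_left fun j hj => ?_
      simp only [List.mem_reverse, List.mem_range'_1] at hj
      rw [rowForm, if_pos (by omega), complForm_eq_sum_Ico _ (i := i + 1)]
      · rfl
      · refine (min_le_right _ _).trans ?_
        push_cast
        omega
    · intro g' hg' p q
      rcases List.mem_append.1 hg' with h | h
      · obtain ⟨j, -, rfl⟩ := List.mem_map.1 h
        exact hψ.csum_comm_psi _ _ _
      · rw [List.mem_singleton.1 h, hg]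
  -- The coefficient of ψ_i is h_0 = 1, those of smaller index have negative degree, and those of
  -- larger index will be killed by the rows below.
  have hsplit : complForm y ψ L (rowFlag lam M L f (k + 1) i) (-(i : ℤ)) = ψ i +
      ∑ p ∈ Finset.Ico (i + 1) L,
        csum y (2 * rowFlag lam M L f (k + 1) i) (-(i : ℤ) + p) * ψ p := by
    rw [complForm_eq_sum_Ico _ le_rfl, Finset.sum_eq_sum_Ico_succ_bot hi]
    simp
  have hcw : ∀ p, ψ p * w = w * ψ p := fun p => hψ.monomialOf_comm_psi _ p
  have h0 : A * w * ∑ p ∈ Finset.Ico (i + 1) L,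
      csum y (2 * rowFlag lam M L f (k + 1) i) (-(i : ℤ) + p) * ψ p = 0 := by
    rw [mul_assoc, Finset.mul_sum]
    simp only [← mul_assoc w]
    refine hAz _ fun p q => ?_
    rw [← mul_assoc, hcw, mul_assoc, hψ.csum_comm_psi, mul_assoc]
  have hdiag : diagFrom lam L f k i = diagFrom lam L f k (i + 1) := by
    rw [diagFrom_of_lt hi, if_neg (by omega), List.nil_append]
  rw [peelState, peelState, prodDesc_succ_top, zero_add, hrow, hsplit, ← mul_assoc, mul_add, h0,
    add_zero, show L - i = L - (i + 1) + 1 by omega, prodDesc_succ, hrowk, hdiag, mul_assoc A w,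
    ← hcw, ← mul_assoc A]

omit hy in
/-- A row that has no cell on the current diagonal and is not exhausted there is unchanged. -/
theorem peelState_unchanged (hi : i < L) (hik : i + k + 1 ≠ L)
    (hc : ¬(L ≤ i + k ∧ i + k - L < lam i)) :
    peelState y ψ lam M L f k (i + 1) = peelState y ψ lam M L f k i := by
  have hdiag : diagFrom lam L f k i = diagFrom lam L f k (i + 1) := by
    rw [diagFrom_of_lt hi, if_neg hc, List.nil_append]
  have hcomm : monomialOf y (diagWord (diagFrom lam L f k (i + 1))) *
      rowForm y ψ lam M L f (k + 1) i =
      rowForm y ψ lam M L f k i * monomialOf y (diagWord (diagFrom lam L f k (i + 1))) := by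
    by_cases hL : L ≤ i + k
    · rw [← hdiag, diagFrom_eq_nil hlam (by omega) hL, monomialOf_diagWord_nil, one_mul, mul_one,
        rowForm, rowForm, if_pos (by omega), if_pos hL, rowFlag, rowFlag, if_neg (by omega),
        if_neg hc, min_eq_left (by push_cast; omega), min_eq_left (by omega)]
    · rw [rowForm, rowForm, if_neg (by omega), if_neg hL, hψ.monomialOf_comm_psi]
  rw [peelState, peelState, prodDesc_succ_top, zero_add, show L - i = L - (i + 1) + 1 by omega,
    prodDesc_succ, hdiag, mul_assoc, ← mul_assoc (monomialOf _ _), hcomm]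
  simp only [mul_assoc]

/-- The state of the peeling process is the sum over all completions of the filling. -/
theorem peelState_eq_fillSum (hi : i ≤ L) (hf : FitsFrom lam M L f k i) :
    peelState y ψ lam M L f k i = fillSum lam M (remCells lam L k i) f fun f' =>
      prodDesc ψ 0 L * monomialOf y (readWord lam L f' k) := by
  refine reading_induction (P := fun k i => ∀ f, FitsFrom lam M L f k i →
    peelState y ψ lam M L f k i = fillSum lam M (remCells lam L k i) f fun f' =>
      prodDesc ψ 0 L * monomialOf y (readWord lam L f' k)) L ?_ ?_ ?_ k i hi f hf
  · intro f _
    rw [remCells_zero_zero, fillSum, peelState, prodDesc_zero, mul_one, Nat.sub_zero]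
    congr 1
    · refine prodDesc_congr fun j _ hj => ?_
      rw [rowForm, if_neg (by omega)]
    · simp [readWord]
  · intro k ih f hf
    have h1 := ih f fun a b ha hb hab => hf a b ha hb (by omega)
    rw [peelState, Nat.sub_self, prodDesc_zero, diagFrom_self, monomialOf_diagWord_nil, one_mul,
      one_mul] at h1
    rw [peelState, prodDesc_zero, mul_one, Nat.sub_zero, h1, remCells_succ_zero, fillSum_mul]
    refine fillSum_congr fun f' hf' => ?_
    have e : diagFrom lam L f (k + 1) 0 = diagFrom lam L f' (k + 1) 0 := by
      refine diagFrom_congr fun a _ ha => (hf' _ ?_).symm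
      rw [mem_remCells le_rfl]
      dsimp only
      omega
    have e2 : readWord lam L f' (k + 1) =
        readWord lam L f' k ++ diagWord (diagFrom lam L f' (k + 1) 0) := by
      simp [readWord, List.range_succ (n := k + 1)]
    rw [e2, monomialOf_append, e, mul_assoc]
  · intro k i hi ih f hf
    rw [remCells_succ]
    by_cases hc : L ≤ i + k ∧ i + k - L < lam i
    · rw [if_pos hc, List.singleton_append, fillSum, peelState_cell hlam hψ hy hf hi hc.1 hc.2]
      exact Finset.sum_congr rfl fun d hd => ih _ (hf.update hc.1 hd)
    · rw [if_neg hc, List.nil_append]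
      have hf' : FitsFrom lam M L f k i := by
        intro a b ha hb hab
        by_cases h : a = i ∧ b + L = k + a
        · obtain ⟨rfl, h2⟩ := h
          exact absurd ⟨by omega, by rwa [show a + k - L = b by omega]⟩ hc
        · exact hf a b ha hb (by omega)
      rw [← ih f hf']
      by_cases hik : i + k + 1 = L
      · exact peelState_exhausted hψ hi hik
      · exact peelState_unchanged hlam hψ hi hik hc

/-- The product of the row forms of a shape is a sum over fillings. -/
theorem prodDesc_complForm_eq_fillSum (k : ℕ) (hk : L + lam 0 ≤ k + 1) :
    prodDesc (fun i => complForm y ψ L M ((lam i : ℤ) - i)) 0 L =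
      prodDesc ψ 0 L * fillSum lam M (remCells lam L k L) 0 fun f' =>
        monomialOf y (readWord lam L f' k) := by
  rw [mul_fillSum, ← peelState_eq_fillSum hlam hψ hy le_rfl, peelState, Nat.sub_self,
    prodDesc_zero, diagFrom_self, monomialOf_diagWord_nil, one_mul, one_mul]
  · refine prodDesc_congr fun i _ hi => ?_
    have h1 : lam i ≤ lam 0 := hlam (Nat.zero_le i)
    rw [rowForm, if_pos (by omega), rowFlag, if_neg (by omega),
      min_eq_left (by push_cast; omega)]
  · intro a b ha hb hab
    have h1 : lam a ≤ lam 0 := hlam (Nat.zero_le a)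
    omega

end Peel


/-! ### Fillings and colored tableaux -/

namespace Letter

variable {N : ℕ}

/-- The position of a letter, counted from `1`. -/
def idx (x : Letter N) : ℕ := x.pos + 1

theorem idx_injective : Function.Injective (idx : Letter N → ℕ) := fun _ _ h =>
  pos_injective (Nat.succ_injective h)

theorem le_iff_idx {x y : Letter N} : x ≤ y ↔ x.idx ≤ y.idx := by
  change x.pos ≤ y.pos ↔ _
  simp [idx]

theorem lt_iff_idx {x y : Letter N} : x < y ↔ x.idx < y.idx := by
  rw [lt_iff_not_ge, le_iff_idx, not_le]

theorem idx_mod_two (x : Letter N) : x.idx % 2 = if x.IsBarred = true then 0 else 1 := by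
  rcases x with a | a <;> simp only [idx, pos, IsBarred] <;> simp <;> omega

theorem isBarred_iff (x : Letter N) : x.IsBarred = true ↔ x.idx % 2 = 0 := by
  rw [idx_mod_two]; split_ifs <;> simp [*]

theorem isBarred_eq_false_iff (x : Letter N) : x.IsBarred = false ↔ x.idx % 2 = 1 := by
  rw [idx_mod_two]; split_ifs <;> simp_all

theorem idx_pos (x : Letter N) : 0 < x.idx := Nat.succ_pos _

theorem idx_le (x : Letter N) : x.idx ≤ 2 * N := by
  rcases x with a | a <;> have := a.2 <;> simp only [idx, pos] <;> omega

theorem exists_idx_eq {i : ℕ} (h0 : 0 < i) (h1 : i ≤ 2 * N) : ∃ x : Letter N, x.idx = i := by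
  rcases Nat.mod_two_eq_zero_or_one i with h | h
  · exact ⟨bar ⟨i / 2 - 1, by omega⟩, by simp only [idx, pos]; omega⟩
  · exact ⟨plain ⟨i / 2, by omega⟩, by simp only [idx, pos]; omega⟩

end Letter

/-- The sequence of ring elements attached to the letters, extended by zero. -/
noncomputable def letterSeq {B : Type*} [Ring B] {N : ℕ} (X : Letter N → B) : ℕ → B :=
  Function.extend Letter.idx X 0

noncomputable instance {N : ℕ} {ν : YoungDiagram} : Fintype (ColoredTableau N ν) :=
  Fintype.ofFinite _

/-- The sum of the reading words of all colored tableaux of a shape, evaluated in a ring. -/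
noncomputable def tableauSum {B : Type*} [Ring B] {N : ℕ} (X : Letter N → B) (ν : YoungDiagram) :
    B :=
  ∑ T : ColoredTableau N ν, FreeMonoid.lift X T.sqread

section Tableaux

variable {B : Type*} [Ring B] {N : ℕ} (X : Letter N → B) {ν : YoungDiagram}

@[simp] theorem letterSeq_idx (x : Letter N) : letterSeq X x.idx = X x :=
  Letter.idx_injective.extend_apply _ _ _

theorem letterSeq_of_not {i : ℕ} (h : ¬(0 < i ∧ i ≤ 2 * N)) : letterSeq X i = 0 := by
  refine Function.extend_apply' _ _ _ ?_
  rintro ⟨x, rfl⟩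
  exact h ⟨x.idx_pos, x.idx_le⟩

/-! ### Tableaux as compatible fillings. -/

namespace ColoredTableau

/-- The positions of the entries of a tableau, zero outside the shape. -/
noncomputable def toFun (T : ColoredTableau N ν) (z : ℕ × ℕ) : ℕ :=
  if h : z ∈ ν.cells then (T.entry ⟨z, h⟩).idx else 0

theorem toFun_of_mem (T : ColoredTableau N ν) {z : ℕ × ℕ} (h : z ∈ ν.cells) :
    T.toFun z = (T.entry ⟨z, h⟩).idx := dif_pos h

theorem toFun_of_notMem (T : ColoredTableau N ν) {z : ℕ × ℕ} (h : z ∉ ν.cells) :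
    T.toFun z = 0 := dif_neg h

theorem toFun_injective : Function.Injective (toFun : ColoredTableau N ν → _) := by
  intro T T' h
  ext c
  apply Letter.idx_injective
  rw [← T.toFun_of_mem c.2, ← T'.toFun_of_mem c.2, h]

/-- Rounding half the entry upwards merges the weak and strict conditions: below an odd entry one
must increase, below an even one equality is allowed, and along rows the parities exchange their
roles. -/
theorem fits_toFun (T : ColoredTableau N ν) {z : ℕ × ℕ} (hz : z ∈ ν.cells) :
    Fits ν.rowLen (N + 1) T.toFun z := by
  obtain ⟨a, b⟩ := z
  have hle := (T.entry ⟨_, hz⟩).idx_le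
  constructor
  · rw [loFlag]
    split_ifs with h0
    · exact Nat.zero_le _
    · dsimp only at h0 ⊢
      have hm : (a - 1, b) ∈ ν.cells := ν.up_left_mem (by omega) le_rfl hz
      rw [T.toFun_of_mem hz, T.toFun_of_mem hm]
      have h1 := Letter.le_iff_idx.1 (T.col_weak ⟨_, hm⟩ ⟨_, hz⟩ rfl (by dsimp only; omega))
      have h2 := T.col_strict ⟨_, hm⟩ ⟨_, hz⟩ rfl (by dsimp only; omega)
      rw [Letter.isBarred_eq_false_iff, Letter.isBarred_eq_false_iff, Letter.lt_iff_idx] at h2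
      omega
  · rw [hiFlag]
    split_ifs with h0
    · dsimp only at h0 ⊢
      have hm : (a, b + 1) ∈ ν.cells := YoungDiagram.mem_iff_lt_rowLen.2 h0
      rw [T.toFun_of_mem hz, T.toFun_of_mem hm]
      have h1 := Letter.le_iff_idx.1 (T.row_weak ⟨_, hz⟩ ⟨_, hm⟩ rfl (by dsimp only; omega))
      have h2 := T.row_strict ⟨_, hz⟩ ⟨_, hm⟩ rfl (by dsimp only; omega)
      rw [Letter.isBarred_iff, Letter.isBarred_iff, Letter.lt_iff_idx] at h2
      omega
    · rw [T.toFun_of_mem hz]; omega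

theorem row_lt_of_fits {f : ℕ × ℕ → ℕ} {M : ℕ} (hf : ∀ z ∈ ν.cells, Fits ν.rowLen M f z)
    {a b b' : ℕ} (hb : b < b') (h : (a, b') ∈ ν.cells) :
    f (a, b) < 2 * ((f (a, b') + 1) / 2) := by
  induction b', hb using Nat.le_induction with
  | base =>
    have h1 := (hf (a, b) (ν.up_left_mem le_rfl (Nat.le_succ b) h)).2
    rwa [hiFlag, if_pos (YoungDiagram.mem_iff_lt_rowLen.1 h)] at h1
  | succ c hc ih =>
    have hm := ν.up_left_mem le_rfl (Nat.le_succ c) h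
    have h1 := (hf (a, c) hm).2
    rw [hiFlag, if_pos (YoungDiagram.mem_iff_lt_rowLen.1 h)] at h1
    have h2 := ih hm
    dsimp only at h1 h2
    omega

theorem col_le_of_fits {f : ℕ × ℕ → ℕ} {M : ℕ} (hf : ∀ z ∈ ν.cells, Fits ν.rowLen M f z)
    {a a' b : ℕ} (ha : a < a') (h : (a', b) ∈ ν.cells) :
    2 * ((f (a, b) + 1) / 2) ≤ f (a', b) := by
  induction a', ha using Nat.le_induction with
  | base =>
    have h1 := (hf _ h).1
    rwa [loFlag, if_neg (Nat.succ_ne_zero a)] at h1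
  | succ c hc ih =>
    have hm := ν.up_left_mem (Nat.le_succ c) le_rfl h
    have h1 := (hf _ h).1
    rw [loFlag, if_neg (Nat.succ_ne_zero c)] at h1
    have h2 := ih hm
    simp only [Nat.add_sub_cancel] at h1 h2 ⊢
    omega

theorem exists_toFun_eq {f : ℕ × ℕ → ℕ} (h0 : ∀ z ∉ ν.cells, f z = 0)
    (hf : ∀ z ∈ ν.cells, Fits ν.rowLen (N + 1) f z)
    (hr : ∀ z ∈ ν.cells, 0 < f z ∧ f z ≤ 2 * N) : ∃ T : ColoredTableau N ν, T.toFun = f := by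
  choose e he using fun z : {c // c ∈ ν.cells} =>
    Letter.exists_idx_eq (N := N) (hr z.1 z.2).1 (hr z.1 z.2).2
  have hrow : ∀ c d : {c // c ∈ ν.cells}, c.1.1 = d.1.1 → c.1.2 < d.1.2 →
      (e c).idx < 2 * (((e d).idx + 1) / 2) := by
    rintro ⟨⟨a, b⟩, hc⟩ ⟨⟨a', b'⟩, hd⟩ (rfl : a = a') hb
    rw [he, he]
    exact row_lt_of_fits hf hb hd
  have hcol : ∀ c d : {c // c ∈ ν.cells}, c.1.2 = d.1.2 → c.1.1 < d.1.1 →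
      2 * (((e c).idx + 1) / 2) ≤ (e d).idx := by
    rintro ⟨⟨a, b⟩, hc⟩ ⟨⟨a', b'⟩, hd⟩ (rfl : b = b') hb
    rw [he, he]
    exact col_le_of_fits hf hb hd
  refine ⟨⟨e, fun c d h h' => ?_, fun c d h h' => ?_, fun c d h h' => ?_, fun c d h h' => ?_⟩, ?_⟩
  · rw [Letter.le_iff_idx]; have := hrow c d h h'; omega
  · rw [Letter.le_iff_idx]; have := hcol c d h h'; omega
  · rw [Letter.lt_iff_idx, Letter.isBarred_iff, Letter.isBarred_iff]
    have := hrow c d h h'; omega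
  · rw [Letter.lt_iff_idx, Letter.isBarred_eq_false_iff, Letter.isBarred_eq_false_iff]
    have := hcol c d h h'; omega
  · funext z
    by_cases hz : z ∈ ν.cells
    · rw [toFun_of_mem _ hz, he]
    · rw [toFun_of_notMem _ hz, h0 z hz]

/-- `L` may exceed the number of rows: the extra rows are empty and only shift the numbering of the
diagonals. -/
theorem diagFrom_toFun (T : ColoredTableau N ν) {L : ℕ} (hL : ν.colLen 0 ≤ L) (k : ℕ) :
    diagFrom ν.rowLen L T.toFun (L - ν.colLen 0 + k) 0 = (T.diagonal k).map Letter.idx := by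
  have hcol : ∀ i j, (i, j) ∈ ν.cells → i < ν.colLen 0 := fun i j h =>
    YoungDiagram.mem_iff_lt_colLen.1 (ν.up_left_mem le_rfl (Nat.zero_le j) h)
  obtain ⟨d, rfl⟩ := Nat.exists_eq_add_of_le hL
  rw [diagFrom, diagonal, List.map_filterMap, Nat.sub_zero, ← List.range_eq_range',
    List.range_add, List.filterMap_append, List.filterMap_map]
  have h2 : List.filterMap ((fun i => if ν.colLen 0 + d ≤ i + (ν.colLen 0 + d - ν.colLen 0 + k) ∧
      i + (ν.colLen 0 + d - ν.colLen 0 + k) - (ν.colLen 0 + d) < ν.rowLen i then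
        some (T.toFun (i, i + (ν.colLen 0 + d - ν.colLen 0 + k) - (ν.colLen 0 + d)))
      else none) ∘ fun x => ν.colLen 0 + x) (List.range d) = [] := by
    refine List.filterMap_eq_nil_iff.2 fun i _ => ?_
    simp only [Function.comp_apply, ite_eq_right_iff, reduceCtorEq, imp_false, not_and]
    intro _ h
    have := hcol _ _ (YoungDiagram.mem_iff_lt_rowLen.2 h)
    omega
  rw [h2, List.append_nil]
  refine List.filterMap_congr fun i _ => ?_
  have e : i + (ν.colLen 0 + d - ν.colLen 0 + k) - (ν.colLen 0 + d) = i + k - ν.colLen 0 := by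
    omega
  rw [e]
  by_cases hc : ν.colLen 0 ≤ i + k ∧ (i, i + k - ν.colLen 0) ∈ ν.cells
  · rw [dif_pos hc, if_pos ⟨by omega, YoungDiagram.mem_iff_lt_rowLen.1 hc.2⟩, T.toFun_of_mem hc.2]
    rfl
  · rw [dif_neg hc, if_neg]
    · rfl
    · rintro ⟨h3, h4⟩
      exact hc ⟨by omega, YoungDiagram.mem_iff_lt_rowLen.2 h4⟩

theorem diagWord_map_idx (D : List (Letter N)) : diagWord (D.map Letter.idx) =
    ((D.filter fun x => !x.IsBarred).reverse ++ D.filter fun x => x.IsBarred).map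
      Letter.idx := by
  rw [diagWord, List.map_append, List.map_reverse, List.filter_map, List.filter_map]
  congr 4
  · funext x
    simp only [Function.comp_apply, Letter.idx_mod_two]
    cases x.IsBarred <;> simp
  · funext x
    simp only [Function.comp_apply, Letter.idx_mod_two]
    cases x.IsBarred <;> simp

theorem readWord_toFun (T : ColoredTableau N ν) {L : ℕ} (hL : ν.colLen 0 ≤ L) (h0 : 0 < L) :
    readWord ν.rowLen L T.toFun (L + ν.rowLen 0 - 1) = T.sqread.toList.map Letter.idx := by
  have e : L + ν.rowLen 0 - 1 + 1 = (L - ν.colLen 0) + (ν.colLen 0 + ν.rowLen 0) := by omega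
  rw [readWord, e, List.range_add, List.flatMap_append, List.flatMap_map]
  have h1 : (List.range (L - ν.colLen 0)).flatMap
      (fun k => diagWord (diagFrom ν.rowLen L T.toFun k 0)) = [] := by
    refine List.flatMap_eq_nil_iff.2 fun k hk => ?_
    have hk := List.mem_range.1 hk
    have : diagFrom ν.rowLen L T.toFun k 0 = [] := by
      refine List.eq_nil_iff_forall_not_mem.2 fun x hx => ?_
      obtain ⟨a, -, ha, h3, h4, -⟩ := mem_diagFrom.1 hx
      have h5 : a < ν.colLen 0 := YoungDiagram.mem_iff_lt_colLen.1
        (ν.up_left_mem le_rfl (Nat.zero_le _) (YoungDiagram.mem_iff_lt_rowLen.2 h4))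
      omega
    rw [this]; rfl
  rw [h1, List.nil_append, sqread, FreeMonoid.toList_ofList, List.map_flatMap]
  congr 1
  funext k
  rw [T.diagFrom_toFun hL, diagWord_map_idx]

end ColoredTableau

theorem monomialOf_map_idx (w : List (Letter N)) :
    monomialOf (letterSeq X) (w.map Letter.idx) = FreeMonoid.lift X (FreeMonoid.ofList w) := by
  simp [monomialOf, FreeMonoid.lift_apply, Function.comp_def]

theorem mem_diagWord {D : List ℕ} {e : ℕ} : e ∈ diagWord D ↔ e ∈ D := by
  simp only [diagWord, List.mem_append, List.mem_reverse, List.mem_filter, decide_eq_true_eq]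
  have := Nat.mod_two_eq_zero_or_one e
  tauto

/-- The sum over the fillings of a shape is the sum over the colored tableaux. -/
theorem fillSum_eq_tableauSum {L : ℕ} (hL : ν.colLen 0 ≤ L) (h0 : 0 < L) :
    fillSum ν.rowLen (N + 1) (remCells ν.rowLen L (L + ν.rowLen 0 - 1) L) 0 (fun f' =>
      monomialOf (letterSeq X) (readWord ν.rowLen L f' (L + ν.rowLen 0 - 1))) =
      tableauSum X ν := by
  obtain ⟨S, hS, hsum⟩ := exists_fillSum_eq_sum (lam := ν.rowLen) (M := N + 1) (B := B)
    (nodup_remCells (lam := ν.rowLen) (k := L + ν.rowLen 0 - 1) (le_refl L))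
    (pairwise_remCells le_rfl) 0
  have hmem : ∀ z, z ∈ remCells ν.rowLen L (L + ν.rowLen 0 - 1) L ↔ z ∈ ν.cells := by
    rintro ⟨a, b⟩
    rw [mem_remCells le_rfl, YoungDiagram.mem_cells, YoungDiagram.mem_iff_lt_rowLen]
    dsimp only
    refine ⟨fun h => h.2.1, fun h => ?_⟩
    have h1 : a < ν.colLen 0 := YoungDiagram.mem_iff_lt_colLen.1
      (ν.up_left_mem le_rfl (Nat.zero_le _) (YoungDiagram.mem_iff_lt_rowLen.2 h))
    have h2 : ν.rowLen a ≤ ν.rowLen 0 := ν.rowLen_anti 0 a (Nat.zero_le _)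
    exact ⟨by omega, h, by omega⟩
  simp only [hmem] at hS
  rw [hsum, tableauSum]
  symm
  refine Finset.sum_of_injOn ColoredTableau.toFun (ColoredTableau.toFun_injective.injOn)
    (fun T _ => Finset.mem_coe.2 ((hS _).2 ⟨fun z hz => T.toFun_of_notMem hz,
      fun z hz => T.fits_toFun hz⟩)) ?_ ?_
  · intro f hf hne
    obtain ⟨h1, h2⟩ := (hS f).1 hf
    -- Compatibility only bounds the indices by 2N + 1. A filling that is no tableau therefore uses
    -- an index outside 1, …, 2N, where `letterSeq` is zero, and its monomial vanishes.
    have h3 : ∃ z ∈ ν.cells, ¬(0 < f z ∧ f z ≤ 2 * N) := by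
      by_contra hcon
      obtain ⟨T, hT⟩ := ColoredTableau.exists_toFun_eq h1 h2 fun z hz =>
        not_not.1 fun h => hcon ⟨z, hz, h⟩
      exact hne ⟨T, by simp, hT⟩
    obtain ⟨⟨a, b⟩, hz, hbad⟩ := h3
    rw [monomialOf]
    refine List.prod_eq_zero (List.mem_map.2 ⟨f (a, b), ?_, letterSeq_of_not X hbad⟩)
    have h4 := (mem_remCells (le_refl L) _).1 ((hmem _).2 hz)
    dsimp only at h4
    refine List.mem_flatMap.2 ⟨b + L - a, by rw [List.mem_range]; omega, ?_⟩
    rw [mem_diagWord]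
    refine mem_diagFrom.2 ⟨a, Nat.zero_le _, h4.1, by omega, ?_, ?_⟩
    · rw [show a + (b + L - a) - L = b by omega]; exact h4.2.1
    · rw [show a + (b + L - a) - L = b by omega]
  · intro T _
    rw [T.readWord_toFun hL h0, monomialOf_map_idx]
    rfl

end Tableaux


/-! ### Adding a horizontal strip: the algebraic part -/

/-- The Jacobi–Trudi formula: the left side is ψ_{L-1} ⋯ ψ_0 times the determinant of the complete
sums. The flag N + 1 admits all letters. -/
theorem prodDesc_complForm_eq {B : Type*} [Ring B] {N : ℕ} {X : Letter N → B} {ψ : ℕ → B}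
    (hψ : GrassmannFor (letterSeq X) ψ) (hX : KronLetters (letterSeq X)) (ν : YoungDiagram)
    {L : ℕ} (hL : ν.colLen 0 ≤ L) (h0 : 0 < L) :
    prodDesc (fun i => complForm (letterSeq X) ψ L (N + 1) ((ν.rowLen i : ℤ) - i)) 0 L =
      prodDesc ψ 0 L * tableauSum X ν := by
  rw [← fillSum_eq_tableauSum X hL h0]
  exact prodDesc_complForm_eq_fillSum (fun _ _ h => ν.rowLen_anti _ _ h) hψ hX _ (by omega)

section Strip

variable {B : Type*} [Ring B]

/-- The variables `∑_{p ≤ q} t^{q-p} ψ_p`. -/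
def shiftedPsi (t : B) (ψ : ℕ → B) : ℕ → B
  | 0 => ψ 0
  | q + 1 => t * shiftedPsi t ψ q + ψ (q + 1)

/-- On its way through the product θ changes only signs, so it meets every other θ and annihilates
the terms containing one. -/
theorem mul_prodDesc_add_mul {θ : B} {a r : ℕ → B} (hθ : θ * θ = 0)
    (ha : ∀ i, θ * a i = -(a i * θ)) (hr : ∀ i, θ * r i = r i * θ) (m : ℕ) :
    θ * prodDesc (fun i => a i + r i * θ) 0 m = θ * prodDesc a 0 m := by
  induction m with
  | zero => simp
  | succ m ih =>
    rw [prodDesc_succ_top, prodDesc_succ_top, zero_add, ← mul_assoc, mul_add, ← mul_assoc θ (r m),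
      hr, mul_assoc _ θ θ, hθ, mul_zero, add_zero, ha, neg_mul, mul_assoc, ih, ← mul_assoc,
      ← neg_mul, ← ha, mul_assoc]

theorem prodDesc_pow_mul {t : B} {F : ℕ → B} (ht : ∀ i, t * F i = F i * t) (κ : ℕ → ℕ) (n : ℕ) :
    prodDesc (fun i => t ^ κ i * F i) 0 n = t ^ (∑ i ∈ Finset.range n, κ i) * prodDesc F 0 n := by
  induction n with
  | zero => simp
  | succ n ih =>
    have h : ∀ m, F n * t ^ m = t ^ m * F n := fun m => (Commute.pow_right (ht n).symm m).eq
    rw [prodDesc_succ_top, prodDesc_succ_top, ih, zero_add, Finset.sum_range_succ, add_comm,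
      pow_add]
    simp only [mul_assoc]
    rw [← mul_assoc (F n), h]
    simp only [mul_assoc]

theorem exists_prodDesc_sum (g : ℕ → ℕ) (n : ℕ) : ∃ S : Finset (ℕ → ℕ),
    (∀ κ, κ ∈ S ↔ (∀ i < n, κ i < g i) ∧ ∀ i, n ≤ i → κ i = 0) ∧
    ∀ G : ℕ → ℕ → B, prodDesc (fun i => ∑ m ∈ Finset.range (g i), G i m) 0 n =
      ∑ κ ∈ S, prodDesc (fun i => G i (κ i)) 0 n := by
  classical
  induction n with
  | zero => exact ⟨{0}, fun κ => by simp [funext_iff], fun G => by simp⟩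
  | succ n ih =>
    obtain ⟨S, hS, hsum⟩ := ih
    refine ⟨(Finset.range (g n) ×ˢ S).image fun x => Function.update x.2 n x.1, fun κ => ?_,
      fun G => ?_⟩
    · simp only [Finset.mem_image, Finset.mem_product, Finset.mem_range, Prod.exists, hS]
      constructor
      · rintro ⟨m, κ, ⟨hm, h1, h2⟩, rfl⟩
        refine ⟨fun i hi => ?_, fun i hi => ?_⟩
        · by_cases h : i = n
          · subst h; rwa [Function.update_self]
          · rw [Function.update_of_ne h]; exact h1 i (by omega)
        · rw [Function.update_of_ne (by omega)]; exact h2 i (by omega)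
      · rintro ⟨h1, h2⟩
        refine ⟨κ n, Function.update κ n 0, ⟨h1 n (by omega), fun i hi => ?_, fun i hi => ?_⟩, ?_⟩
        · rw [Function.update_of_ne (by omega)]; exact h1 i (by omega)
        · by_cases h : i = n
          · subst h; rw [Function.update_self]
          · rw [Function.update_of_ne h]; exact h2 i (by omega)
        · simp
    · rw [prodDesc_succ_top, hsum, zero_add, Finset.sum_mul_sum, ← Finset.sum_product',
        Finset.sum_image]
      · refine Finset.sum_congr rfl fun x _ => ?_
        rw [prodDesc_succ_top, zero_add, Function.update_self]
        congr 1
        refine prodDesc_congr fun j _ hj => ?_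
        rw [Function.update_of_ne (by omega)]
      · rintro ⟨m, κ⟩ h ⟨m', κ'⟩ h' heq
        have hκ := (hS κ).1 (Finset.mem_product.1 h).2
        have hκ' := (hS κ').1 (Finset.mem_product.1 h').2
        have e1 : m = m' := by simpa using congrFun heq n
        have e2 : κ = κ' := by
          funext i
          by_cases hi : i = n
          · subst hi; rw [hκ.2 i le_rfl, hκ'.2 i le_rfl]
          · simpa [Function.update_of_ne hi] using congrFun heq i
        rw [e1, e2]

variable {y ψ : ℕ → B} {t : B} (hψ : GrassmannFor y ψ)

/-! ### A unitriangular change of the anticommuting variables. -/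

section Shifted


theorem comm_shiftedPsi {b : B} (hb : ∀ p, b * ψ p = ψ p * b) (hbt : b * t = t * b) (q : ℕ) :
    b * shiftedPsi t ψ q = shiftedPsi t ψ q * b := by
  induction q with
  | zero => exact hb 0
  | succ q ih =>
    rw [shiftedPsi, mul_add, add_mul, ← mul_assoc, hbt, mul_assoc, ih, hb, mul_assoc]

theorem anti_shiftedPsi {b : B} (hb : ∀ p, b * ψ p = -(ψ p * b)) (hbt : b * t = t * b) (q : ℕ) :
    b * shiftedPsi t ψ q = -(shiftedPsi t ψ q * b) := by
  induction q with
  | zero => exact hb 0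
  | succ q ih =>
    rw [shiftedPsi, mul_add, add_mul, ← mul_assoc, hbt, mul_assoc, ih, hb, mul_assoc]
    noncomm_ring

variable (htψ : ∀ p, t * ψ p = ψ p * t)
include hψ htψ

theorem grassmannFor_shiftedPsi (hty : ∀ i, t * y i = y i * t) :
    GrassmannFor y (shiftedPsi t ψ) := by
  have h1 : ∀ p q, ψ p * ψ q = -(ψ q * ψ p) := fun p q => by
    by_cases h : p = q
    · subst h; simp [hψ.sq]
    · exact hψ.anti p q h
  have h2 : ∀ p q, ψ p * shiftedPsi t ψ q = -(shiftedPsi t ψ q * ψ p) := fun p q =>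
    anti_shiftedPsi (h1 p) (htψ p).symm q
  have h3 : ∀ q, t * shiftedPsi t ψ q = shiftedPsi t ψ q * t := comm_shiftedPsi htψ rfl
  refine ⟨fun q => ?_, fun p q _ => ?_, fun i q => ?_⟩
  · induction q with
    | zero => exact hψ.sq 0
    | succ q ih =>
      have e : shiftedPsi t ψ (q + 1) * shiftedPsi t ψ (q + 1) =
          t * (shiftedPsi t ψ q * t) * shiftedPsi t ψ q + t * (shiftedPsi t ψ q * ψ (q + 1)) +
            (ψ (q + 1) * t) * shiftedPsi t ψ q + ψ (q + 1) * ψ (q + 1) := by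
        rw [shiftedPsi]; noncomm_ring
      rw [e, ← h3, ← htψ, hψ.sq, mul_assoc t (ψ _), h2, mul_assoc t, mul_assoc t, ih]
      simp
  · exact anti_shiftedPsi (fun r => by rw [h2, neg_neg]) (h3 p).symm q
  · exact comm_shiftedPsi (fun p => hψ.comm i p) (hty i).symm q

/-- The multiple of the previous variable in each factor is killed by the adjacent factor, as for a
unitriangular determinant. -/
theorem prodDesc_shiftedPsi (hty : ∀ i, t * y i = y i * t) (m : ℕ) :
    prodDesc (shiftedPsi t ψ) 0 m = prodDesc ψ 0 m := by
  have hsq := (grassmannFor_shiftedPsi hψ htψ hty).sq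
  induction m with
  | zero => simp
  | succ m ih =>
    rw [prodDesc_succ_top, prodDesc_succ_top, zero_add, ← ih]
    cases m with
    | zero => rfl
    | succ m =>
      rw [prodDesc_succ_top, zero_add, shiftedPsi, add_mul, ← mul_assoc, mul_assoc t, hsq]
      simp

end Shifted

variable {n : ℕ} {ξ : ℤ → B} (hξ : ∀ c, ξ c = csum y (2 * n) c + t * ξ (c + 1))
  (hξψ : ∀ c p, ξ c * ψ p = ψ p * ξ c) (hξξ : ∀ c d, ξ c * ξ d = ξ d * ξ c)
  (htψ : ∀ p, t * ψ p = ψ p * t) (htξ : ∀ c, t * ξ c = ξ c * t)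

section
include hξ htψ htξ

omit htψ in
-- Column operations: substituting ψ_p = ψ'_p - t ψ'_{p-1}, with ψ' the shifted variables, turns the
-- coefficients into ξ_c - t ξ_{c+1} = h_c, except in the last column.
theorem linForm_geometric (L : ℕ) (b : ℤ) :
    linForm ψ (L + 1) (fun p => ξ (b + p)) =
      linForm (shiftedPsi t ψ) L (fun p => csum y (2 * n) (b + p)) +
        ξ (b + L) * shiftedPsi t ψ L := by
  induction L with
  | zero => simp [linForm, shiftedPsi]
  | succ L ih =>
    rw [linForm, Finset.sum_range_succ]
    rw [linForm] at ih
    rw [ih, hξ (b + L), linForm, linForm, Finset.sum_range_succ, shiftedPsi, htξ]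
    push_cast
    rw [← add_assoc b]
    noncomm_ring

omit htψ htξ in
/-- The first few terms of a geometric row. -/
theorem linForm_geometric_sub (L g : ℕ) (b : ℤ) :
    linForm ψ L (fun p => ξ (b + p)) =
      ∑ m ∈ Finset.range g, t ^ m * complForm y ψ L n (b + m) +
        t ^ g * linForm ψ L (fun p => ξ (b + g + p)) := by
  induction g with
  | zero => simp
  | succ g ih =>
    have e : linForm ψ L (fun p => ξ (b + g + p)) = complForm y ψ L n (b + g) +
        t * linForm ψ L (fun p => ξ (b + (g + 1 : ℕ) + p)) := by
      simp only [linForm, complForm, Finset.mul_sum, ← Finset.sum_add_distrib, ← mul_assoc,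
        ← add_mul]
      refine Finset.sum_congr rfl fun p _ => ?_
      rw [hξ (b + g + p)]
      push_cast
      rw [show b + (g : ℤ) + p + 1 = b + (g + 1) + p by ring]
    rw [ih, Finset.sum_range_succ, e, pow_succ]
    noncomm_ring

end

include hψ hξ hξψ hξξ htψ htξ

omit hξ htψ htξ in
theorem linForm_geometric_sq (L : ℕ) (b : ℤ) :
    linForm ψ L (fun p => ξ (b + p)) * linForm ψ L (fun p => ξ (b + p)) = 0 :=
  linForm_mul_linForm_eq_zero hψ.sq hψ.anti (fun _ _ => hξξ _ _) fun _ _ => (hξψ _ _).symm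

omit hξξ in
-- In the shifted variables the empty row L has only negative degrees before the last column, so it
-- is ξ_0 times the last variable. This variable then removes the last column from all other rows.
theorem prodDesc_geometric {lam : ℕ → ℕ} {L : ℕ} {s : B} (hL : lam L = 0)
    (hty : ∀ i, t * y i = y i * t)
    (hs : prodDesc (fun i => complForm y (shiftedPsi t ψ) L n ((lam i : ℤ) - i)) 0 L =
      prodDesc (shiftedPsi t ψ) 0 L * s) :
    prodDesc (fun i => linForm ψ (L + 1) fun p => ξ ((lam i : ℤ) - i + p)) 0 (L + 1) =
      ξ 0 * prodDesc ψ 0 (L + 1) * s := by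
  have hψ' := grassmannFor_shiftedPsi hψ htψ hty
  rw [prodDesc_succ_top, zero_add]
  simp only [linForm_geometric hξ htξ]
  have h1 : linForm (shiftedPsi t ψ) L
      (fun p => csum y (2 * n) ((lam L : ℤ) - L + p)) = 0 := by
    rw [linForm]
    refine Finset.sum_eq_zero fun p hp => ?_
    have hp := Finset.mem_range.1 hp
    rw [hL, csum_of_neg _ _ (by push_cast; omega), zero_mul]
  rw [h1, hL, zero_add, show ((0 : ℕ) : ℤ) - (L : ℤ) + L = 0 by simp, mul_assoc,
    mul_prodDesc_add_mul (hψ'.sq L)]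
  · rw [← prodDesc_shiftedPsi hψ htψ hty (L + 1), prodDesc_succ_top, zero_add, mul_assoc,
      mul_assoc, ← hs]
    rfl
  · intro i
    rw [linForm, Finset.mul_sum, Finset.sum_mul, ← Finset.sum_neg_distrib]
    refine Finset.sum_congr rfl fun p hp => ?_
    have hp := Finset.mem_range.1 hp
    rw [← mul_assoc, hψ'.csum_comm_psi, mul_assoc, hψ'.anti _ _ (by omega), mul_neg, mul_assoc]
  · intro i
    exact (comm_shiftedPsi (fun p => hξψ _ p) (htξ _).symm L).symm

omit htψ htξ in
-- Row operations: after λ_i - λ_{i+1} + 1 terms, the tail of the series in row i + 1 is a power of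
-- t times row i, which stands next to it and squares to zero. The remaining exponents are the
-- numbers of cells that a horizontal strip may add to row i + 1.
theorem prodDesc_truncate {lam : ℕ → ℕ} (hlam : Antitone lam) (L m : ℕ) :
    prodDesc (fun i => linForm ψ L fun p => ξ ((lam i : ℤ) - i + p)) 0 (m + 1) =
      prodDesc (fun i => ∑ j ∈ Finset.range (lam i - lam (i + 1) + 1),
        t ^ j * complForm y ψ L n ((lam (i + 1) : ℤ) - (i + 1 : ℕ) + j)) 0 m *
      linForm ψ L fun p => ξ ((lam 0 : ℤ) + p) := by
  induction m with
  | zero => simp [prodDesc_succ_top]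
  | succ m ih =>
    have h1 := hlam (Nat.le_succ m)
    simp only [Nat.succ_eq_add_one] at h1
    conv_rhs => rw [prodDesc_succ_top, mul_assoc, ← ih]
    rw [prodDesc_succ_top]
    have e : ((lam (m + 1) : ℤ) - (m + 1 : ℕ)) + (lam m - lam (m + 1) + 1 : ℕ) =
        (lam m : ℤ) - m := by push_cast [h1]; ring
    rw [zero_add, zero_add, linForm_geometric_sub hξ L (lam m - lam (m + 1) + 1), e,
      add_mul, mul_assoc (t ^ _), prodDesc_succ_top, zero_add,
      ← mul_assoc (linForm ψ L fun p => ξ ((lam m : ℤ) - m + p)),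
      linForm_geometric_sq hψ hξψ hξξ]
    simp

end Strip


/-! ### Anticommuting variables over an arbitrary ring -/

open scoped TensorProduct

/-- The exterior algebra on countably many generators over a ring. -/
abbrev GrassmannExt (A : Type*) [Ring A] : Type _ := A ⊗[ℤ] ExteriorAlgebra ℤ (ℕ →₀ ℤ)

namespace GrassmannExt

variable {A : Type*} [Ring A]

/-- The inclusion of the coefficients. -/
noncomputable def const : A →+* GrassmannExt A :=
  (Algebra.TensorProduct.includeLeft : A →ₐ[ℤ] GrassmannExt A).toRingHom

/-- The anticommuting generators. -/
noncomputable def psi (p : ℕ) : GrassmannExt A :=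
  1 ⊗ₜ ExteriorAlgebra.ι ℤ (Finsupp.single p 1)

theorem const_apply (a : A) : const a = (a ⊗ₜ 1 : GrassmannExt A) := rfl

theorem psi_sq (p : ℕ) : psi p * psi p = (0 : GrassmannExt A) := by
  simp [psi]

theorem psi_anti (p q : ℕ) : psi p * psi q = (-(psi q * psi p) : GrassmannExt A) := by
  rw [eq_neg_iff_add_eq_zero]
  simp only [psi, Algebra.TensorProduct.tmul_mul_tmul, one_mul, ← TensorProduct.tmul_add,
    ExteriorAlgebra.ι_add_mul_swap, TensorProduct.tmul_zero]

theorem const_comm_psi (a : A) (p : ℕ) : const a * psi p = psi p * const a := by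
  simp [psi, const_apply]

/-- The alternating form that is `1` on the generators `ψ_{L-1}, …, ψ_0`. -/
noncomputable def detForm (L : ℕ) : (ℕ →₀ ℤ) [⋀^Fin L]→ₗ[ℤ] ℤ :=
  (Matrix.detRowAlternating : (Fin L → ℤ) [⋀^Fin L]→ₗ[ℤ] ℤ).compLinearMap
    (LinearMap.pi fun j : Fin L => Finsupp.lapply (L - 1 - j))

/-- The top coefficient in the first `L` generators. -/
noncomputable def topCoeff (A : Type*) [Ring A] (L : ℕ) : GrassmannExt A →+ A :=
  ((TensorProduct.rid ℤ A).toLinearMap ∘ₗ LinearMap.lTensor A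
    (ExteriorAlgebra.liftAlternating (R := ℤ) (M := ℕ →₀ ℤ) (N := ℤ)
      (Pi.single L (detForm L)))).toAddMonoidHom

theorem topCoeff_const_mul (L : ℕ) (a : A) (x : GrassmannExt A) :
    topCoeff A L (const a * x) = a * topCoeff A L x := by
  induction x using TensorProduct.induction_on with
  | zero => simp
  | tmul b w =>
    simp only [topCoeff, const_apply, Algebra.TensorProduct.tmul_mul_tmul, one_mul,
      LinearMap.toAddMonoidHom_coe, LinearMap.comp_apply, LinearMap.lTensor_tmul,
      LinearEquiv.coe_coe, TensorProduct.rid_tmul, mul_smul_comm]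
  | add x y hx hy => simp [mul_add, hx, hy]

theorem prodDesc_psi (L : ℕ) : prodDesc (psi : ℕ → GrassmannExt A) 0 L =
    1 ⊗ₜ ExteriorAlgebra.ιMulti ℤ L fun i : Fin L => Finsupp.single (L - 1 - (i : ℕ)) 1 := by
  have h : ∀ l : List ℕ, ((l.map psi).prod : GrassmannExt A) =
      1 ⊗ₜ (l.map fun p => ExteriorAlgebra.ι ℤ (Finsupp.single p (1 : ℤ))).prod := by
    intro l
    induction l with
    | nil => rfl
    | cons a l ih => simp [ih, psi]
  rw [prodDesc, h, ExteriorAlgebra.ιMulti_apply]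
  congr 2
  refine List.ext_getElem (by simp) fun i h1 h2 => ?_
  simp at h1 ⊢

theorem topCoeff_prodDesc_psi (L : ℕ) : topCoeff A L (prodDesc psi 0 L) = 1 := by
  rw [prodDesc_psi]
  have h : detForm L (fun i : Fin L => Finsupp.single (L - 1 - (i : ℕ)) 1) = 1 := by
    rw [detForm, AlternatingMap.compLinearMap_apply]
    change Matrix.det _ = 1
    refine Eq.trans (congrArg Matrix.det (?_ : _ = (1 : Matrix (Fin L) (Fin L) ℤ)))
      Matrix.det_one
    ext i j
    simp only [LinearMap.pi_apply, Finsupp.lapply_apply, Matrix.one_apply, Finsupp.single_apply]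
    refine if_congr ?_ rfl rfl
    rw [Fin.ext_iff]
    omega
  simp [topCoeff, ExteriorAlgebra.liftAlternating_apply_ιMulti, h]

end GrassmannExt

/-- Every ring embeds into a ring with anticommuting variables and a top coefficient. -/
theorem exists_grassmann.{u} (A : Type u) [Ring A] : ∃ (B : Type u) (_ : Ring B) (φ : A →+* B)
    (ψ : ℕ → B) (top : ℕ → B →+ A), (∀ p, ψ p * ψ p = 0) ∧ (∀ p q, ψ p * ψ q = -(ψ q * ψ p)) ∧
      (∀ a p, φ a * ψ p = ψ p * φ a) ∧ (∀ L a x, top L (φ a * x) = a * top L x) ∧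
      ∀ L, top L (prodDesc ψ 0 L) = 1 :=
  ⟨GrassmannExt A, inferInstance, GrassmannExt.const, GrassmannExt.psi, GrassmannExt.topCoeff A,
    GrassmannExt.psi_sq, GrassmannExt.psi_anti, GrassmannExt.const_comm_psi,
    GrassmannExt.topCoeff_const_mul, GrassmannExt.topCoeff_prodDesc_psi⟩

/-! ### Ring homomorphisms -/

section Map

variable {A B : Type*} [Ring A] [Ring B] (φ : A →+* B)

theorem map_csumNat (y : ℕ → A) (n k : ℕ) : φ (csumNat y n k) = csumNat (φ ∘ y) n k := by
  induction n generalizing k with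
  | zero => cases k <;> simp [csumNat]
  | succ n ih =>
    induction k with
    | zero => simp
    | succ k ihk =>
      rw [csumNat, csumNat]
      split_ifs <;> simp [ih, ihk]

theorem map_csum (y : ℕ → A) (n : ℕ) (k : ℤ) : φ (csum y n k) = csum (φ ∘ y) n k := by
  cases k with
  | ofNat k => exact map_csumNat φ y n k
  | negSucc k => exact map_zero φ

theorem KronLetters.map {y : ℕ → A} (hy : KronLetters y) : KronLetters (φ ∘ y) := by
  have hc : ∀ i j, commLetters (φ ∘ y) i j = φ (commLetters y i j) := fun i j => by
    simp [commLetters]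
  refine ⟨fun i j h => ?_, fun i => ?_, fun i j h h' => ?_, fun i j h h' => ?_,
    fun i j h h' => ?_, fun i j h h' => ?_⟩ <;>
  simp only [hc, Function.comp_apply, ← map_mul]
  · rw [hy.far i j h]
  · rw [hy.rotate i]
  · rw [hy.odd_mul i j h h', map_zero]
  · rw [hy.mul_even i j h h', map_zero]
  · rw [hy.even_mul i j h h', map_zero]
  · rw [hy.mul_odd i j h h', map_zero]

variable {N : ℕ}

theorem comp_letterSeq (X : Letter N → A) : φ ∘ letterSeq X = letterSeq (φ ∘ X) := by
  funext i
  by_cases h : 0 < i ∧ i ≤ 2 * N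
  · obtain ⟨x, rfl⟩ := Letter.exists_idx_eq h.1 h.2
    simp
  · simp [letterSeq_of_not _ h]

theorem map_tableauSum (X : Letter N → A) (ν : YoungDiagram) :
    φ (tableauSum X ν) = tableauSum (φ ∘ X) ν := by
  simp only [tableauSum, map_sum]
  refine Finset.sum_congr rfl fun T _ => ?_
  simp [FreeMonoid.lift_apply, map_list_prod]

end Map

/-! ### Young diagrams from row lengths -/

namespace YoungDiagram

/-- The Young diagram with given row lengths. -/
def ofRows (g : ℕ → ℕ) (hg : Antitone g) (L : ℕ) : YoungDiagram where
  cells := (Finset.range L ×ˢ Finset.range (g 0)).filter fun z => z.2 < g z.1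
  isLowerSet := by
    rintro ⟨a, b⟩ ⟨a', b'⟩ ⟨h1, h2⟩ h
    simp only [Finset.coe_filter, Finset.mem_product, Finset.mem_range, Set.mem_ofPred_eq] at h ⊢
    dsimp only at h1 h2
    have := hg h1
    omega

theorem rowLen_ofRows {g : ℕ → ℕ} (hg : Antitone g) {L : ℕ} (hL : g L = 0) (i : ℕ) :
    (ofRows g hg L).rowLen i = g i := by
  have h : ∀ j, j < (ofRows g hg L).rowLen i ↔ j < g i := fun j => by
    rw [← mem_iff_lt_rowLen, ← mem_cells]
    simp only [ofRows, Finset.mem_filter, Finset.mem_product, Finset.mem_range]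
    have h0 := hg (Nat.zero_le i)
    refine ⟨fun h => h.2, fun h => ⟨⟨?_, by omega⟩, h⟩⟩
    by_contra hi
    have := hg (not_lt.1 hi)
    omega
  have h1 := h (g i)
  have h2 := h ((ofRows g hg L).rowLen i)
  omega

theorem ext_rowLen {ν μ : YoungDiagram} (h : ∀ i, ν.rowLen i = μ.rowLen i) : ν = μ := by
  ext ⟨a, b⟩
  rw [mem_cells, mem_cells, mem_iff_lt_rowLen, mem_iff_lt_rowLen, h]

theorem lt_colLen_iff (ν : YoungDiagram) (i : ℕ) : i < ν.colLen 0 ↔ 0 < ν.rowLen i := by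
  rw [← mem_iff_lt_colLen, ← mem_iff_lt_rowLen]

theorem rowLen_eq_zero_of_le {ν : YoungDiagram} {i : ℕ} (h : ν.colLen 0 ≤ i) :
    ν.rowLen i = 0 := by
  have := ν.lt_colLen_iff i
  omega

theorem card_eq_sum_rowLen {ν : YoungDiagram} {L : ℕ} (hL : ν.colLen 0 ≤ L) :
    ν.card = ∑ i ∈ Finset.range L, ν.rowLen i := by
  rw [YoungDiagram.card, Finset.card_eq_sum_card_fiberwise (f := Prod.fst) (t := Finset.range L)]
  · exact Finset.sum_congr rfl fun i _ => (ν.rowLen_eq_card).symm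
  · rintro ⟨a, b⟩ h
    have h1 := ν.lt_colLen_iff a
    have h2 : b < ν.rowLen a := mem_iff_lt_rowLen.1 h
    simp only [Finset.coe_range, Set.mem_Iio]
    omega

/-- `lam / ν` is a horizontal strip. -/
def IsStrip (ν lam : YoungDiagram) : Prop :=
  ∀ i, ν.rowLen i ≤ lam.rowLen i ∧ lam.rowLen (i + 1) ≤ ν.rowLen i

open Classical in
/-- The diagrams obtained from `ν` by adding a horizontal strip of size `k`. -/
noncomputable def strips (ν : YoungDiagram) (k : ℕ) : Finset YoungDiagram :=
  (finite_youngDiagram_card (ν.card + k)).toFinset.filter fun lam => IsStrip ν lam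

theorem mem_strips {ν lam : YoungDiagram} {k : ℕ} :
    lam ∈ ν.strips k ↔ lam.card = ν.card + k ∧ IsStrip ν lam := by
  simp [strips]

end YoungDiagram


/-! ### The Pieri rule -/

theorem mul_prodDesc_comm {B : Type*} [Ring B] {b : B} {ψ : ℕ → B}
    (h : ∀ p, b * ψ p = ψ p * b) (i m : ℕ) : b * prodDesc ψ i m = prodDesc ψ i m * b := by
  induction m generalizing i with
  | zero => simp
  | succ m ih => rw [prodDesc_succ, ← mul_assoc, ih, mul_assoc, h, mul_assoc]

theorem prodDesc_shift {B : Type*} [Ring B] (g : ℕ → B) (i m : ℕ) :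
    prodDesc (fun j => g (j + 1)) i m = prodDesc g (i + 1) m := by
  induction m generalizing i with
  | zero => simp
  | succ m ih => rw [prodDesc_succ, prodDesc_succ, ih]

namespace YoungDiagram

variable {ν : YoungDiagram}

theorem exists_rowLen_of_mem {L : ℕ}
    (hL : ν.colLen 0 ≤ L) {S : Finset (ℕ → ℕ)} {g : ℕ → ℕ}
    (hg : ∀ i, g (i + 1) = ν.rowLen i - ν.rowLen (i + 1) + 1)
    (hS : ∀ κ, κ ∈ S ↔ (∀ i < L + 1, κ i < g i) ∧ ∀ i, L + 1 ≤ i → κ i = 0) {κ : ℕ → ℕ}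
    (hκ : κ ∈ S) : ∃ lam : YoungDiagram, ∀ i, lam.rowLen i = ν.rowLen i + κ i := by
  have hanti : Antitone fun i => ν.rowLen i + κ i :=
    antitone_nat_of_succ_le fun i => by
      obtain ⟨h1, h2⟩ := (hS κ).1 hκ
      have h3 := ν.rowLen_anti _ _ (Nat.le_succ i)
      simp only [Nat.succ_eq_add_one] at h3
      by_cases hi : i < L
      · have := h1 (i + 1) (by omega)
        rw [hg] at this
        omega
      · have := h2 (i + 1) (by omega)
        omega
  refine ⟨ofRows _ hanti (L + 1), fun i => rowLen_ofRows hanti ?_ i⟩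
  rw [((hS κ).1 hκ).2 _ le_rfl, rowLen_eq_zero_of_le (by omega)]

/-- Horizontal strips in terms of the numbers of cells added to the rows. -/
theorem sum_strips_eq {M : Type*} [AddCommMonoid M] (F : YoungDiagram → M) {L k : ℕ}
    (hL : ν.colLen 0 ≤ L) {S : Finset (ℕ → ℕ)} {g : ℕ → ℕ} (hg0 : g 0 = k + 1)
    (hg : ∀ i, g (i + 1) = ν.rowLen i - ν.rowLen (i + 1) + 1)
    (hS : ∀ κ, κ ∈ S ↔ (∀ i < L + 1, κ i < g i) ∧ ∀ i, L + 1 ≤ i → κ i = 0)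
    {G : (ℕ → ℕ) → M}
    (hG : ∀ κ ∈ S, ∑ i ∈ Finset.range (L + 1), κ i = k →
      ∀ lam : YoungDiagram, (∀ i, lam.rowLen i = ν.rowLen i + κ i) → G κ = F lam) :
    ∑ κ ∈ S with ∑ i ∈ Finset.range (L + 1), κ i = k, G κ = ∑ lam ∈ ν.strips k, F lam := by
  have hν : ∀ i, ν.rowLen (i + 1) ≤ ν.rowLen i := fun i => ν.rowLen_anti _ _ (Nat.le_succ i)
  have hanti : ∀ κ ∈ S, Antitone fun i => ν.rowLen i + κ i := fun κ hκ =>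
    antitone_nat_of_succ_le fun i => by
      obtain ⟨h1, h2⟩ := (hS κ).1 hκ
      have h3 := hν i
      by_cases hi : i < L
      · have := h1 (i + 1) (by omega)
        rw [hg] at this
        omega
      · have := h2 (i + 1) (by omega)
        omega
  have hrow : ∀ κ (hκ : κ ∈ S) i,
      (ofRows _ (hanti κ hκ) (L + 1)).rowLen i = ν.rowLen i + κ i := fun κ hκ i =>
    rowLen_ofRows (hanti κ hκ) (by
      rw [((hS κ).1 hκ).2 _ le_rfl, rowLen_eq_zero_of_le (by omega)]) i
  have hcol : ∀ lam : YoungDiagram, IsStrip ν lam → lam.colLen 0 ≤ L + 1 := fun lam h => by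
    by_contra! hcon
    have h1 := (lam.lt_colLen_iff (L + 1)).1 hcon
    have h2 := (h L).2
    rw [rowLen_eq_zero_of_le hL] at h2
    omega
  refine Finset.sum_bij' (fun κ hκ => ofRows _ (hanti κ (Finset.mem_filter.1 hκ).1) (L + 1))
    (fun lam _ i => lam.rowLen i - ν.rowLen i) ?_ ?_ ?_ ?_ ?_
  · intro κ hκ
    have hκS := (Finset.mem_filter.1 hκ).1
    have hstrip : IsStrip ν (ofRows _ (hanti κ hκS) (L + 1)) := fun i => by
      rw [hrow κ hκS, hrow κ hκS]
      refine ⟨by omega, ?_⟩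
      obtain ⟨h1, h2⟩ := (hS κ).1 hκS
      have h3 := hν i
      by_cases hi : i < L
      · have := h1 (i + 1) (by omega)
        rw [hg] at this
        omega
      · have := h2 (i + 1) (by omega)
        omega
    refine mem_strips.2 ⟨?_, hstrip⟩
    rw [card_eq_sum_rowLen (hcol _ hstrip), card_eq_sum_rowLen (by omega : ν.colLen 0 ≤ L + 1)]
    rw [← (Finset.mem_filter.1 hκ).2, ← Finset.sum_add_distrib]
    exact Finset.sum_congr rfl fun i _ => hrow κ hκS i
  · intro lam hlam
    obtain ⟨h1, h2⟩ := mem_strips.1 hlam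
    have hsum : ∑ i ∈ Finset.range (L + 1), (lam.rowLen i - ν.rowLen i) = k := by
      rw [card_eq_sum_rowLen (hcol _ h2), card_eq_sum_rowLen (by omega : ν.colLen 0 ≤ L + 1)] at h1
      have h3 : ∑ i ∈ Finset.range (L + 1), lam.rowLen i =
          ∑ i ∈ Finset.range (L + 1), ν.rowLen i +
            ∑ i ∈ Finset.range (L + 1), (lam.rowLen i - ν.rowLen i) := by
        rw [← Finset.sum_add_distrib]
        exact Finset.sum_congr rfl fun i _ => by have := (h2 i).1; omega
      omega
    refine Finset.mem_filter.2 ⟨(hS _).2 ⟨fun i hi => ?_, fun i hi => ?_⟩, hsum⟩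
    · rcases i with _ | i
      · rw [hg0]
        have := Finset.single_le_sum (f := fun i => lam.rowLen i - ν.rowLen i)
          (fun i _ => Nat.zero_le _) (Finset.mem_range.2 (Nat.succ_pos L) : 0 ∈ Finset.range (L + 1))
        rw [hsum] at this
        omega
      · rw [hg]
        have := (h2 i).2
        omega
    · have := rowLen_eq_zero_of_le ((hcol _ h2).trans hi)
      omega
  · intro κ hκ
    funext i
    rw [hrow κ (Finset.mem_filter.1 hκ).1, Nat.add_sub_cancel_left]
  · intro lam hlam
    refine ext_rowLen fun i => ?_
    rw [rowLen_ofRows]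
    · have := ((mem_strips.1 hlam).2 i).1
      dsimp only
      omega
    · have := rowLen_eq_zero_of_le (hcol _ (mem_strips.1 hlam).2)
      have h2 := rowLen_eq_zero_of_le (by omega : ν.colLen 0 ≤ L + 1)
      dsimp only
      omega
  · intro κ hκ
    exact hG κ (Finset.mem_filter.1 hκ).1 (Finset.mem_filter.1 hκ).2 _ fun i =>
      hrow κ (Finset.mem_filter.1 hκ).1 i

end YoungDiagram

open PowerSeries in
/-- Multiplying the tableau sum of a shape by a complete sum adds a horizontal strip. -/
theorem csum_mul_tableauSum {R : Type*} [Ring R] {N : ℕ} {X : Letter N → R}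
    (hX : KronLetters (letterSeq X)) (ν : YoungDiagram) (k : ℕ) :
    csum (letterSeq X) (2 * (N + 1)) k * tableauSum X ν =
      ∑ lam ∈ ν.strips k, tableauSum X lam := by
  obtain ⟨B, _, const, psi, top, psi_sq, psi_anti, const_psi, top_mul, top_psi⟩ :=
    exists_grassmann R⟦X⟧
  set φ : R →+* B := const.comp (PowerSeries.C (R := R)) with hφ
  have hφa : ∀ a, φ a = const (PowerSeries.C (R := R) a) := fun _ => rfl
  have hy : KronLetters (letterSeq (φ ∘ X)) := by
    rw [← comp_letterSeq]; exact hX.map φ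
  have hψ : GrassmannFor (letterSeq (φ ∘ X)) psi :=
    ⟨psi_sq, fun p q _ => psi_anti p q, fun i p => by
      rw [← comp_letterSeq]; exact const_psi _ _⟩
  set t : B := const PowerSeries.X with ht
  have htφ : ∀ a, t * const a = const a * t := fun a => by
    rw [ht, ← map_mul, ← map_mul, (PowerSeries.commute_X a).eq]
  have htψ : ∀ p, t * psi p = psi p * t := const_psi _
  have hty : ∀ i, t * letterSeq (φ ∘ X) i = letterSeq (φ ∘ X) i * t := fun i => by
    rw [← comp_letterSeq]; exact htφ _
  set n := N + 1 with hn
  -- These series satisfy η_c = h_c + t η_{c+1} and commute because the complete sums do.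
  set η : ℤ → R⟦X⟧ := fun c => PowerSeries.mk fun m => csum (letterSeq X) (2 * n) (c + m) with hη
  have hξ : ∀ c, const (η c) = csum (letterSeq (φ ∘ X)) (2 * n) c + t * const (η (c + 1)) := by
    intro c
    rw [← comp_letterSeq, ← map_csum, hφa, ht, ← map_mul, ← map_add]
    congr 1
    ext m
    cases m with
    | zero => simp [hη]
    | succ m =>
      simp only [hη, coeff_mk, map_add, coeff_succ_X_mul, coeff_C]
      simp [add_assoc, add_comm (m : ℤ) 1]
  have hηη : ∀ c d, η c * η d = η d * η c := by
    intro c d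
    ext m
    rw [coeff_mul, coeff_mul, ← Finset.Nat.sum_antidiagonal_swap]
    refine Finset.sum_congr rfl fun x _ => ?_
    simp only [hη, coeff_mk, Prod.fst_swap, Prod.snd_swap]
    exact hX.csum_comm _ _ _
  have hξξ : ∀ c d, const (η c) * const (η d) = const (η d) * const (η c) := fun c d => by
    rw [← map_mul, ← map_mul, hηη]
  have hξψ : ∀ c p, const (η c) * psi p = psi p * const (η c) := fun c p => const_psi _ _
  have htξ : ∀ c, t * const (η c) = const (η c) * t := fun c => htφ _
  -- The extra 1 keeps `L` positive for the empty diagram; the product below has `L + 1` rows, so a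
  -- strip has room for a new row.
  set L := ν.colLen 0 + 1 with hL
  have hν : Antitone ν.rowLen := fun _ _ h => ν.rowLen_anti _ _ h
  have hνL : ν.rowLen L = 0 := YoungDiagram.rowLen_eq_zero_of_le (by omega)
  have e1 := prodDesc_geometric hψ hξ hξψ htψ htξ hνL hty
    (prodDesc_complForm_eq (grassmannFor_shiftedPsi hψ htψ hty) hy ν (by omega) (by omega))
  -- Row 0 has no row above it to cut its series, so it is split by hand after t^k; the tail carries
  -- t^(k+1) and disappears from the coefficient of t^k.
  rw [prodDesc_truncate hψ hξ hξψ hξξ hν (L + 1) L,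
    linForm_geometric_sub (n := n) (ξ := fun c => const (η c)) hξ (L + 1) (k + 1)] at e1
  set g : ℕ → ℕ := fun i => if i = 0 then k + 1 else ν.rowLen (i - 1) - ν.rowLen i + 1 with hg
  set G : ℕ → ℕ → B := fun i m =>
    t ^ m * complForm (letterSeq (φ ∘ X)) psi (L + 1) n ((ν.rowLen i : ℤ) - i + m) with hG
  set Z := linForm psi (L + 1) fun p => const (η (↑(ν.rowLen 0) + ↑(k + 1) + ↑p)) with hZ
  set A := prodDesc (fun i => ∑ m ∈ Finset.range (g i), G i m) 1 L with hA
  obtain ⟨S, hS, hexp⟩ := exists_prodDesc_sum (B := B) g (L + 1)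
  have e2 : ∑ κ ∈ S, prodDesc (fun i => G i (κ i)) 0 (L + 1) + A * (t ^ (k + 1) * Z) =
        const (η 0) * prodDesc psi 0 (L + 1) * tableauSum (φ ∘ X) ν := by
    rw [← e1, mul_add, ← hexp, prodDesc_succ, zero_add, ← hA, hA, ← prodDesc_shift _ 0]
    congr 1
  have hA_t : A * t ^ (k + 1) = t ^ (k + 1) * A := by
    have h1 : ∀ p, psi p * t = t * psi p := fun p => (htψ p).symm
    have h2 : ∀ i, (∑ m ∈ Finset.range (g i), G i m) * t =
        t * ∑ m ∈ Finset.range (g i), G i m := fun i => by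
      rw [Finset.sum_mul, Finset.mul_sum]
      refine Finset.sum_congr rfl fun m _ => ?_
      rw [hG]
      dsimp only
      rw [mul_assoc, ← GrassmannFor.complForm_commute (b := t) _ (fun i _ => hty i) htψ,
        ← mul_assoc, ← mul_assoc, ← pow_succ, ← pow_succ']
    have h3 : Commute t A := mul_prodDesc_comm (fun i => (h2 i).symm) 1 L
    exact (h3.symm.pow_right _).eq
  have hterm : ∀ κ ∈ S, ∀ lam : YoungDiagram, (∀ i, lam.rowLen i = ν.rowLen i + κ i) →
      top (L + 1) (prodDesc (fun i => G i (κ i)) 0 (L + 1)) =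
        PowerSeries.X ^ (∑ i ∈ Finset.range (L + 1), κ i) *
          PowerSeries.C (R := R) (tableauSum X lam) := by
    intro κ hκ lam hlam
    have h1 : lam.colLen 0 ≤ L + 1 := by
      by_contra! hcon
      have h2 := (lam.lt_colLen_iff (L + 1)).1 hcon
      rw [hlam, ((hS κ).1 hκ).2 _ le_rfl, YoungDiagram.rowLen_eq_zero_of_le (by omega)] at h2
      omega
    have h2 := prodDesc_complForm_eq hψ hy lam h1 (by omega)
    rw [hG]
    dsimp only
    rw [prodDesc_pow_mul fun i =>
      GrassmannFor.complForm_commute (b := t) _ (fun i _ => hty i) htψ _]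
    have h3 : ∀ i, ((ν.rowLen i : ℤ) - i + κ i) = (lam.rowLen i : ℤ) - i := fun i => by
      rw [hlam]; push_cast; ring
    simp only [h3]
    rw [h2, ← map_tableauSum, hφa, ← mul_prodDesc_comm (const_psi _), ht, ← map_pow, top_mul,
      top_mul, top_psi, mul_one]
  -- First the coefficient of ψ_L ⋯ ψ_0, then that of t^k.
  have e3 := congrArg (fun x => coeff k (top (L + 1) x)) e2
  simp only [map_add, map_sum] at e3
  rw [← mul_assoc, hA_t, mul_assoc (t ^ _), ht, ← map_pow, top_mul, mul_assoc, top_mul,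
    ← map_tableauSum, hφa, ← mul_prodDesc_comm (const_psi _), top_mul, top_psi, mul_one,
    coeff_mul_C, coeff_X_pow_mul', if_neg (by omega), add_zero] at e3
  have e4 : coeff k (η 0) = csum (letterSeq X) (2 * n) k := by simp [hη]
  rw [hn] at e4
  rw [← e4, ← e3]
  have e5 := YoungDiagram.sum_strips_eq (ν := ν) (F := tableauSum X) (L := L) (k := k) (S := S)
    (g := g) (by omega) (by simp [hg]) (by simp [hg]) hS
    (G := fun κ => coeff k (top (L + 1) (prodDesc (fun i => G i (κ i)) 0 (L + 1))))
    fun κ hκ hk lam hlam => by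
      rw [hterm κ hκ lam hlam, hk, coeff_X_pow_mul', if_pos le_rfl, Nat.sub_self, coeff_zero_C]
  rw [← e5, Finset.sum_filter]
  refine Finset.sum_congr rfl fun κ hκ => ?_
  split_ifs with hk
  · rfl
  · obtain ⟨lam, hlam⟩ := YoungDiagram.exists_rowLen_of_mem (ν := ν) (L := L) (by omega)
      (by simp [hg]) hS hκ
    rw [hterm κ hκ lam hlam, coeff_X_pow_mul']
    split_ifs with hle
    · rw [coeff_C, if_neg (by omega)]
    · rfl


/-! ### The quotient by `I_kron` -/

section Quotient

variable {N : ℕ}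

namespace Letter

theorem down_eq_some {x y : Letter N} (h : y.idx = x.idx + 1) : y.down = some x := by
  rcases y with ⟨_ | b, hb⟩ | b <;> rcases x with a | a <;>
    simp only [idx, pos, down, Option.some.injEq, Letter.plain.injEq, Letter.bar.injEq,
      Fin.ext_iff, reduceCtorEq] at h ⊢ <;> omega

theorem downTwo_eq_some {x z : Letter N} (h : z.idx = x.idx + 2) : z.downTwo = some x := by
  obtain ⟨y, hy⟩ := exists_idx_eq (N := N) (i := x.idx + 1) (by omega) (by
    have := z.idx_le
    omega)
  rw [downTwo, down_eq_some (by omega : z.idx = y.idx + 1), Option.bind_some, down_eq_some hy]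

end Letter

/-- The letters of the quotient ring. -/
noncomputable def kronLetter (x : Letter N) : (Ikron N).ringCon.Quotient :=
  (Ikron N).ringCon.mk' (u x)

theorem mk_eq_mk_iff {f g : FreeU N} :
    (Ikron N).ringCon.mk' f = (Ikron N).ringCon.mk' g ↔ f - g ∈ Ikron N := by
  rw [← sub_eq_zero, ← map_sub, ← TwoSidedIdeal.mem_ker, TwoSidedIdeal.ker_ringCon_mk']

theorem mk_eq_of_kronRel {f g : FreeU N} (h : KronRel N f g) :
    (Ikron N).ringCon.mk' f = (Ikron N).ringCon.mk' g :=
  mk_eq_mk_iff.2 (TwoSidedIdeal.subset_span ⟨f, g, h, rfl⟩)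

/-- Relations involving an index outside 1, …, 2N are trivial because that letter is zero. The
others are the generators of the ideal, rewritten with commutators. -/
theorem kronLetters_kronLetter : KronLetters (letterSeq (kronLetter (N := N))) := by
  have hzero : ∀ i, ¬(0 < i ∧ i ≤ 2 * N) → letterSeq (kronLetter (N := N)) i = 0 := fun i =>
    letterSeq_of_not _
  have hcases : ∀ i, (∃ x : Letter N, x.idx = i) ∨ letterSeq (kronLetter (N := N)) i = 0 :=
    fun i => by
      by_cases h : 0 < i ∧ i ≤ 2 * N
      · exact Or.inl (Letter.exists_idx_eq h.1 h.2)
      · exact Or.inr (hzero i h)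
  refine ⟨fun i j h => ?_, fun i => ?_, fun i j h h' => ?_, fun i j h h' => ?_,
    fun i j h h' => ?_, fun i j h h' => ?_⟩
  · rcases hcases i with ⟨x, rfl⟩ | hi
    · rcases hcases j with ⟨z, rfl⟩ | hj
      · obtain ⟨z', hz'⟩ := Letter.exists_idx_eq (N := N) (i := z.idx - 2) (by omega) (by
          have := z.idx_le
          omega)
        have := mk_eq_of_kronRel (.far x z z' (Letter.downTwo_eq_some (by omega))
          (Letter.lt_iff_idx.2 (by omega)))
        simp only [letterSeq_idx, kronLetter, ← map_mul, this]
      · simp [hj]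
    · simp [hi]
  · rcases hcases i with ⟨x, rfl⟩ | hi
    · rcases hcases (x.idx + 2) with ⟨z, hz⟩ | hj
      · obtain ⟨y, hy⟩ := Letter.exists_idx_eq (N := N) (i := x.idx + 1) (by omega) (by
          have := z.idx_le
          omega)
        have := mk_eq_of_kronRel (.rotate x y z (Letter.down_eq_some hy)
          (Letter.downTwo_eq_some hz))
        rw [commLetters, ← hz, ← hy]
        simp only [letterSeq_idx, kronLetter]
        simp only [map_mul, map_sub] at this
        rw [← neg_inj, ← neg_mul, ← mul_neg, neg_sub, this]
      · simp [commLetters, hj]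
    · simp [commLetters, hi]
  all_goals
    rcases hcases i with ⟨x, rfl⟩ | hi
    swap
    · simp [commLetters, hi]
    rcases hcases j with ⟨z, rfl⟩ | hj
    swap
    · simp [commLetters, hj]
  · have := mk_eq_of_kronRel (.yyx x z (z.isBarred_eq_false_iff.2 h') (Letter.lt_iff_idx.2 h))
    simp only [map_mul] at this
    simp only [commLetters, letterSeq_idx, kronLetter, mul_sub, ← mul_assoc, this, sub_self]
  · have := mk_eq_of_kronRel (.xyy x z (z.isBarred_iff.2 h') (Letter.lt_iff_idx.2 h))
    simp only [map_mul] at this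
    simp only [commLetters, letterSeq_idx, kronLetter, sub_mul, this, sub_self]
  · have := mk_eq_of_kronRel (.yyz x z (x.isBarred_iff.2 h') (Letter.lt_iff_idx.2 h))
    simp only [map_mul] at this
    simp only [commLetters, letterSeq_idx, kronLetter, mul_sub, ← mul_assoc, this, sub_self]
  · have := mk_eq_of_kronRel (.zyy x z (x.isBarred_eq_false_iff.2 h') (Letter.lt_iff_idx.2 h))
    simp only [map_mul] at this
    simp only [commLetters, letterSeq_idx, kronLetter, sub_mul, this, sub_self]

/-- The pairing with a fixed formal sum of words, as an additive map. -/
noncomputable def pairingHom (γ : ColoredWord N → ℤ) : FreeU N →+ ℤ where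
  toFun f := pairing f γ
  map_zero' := by simp [pairing]
  map_add' f g := by
    rw [pairing, MonoidAlgebra.coeff_add, Finsupp.sum_add_index'] <;> simp [pairing, add_mul]

theorem pairingHom_of (γ : ColoredWord N → ℤ) (w : ColoredWord N) :
    pairingHom γ (MonoidAlgebra.of ℤ _ w) = γ w := by
  simp [pairingHom, pairing, MonoidAlgebra.of]

theorem pairingHom_eq_of_mk_eq {γ : ColoredWord N → ℤ} (hγ : γ ∈ kronPerp N) {f g : FreeU N}
    (h : (Ikron N).ringCon.mk' f = (Ikron N).ringCon.mk' g) : pairingHom γ f = pairingHom γ g := by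
  rw [← sub_eq_zero, ← map_sub]
  exact hγ _ (mk_eq_mk_iff.1 h)

end Quotient


/-! ### Semistandard tableaux by largest entry -/

section Kostka

variable {ν lam : YoungDiagram}

/-- The semistandard tableaux of a given shape and weight. -/
def ssytOfWeight (ν : YoungDiagram) (m : ℕ →₀ ℕ) : Set (SemistandardYoungTableau ν) :=
  {T | ssytWeight T = m}

theorem ssytWeight_apply (T : SemistandardYoungTableau ν) (r : ℕ) :
    ssytWeight T r = (ν.cells.filter fun c => T c.1 c.2 = r).card := by
  rw [Finset.card_filter, ssytWeight, Finsupp.finsetSum_apply]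
  simp only [Finsupp.single_apply]

theorem degree_ssytWeight (T : SemistandardYoungTableau ν) : (ssytWeight T).degree = ν.card := by
  simp [ssytWeight]

theorem mem_support_of_mem_ssytOfWeight {m : ℕ →₀ ℕ} {T : SemistandardYoungTableau ν}
    (hT : T ∈ ssytOfWeight ν m) {c : ℕ × ℕ} (hc : c ∈ ν.cells) : T c.1 c.2 ∈ m.support := by
  rw [← show ssytWeight T = m from hT, Finsupp.mem_support_iff, ssytWeight_apply]
  exact Finset.card_ne_zero_of_mem (Finset.mem_filter.2 ⟨hc, rfl⟩)

theorem finite_ssytOfWeight (ν : YoungDiagram) (m : ℕ →₀ ℕ) : (ssytOfWeight ν m).Finite := by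
  refine Set.Finite.of_finite_image (f := fun T (c : ν.cells) => T c.1.1 c.1.2)
    ((Set.Finite.pi' fun _ : ν.cells => m.support.finite_toSet).subset ?_) ?_
  · rintro _ ⟨T, hT, rfl⟩ c
    exact mem_support_of_mem_ssytOfWeight hT c.2
  · intro T _ T' _ h
    ext i j
    by_cases hc : (i, j) ∈ ν
    · exact congrFun h ⟨(i, j), hc⟩
    · rw [T.zeros hc, T'.zeros hc]

/-- The number of semistandard tableaux of a given shape and weight. -/
noncomputable def kostka (ν : YoungDiagram) (m : ℕ →₀ ℕ) : ℕ := (ssytOfWeight ν m).ncard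

/-! ### Removing and adding the largest entry. -/

namespace SemistandardYoungTableau

/-- The shape of the part of a tableau with entries less than `r`. -/
def shapeBelow (T : SemistandardYoungTableau ν) (r : ℕ) : YoungDiagram where
  cells := ν.cells.filter fun c => T c.1 c.2 < r
  isLowerSet := by
    rintro ⟨a, b⟩ ⟨a', b'⟩ ⟨h1, h2⟩ h
    simp only [Finset.coe_filter, Set.mem_ofPred_eq, YoungDiagram.mem_cells] at h ⊢
    dsimp only at h1 h2
    have h3 : (a, b') ∈ ν := ν.up_left_mem le_rfl h2 h.1
    exact ⟨ν.up_left_mem h1 h2 h.1,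
      ((T.col_weak h1 h3).trans (T.row_weak_of_le h2 h.1)).trans_lt h.2⟩

theorem mem_shapeBelow {T : SemistandardYoungTableau ν} {r : ℕ} {c : ℕ × ℕ} :
    c ∈ T.shapeBelow r ↔ c ∈ ν ∧ T c.1 c.2 < r := by
  rw [← YoungDiagram.mem_cells, shapeBelow]
  simp

/-- The part of a tableau with entries less than `r`. -/
def below (T : SemistandardYoungTableau ν) (r : ℕ) :
    SemistandardYoungTableau (T.shapeBelow r) where
  entry i j := if (i, j) ∈ T.shapeBelow r then T i j else 0
  row_weak' {i j1 j2} hj h := by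
    rw [if_pos h, if_pos ((T.shapeBelow r).up_left_mem le_rfl hj.le h)]
    exact T.row_weak hj (mem_shapeBelow.1 h).1
  col_strict' {i1 i2 j} hi h := by
    rw [if_pos h, if_pos ((T.shapeBelow r).up_left_mem hi.le le_rfl h)]
    exact T.col_strict hi (mem_shapeBelow.1 h).1
  zeros' h := if_neg h

/-- Filling up a horizontal strip with a new largest entry. -/
def extend (T : SemistandardYoungTableau ν) (h : YoungDiagram.IsStrip ν lam) (r : ℕ)
    (hr : ∀ c ∈ ν, T c.1 c.2 < r) : SemistandardYoungTableau lam where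
  entry i j := if (i, j) ∈ ν then T i j else if (i, j) ∈ lam then r else 0
  row_weak' {i j1 j2} hj hc := by
    by_cases h2 : (i, j2) ∈ ν
    · rw [if_pos h2, if_pos (ν.up_left_mem le_rfl hj.le h2)]
      exact T.row_weak hj h2
    · rw [if_neg h2, if_pos hc]
      split_ifs with h3
      · exact (hr _ h3).le
      · exact le_rfl
      · exact Nat.zero_le _
  col_strict' {i1 i2 j} hi hc := by
    have h1 : (i1, j) ∈ ν := by
      rw [YoungDiagram.mem_iff_lt_rowLen] at hc ⊢
      exact (hc.trans_le (lam.rowLen_anti _ _ hi)).trans_le (h i1).2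
    rw [if_pos h1]
    split_ifs with h2
    · exact T.col_strict hi h2
    · exact hr _ h1
  zeros' {i j} hc := by
    have h1 : (i, j) ∉ ν := fun h1 => hc <| by
      rw [YoungDiagram.mem_iff_lt_rowLen] at h1 ⊢
      exact h1.trans_le (h i).1
    rw [if_neg h1, if_neg hc]

end SemistandardYoungTableau

open SemistandardYoungTableau

theorem YoungDiagram.IsStrip.mem (h : YoungDiagram.IsStrip ν lam) {c : ℕ × ℕ} (hc : c ∈ ν) :
    c ∈ lam := by
  rw [YoungDiagram.mem_iff_lt_rowLen] at hc ⊢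
  exact hc.trans_le (h _).1

/-- By column strictness the maximal entry occurs at most once in a column. -/
theorem isStrip_shapeBelow {T : SemistandardYoungTableau lam} {r : ℕ}
    (hT : ∀ c ∈ lam, T c.1 c.2 ≤ r) : YoungDiagram.IsStrip (T.shapeBelow r) lam := by
  refine fun i => ⟨?_, ?_⟩
  · by_contra! h
    have := (mem_shapeBelow.1 (YoungDiagram.mem_iff_lt_rowLen.2 h)).1
    exact lt_irrefl _ (YoungDiagram.mem_iff_lt_rowLen.1 this)
  · by_contra! h
    have h1 := YoungDiagram.mem_iff_lt_rowLen.2 h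
    refine lt_irrefl _ (YoungDiagram.mem_iff_lt_rowLen.1 (mem_shapeBelow.2
      ⟨lam.up_left_mem (Nat.le_succ i) le_rfl h1, ?_⟩))
    exact (T.col_strict (Nat.lt_succ_self i) h1).trans_le (hT _ h1)

/-- `extend` and `below` are inverse to each other: the entries r occupy precisely the strip, whose
size is the multiplicity of r in the weight. -/
theorem ncard_shapeBelow_eq {r : ℕ} {m : ℕ →₀ ℕ} (hm : ∀ i, r < i → m i = 0)
    (h : lam ∈ ν.strips (m r)) :
    {T ∈ ssytOfWeight lam m | T.shapeBelow r = ν}.ncard = kostka ν (m.erase r) := by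
  obtain ⟨hcard, hstrip⟩ := YoungDiagram.mem_strips.1 h
  have hlt : ∀ T' ∈ ssytOfWeight ν (m.erase r), ∀ c ∈ ν, T' c.1 c.2 < r := fun T' hT' c hc => by
    have h1 := mem_support_of_mem_ssytOfWeight hT' ((YoungDiagram.mem_cells c).2 hc)
    rw [Finsupp.mem_support_iff] at h1
    by_contra! h2
    rcases h2.eq_or_lt with h2 | h2
    · exact h1 (by rw [← h2, Finsupp.erase_same])
    · exact h1 (by rw [Finsupp.erase_ne h2.ne', hm _ h2])
  refine (Set.ncard_congr (s := ssytOfWeight ν (m.erase r))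
    (fun T' hT' => T'.extend hstrip r (hlt T' hT')) ?_ ?_ ?_).symm
  · intro T' hT'
    have hT'w : ssytWeight T' = m.erase r := hT'
    have hv : ∀ c ∈ lam, c ∉ ν → T'.extend hstrip r (hlt T' hT') c.1 c.2 = r := fun c h1 h2 => by
      change (if _ then _ else if _ then _ else _) = r
      rw [if_neg h2, if_pos h1]
    have hv' : ∀ c ∈ ν, T'.extend hstrip r (hlt T' hT') c.1 c.2 = T' c.1 c.2 := fun c h2 => by
      change (if _ then _ else if _ then _ else _) = _
      rw [if_pos h2]
    have hsub : ν.cells ⊆ lam.cells := fun c hc => hstrip.mem hc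
    refine ⟨?_, ?_⟩
    · change ssytWeight _ = m
      ext i
      by_cases hi : i = r
      · subst hi
        rw [ssytWeight_apply]
        have : (lam.cells.filter fun c => T'.extend hstrip i (hlt T' hT') c.1 c.2 = i) =
            lam.cells \ ν.cells := by
          ext c
          rw [Finset.mem_filter, Finset.mem_sdiff]
          refine and_congr_right fun hc => ⟨fun h1 h2 => ?_, fun h1 => hv c hc h1⟩
          rw [hv' c h2] at h1
          exact (hlt T' hT' c h2).ne h1
        rw [this, Finset.card_sdiff_of_subset hsub]
        change lam.card - ν.card = m i
        omega
      · rw [← Finsupp.erase_ne (f := m) hi, ← hT'w, ssytWeight_apply, ssytWeight_apply]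
        congr 1
        ext c
        rw [Finset.mem_filter, Finset.mem_filter]
        constructor
        · rintro ⟨h1, h2⟩
          by_cases h3 : c ∈ ν
          · exact ⟨h3, by rwa [hv' c h3] at h2⟩
          · rw [hv c h1 h3] at h2
            exact absurd h2.symm hi
        · rintro ⟨h1, h2⟩
          exact ⟨hsub h1, by rw [hv' c h1, h2]⟩
    · ext c
      rw [YoungDiagram.mem_cells, YoungDiagram.mem_cells, mem_shapeBelow]
      constructor
      · rintro ⟨h1, h2⟩
        by_contra h3
        rw [hv c h1 h3] at h2
        exact lt_irrefl _ h2
      · exact fun h1 => ⟨hstrip.mem h1, by rw [hv' c h1]; exact hlt T' hT' c h1⟩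
  · intro T T' hT hT' heq
    ext i j
    by_cases hc : (i, j) ∈ ν
    · have h1 : T.extend hstrip r (hlt T hT) i j = T'.extend hstrip r (hlt T' hT') i j := by
        rw [heq]
      change (if _ then _ else if _ then _ else _) = (if _ then _ else if _ then _ else _) at h1
      rwa [if_pos hc, if_pos hc] at h1
    · rw [T.zeros hc, T'.zeros hc]
  · rintro T ⟨hT, rfl⟩
    have hTw : ssytWeight T = m := hT
    have hle : ∀ c ∈ lam, T c.1 c.2 ≤ r := fun c hc => by
      have h1 := mem_support_of_mem_ssytOfWeight hT ((YoungDiagram.mem_cells c).2 hc)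
      rw [Finsupp.mem_support_iff] at h1
      by_contra! h2
      exact h1 (hm _ h2)
    have hv : ∀ c ∈ T.shapeBelow r, T.below r c.1 c.2 = T c.1 c.2 := fun c hc => if_pos hc
    have hmem : T.below r ∈ ssytOfWeight (T.shapeBelow r) (m.erase r) := by
      change ssytWeight _ = _
      ext i
      rw [ssytWeight_apply, Finsupp.erase_apply]
      split_ifs with hi
      · rw [Finset.card_eq_zero, Finset.filter_eq_empty_iff]
        intro c hc h1
        rw [hv c hc, hi] at h1
        exact (mem_shapeBelow.1 hc).2.ne h1
      · rw [← hTw, ssytWeight_apply]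
        congr 1
        ext c
        rw [Finset.mem_filter, Finset.mem_filter]
        constructor
        · rintro ⟨h1, h2⟩
          exact ⟨(mem_shapeBelow.1 h1).1, by rwa [hv c h1] at h2⟩
        · rintro ⟨h1, h2⟩
          have h3 : c ∈ T.shapeBelow r := mem_shapeBelow.2 ⟨h1, by
            have := hle c h1
            omega⟩
          exact ⟨h3, by rw [hv c h3, h2]⟩
    refine ⟨T.below r, hmem, ?_⟩
    ext i j
    change (if (i, j) ∈ T.shapeBelow r then (if (i, j) ∈ T.shapeBelow r then T i j else 0) else
      if (i, j) ∈ lam then r else 0) = T i j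
    split_ifs with h1 h2
    · rfl
    · have h3 := hle _ h2
      by_contra h4
      exact h1 (mem_shapeBelow.2 ⟨h2, by dsimp only at h3 ⊢; omega⟩)
    · exact (T.zeros h2).symm

/-- The recursion for the Kostka numbers that removes the largest entry. -/
theorem kostka_eq_sum {r : ℕ} {m : ℕ →₀ ℕ} (hm : ∀ i, r < i → m i = 0) {n : ℕ}
    (hn : lam.card = n + m r) :
    kostka lam m = ∑ ν ∈ (finite_youngDiagram_card n).toFinset,
      open Classical in if lam ∈ ν.strips (m r) then kostka ν (m.erase r) else 0 := by
  classical
  have hle : ∀ T ∈ ssytOfWeight lam m, ∀ c ∈ lam, T c.1 c.2 ≤ r := fun T hT c hc => by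
    have h1 := mem_support_of_mem_ssytOfWeight hT ((YoungDiagram.mem_cells c).2 hc)
    rw [Finsupp.mem_support_iff] at h1
    by_contra! h2
    exact h1 (hm _ h2)
  have hsize : ∀ T ∈ ssytOfWeight lam m, (T.shapeBelow r).card = n := fun T hT => by
    have h1 : (lam.cells.filter fun c => T c.1 c.2 < r).card +
        (lam.cells.filter fun c => ¬ T c.1 c.2 < r).card = lam.card :=
      Finset.card_filter_add_card_filter_not _
    have h2 : (lam.cells.filter fun c => ¬ T c.1 c.2 < r).card = m r := by
      rw [← show ssytWeight T = m from hT, ssytWeight_apply]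
      congr 1
      refine Finset.filter_congr fun c hc => ?_
      have := hle T hT c hc
      omega
    change (lam.cells.filter fun c => T c.1 c.2 < r).card = n
    omega
  rw [kostka, Set.ncard_eq_toFinset_card _ (finite_ssytOfWeight lam m),
    Finset.card_eq_sum_card_fiberwise (f := fun T => T.shapeBelow r)
      (t := (finite_youngDiagram_card n).toFinset)]
  · refine Finset.sum_congr rfl fun ν hν => ?_
    have hν' : ν.card = n := by simpa using hν
    split_ifs with h
    · rw [← ncard_shapeBelow_eq hm h, ← Set.ncard_coe_finset]
      congr 1
      ext T
      simp
    · rw [Finset.card_eq_zero, Finset.filter_eq_empty_iff]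
      rintro T hT rfl
      have hT' : T ∈ ssytOfWeight lam m := by simpa using hT
      exact h (YoungDiagram.mem_strips.2 ⟨by rw [hsize T hT', hn],
        isStrip_shapeBelow (hle T hT')⟩)
  · intro T hT
    have hT' : T ∈ ssytOfWeight lam m := by simpa using hT
    simpa using hsize T hT'

end Kostka


/-! ### Products of complete sums -/

theorem coloredTableau_sqread_bot {N : ℕ} (T : ColoredTableau N ⊥) : T.sqread = 1 := by
  have h1 : (⊥ : YoungDiagram).colLen 0 = 0 := by
    by_contra h
    exact YoungDiagram.notMem_bot _ (YoungDiagram.mem_iff_lt_colLen.2 (Nat.pos_of_ne_zero h))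
  have h2 : (⊥ : YoungDiagram).rowLen 0 = 0 := by
    by_contra h
    exact YoungDiagram.notMem_bot _ (YoungDiagram.mem_iff_lt_rowLen.2 (Nat.pos_of_ne_zero h))
  rw [ColoredTableau.sqread, h1, h2]
  rfl

theorem card_coloredTableau_bot (N : ℕ) : Fintype.card (ColoredTableau N ⊥) = 1 := by
  have : IsEmpty {c // c ∈ (⊥ : YoungDiagram).cells} :=
    ⟨fun c => YoungDiagram.notMem_bot _ c.2⟩
  refine Fintype.card_eq_one_iff.2 ⟨⟨isEmptyElim, fun c => isEmptyElim c, fun c => isEmptyElim c,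
    fun c => isEmptyElim c, fun c => isEmptyElim c⟩, fun T => ?_⟩
  ext c
  exact isEmptyElim c

theorem tableauSum_bot {R : Type*} [Ring R] {N : ℕ} (X : Letter N → R) :
    tableauSum X ⊥ = 1 := by
  simp [tableauSum, coloredTableau_sqread_bot, card_coloredTableau_bot]

theorem kostka_bot_zero : kostka ⊥ 0 = 1 := by
  rw [kostka, Set.ncard_eq_one]
  refine ⟨SemistandardYoungTableau.highestWeight ⊥, Set.eq_singleton_iff_unique_mem.2
    ⟨?_, fun T _ => ?_⟩⟩
  · change ssytWeight _ = 0
    simp [ssytWeight]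
  · ext i j
    rw [T.zeros (YoungDiagram.notMem_bot _),
      SemistandardYoungTableau.zeros _ (YoungDiagram.notMem_bot _)]

theorem card_eq_zero_iff_eq_bot {ν : YoungDiagram} : ν.card = 0 ↔ ν = ⊥ := by
  rw [YoungDiagram.card, Finset.card_eq_zero, YoungDiagram.ext_iff, YoungDiagram.cells_bot]

/-- The product of the complete sums of degrees `m 0, …, m (r - 1)`. -/
def csumProd {R : Type*} [Ring R] (y : ℕ → R) (n : ℕ) (m : ℕ → ℕ) (r : ℕ) : R :=
  ((List.range r).map fun i => csum y n (m i)).prod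

section CsumProd

variable {R : Type*} [Ring R] {y : ℕ → R}

@[simp] theorem csumProd_zero (n : ℕ) (m : ℕ → ℕ) : csumProd y n m 0 = 1 := rfl

theorem csumProd_succ (n : ℕ) (m : ℕ → ℕ) (r : ℕ) :
    csumProd y n m (r + 1) = csumProd y n m r * csum y n (m r) := by
  simp [csumProd, List.range_succ]

theorem csumProd_congr (n : ℕ) {m m' : ℕ → ℕ} {r : ℕ} (h : ∀ i < r, m i = m' i) :
    csumProd y n m r = csumProd y n m' r := by
  rw [csumProd, csumProd, List.map_congr_left fun i hi => by rw [h i (List.mem_range.1 hi)]]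

theorem KronLetters.csumProd_comm (hy : KronLetters y) (n : ℕ) (m : ℕ → ℕ) (r : ℕ) (k : ℤ) :
    csumProd y n m r * csum y n k = csum y n k * csumProd y n m r := by
  induction r with
  | zero => simp
  | succ r ih => rw [csumProd_succ, mul_assoc, hy.csum_comm, ← mul_assoc, ih, mul_assoc]

theorem map_csumProd {A : Type*} [Ring A] (φ : R →+* A) (n : ℕ) (m : ℕ → ℕ) (r : ℕ) :
    φ (csumProd y n m r) = csumProd (φ ∘ y) n m r := by
  induction r with
  | zero => simp
  | succ r ih => rw [csumProd_succ, csumProd_succ, map_mul, ih, map_csum]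

end CsumProd

/-- The expansion of a product of complete sums in tableau sums. -/
theorem csumProd_eq_sum {R : Type*} [Ring R] {N : ℕ} {X : Letter N → R}
    (hX : KronLetters (letterSeq X)) (r : ℕ) {m : ℕ →₀ ℕ} (hm : ∀ i, r ≤ i → m i = 0) :
    csumProd (letterSeq X) (2 * (N + 1)) m r =
      ∑ ν ∈ (finite_youngDiagram_card m.degree).toFinset, kostka ν m • tableauSum X ν := by
  classical
  induction r generalizing m with
  | zero =>
    obtain rfl : m = 0 := Finsupp.ext fun i => hm i (Nat.zero_le i)
    have : (finite_youngDiagram_card (0 : ℕ →₀ ℕ).degree).toFinset = {⊥} := by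
      ext ν
      simpa using card_eq_zero_iff_eq_bot (ν := ν)
    rw [this, Finset.sum_singleton, kostka_bot_zero, tableauSum_bot, csumProd_zero, one_smul]
  | succ r ih =>
    have h0 : ∀ i, r ≤ i → m.erase r i = 0 := fun i hi => by
      rcases hi.eq_or_lt with rfl | hi
      · exact Finsupp.erase_same
      · rw [Finsupp.erase_ne hi.ne', hm i hi]
    have hdeg : m.degree = (m.erase r).degree + m r := by
      conv_lhs => rw [← Finsupp.erase_add_single r m]
      simp
    -- The last factor is commuted to the front, because the Pieri rule multiplies on the left.
    rw [csumProd_succ, hX.csumProd_comm,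
      csumProd_congr _ fun i hi => (Finsupp.erase_ne (f := m) hi.ne).symm, ih h0, Finset.mul_sum]
    have h1 : ∀ lam ∈ (finite_youngDiagram_card m.degree).toFinset, kostka lam m •
        tableauSum X lam = ∑ ν ∈ (finite_youngDiagram_card (m.erase r).degree).toFinset,
          if lam ∈ ν.strips (m r) then kostka ν (m.erase r) • tableauSum X lam else 0 := by
      intro lam hlam
      have hlam' : lam.card = m.degree := by simpa using hlam
      rw [kostka_eq_sum (fun i hi => hm i hi) (hlam'.trans hdeg), Finset.sum_smul]
      refine Finset.sum_congr rfl fun ν _ => ?_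
      split_ifs <;> simp
    rw [Finset.sum_congr rfl h1, Finset.sum_comm]
    refine Finset.sum_congr rfl fun ν hν => ?_
    have hν' : ν.card = (m.erase r).degree := by simpa using hν
    rw [← Finset.sum_filter, mul_smul_comm, csum_mul_tableauSum hX, Finset.smul_sum]
    refine Finset.sum_congr ?_ fun _ _ => rfl
    ext lam
    simp only [Finset.mem_filter, Set.Finite.mem_toFinset, Set.mem_ofPred_eq]
    refine ⟨fun h => ⟨?_, h⟩, fun h => h.2⟩
    rw [(YoungDiagram.mem_strips.1 h).1, hν', hdeg]


/-! ### Products of complete sums as sums of words -/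

section Words

variable {N : ℕ}

/-- Consecutive letters `a`, `b` without a descent. -/
def Letter.Step (a b : Letter N) : Prop := a < b ∨ (a = b ∧ a.IsBarred = false)

theorem Letter.not_step_iff {a b : Letter N} :
    ¬a.Step b ↔ b < a ∨ (a = b ∧ a.IsBarred = true) := by
  rw [Letter.Step, not_or, not_lt, not_and, Bool.not_eq_false, le_iff_lt_or_eq]
  constructor
  · rintro ⟨h | h, h'⟩
    · exact Or.inl h
    · exact Or.inr ⟨h.symm, h' h.symm⟩
  · rintro (h | ⟨h, h'⟩)
    · exact ⟨Or.inl h, fun e => absurd e.symm h.ne⟩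
    · exact ⟨Or.inr h.symm, fun _ => h'⟩

/-- This is the dichotomy in the recursion of `csumNat`: before an even letter the index bound
stays, before an odd one it goes up by one. -/
theorem Letter.step_iff_idx {a b : Letter N} :
    a.Step b ↔ a.idx < if b.idx % 2 = 0 then b.idx else b.idx + 1 := by
  rw [Letter.Step, Letter.lt_iff_idx, ← Letter.idx_injective.eq_iff,
    Letter.isBarred_eq_false_iff]
  split_ifs <;> omega

theorem Letter.Step.trans {a b c : Letter N} (h : a.Step b) (h' : b.Step c) : a.Step c := by
  rw [Letter.step_iff_idx] at *
  split_ifs at * <;> omega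

/-- The words of length `k` in the letters with index less than `n` that have no descents. -/
noncomputable def chainWords (N n k : ℕ) : Finset (List (Letter N)) :=
  open Classical in (List.finite_length_eq (Letter N) k).toFinset.filter fun w =>
    w.Pairwise Letter.Step ∧ ∀ x ∈ w, x.idx < n

theorem mem_chainWords {n k : ℕ} {w : List (Letter N)} : w ∈ chainWords N n k ↔
    w.length = k ∧ w.Pairwise Letter.Step ∧ ∀ x ∈ w, x.idx < n := by
  simp [chainWords]

/-- A word as an element of the free algebra. -/
noncomputable def wordMonomial (w : List (Letter N)) : FreeU N :=
  MonoidAlgebra.of ℤ (ColoredWord N) (FreeMonoid.ofList w)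

theorem wordMonomial_nil : wordMonomial ([] : List (Letter N)) = 1 :=
  map_one (MonoidAlgebra.of ℤ (ColoredWord N))

theorem wordMonomial_append (w w' : List (Letter N)) :
    wordMonomial (w ++ w') = wordMonomial w * wordMonomial w' := by
  rw [wordMonomial, FreeMonoid.ofList_append, map_mul]
  rfl

theorem wordMonomial_singleton (x : Letter N) : wordMonomial [x] = u x := rfl

theorem chainWords_succ_of_forall_ne {n k : ℕ} (h : ∀ x : Letter N, x.idx ≠ n) :
    chainWords N (n + 1) k = chainWords N n k := by
  ext w
  rw [mem_chainWords, mem_chainWords]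
  refine and_congr_right fun _ => and_congr_right fun _ => forall₂_congr fun x _ => ?_
  have := h x
  omega

/-- A descent-free word containing x as its largest letter ends with x; removing that letter gives
the second sum. -/
theorem sum_chainWords_succ (x : Letter N) (k : ℕ) {M : Type*} [AddCommMonoid M]
    (F : List (Letter N) → M) :
    ∑ w ∈ chainWords N (x.idx + 1) (k + 1), F w = ∑ w ∈ chainWords N x.idx (k + 1), F w +
      ∑ w ∈ chainWords N (if x.idx % 2 = 0 then x.idx else x.idx + 1) k, F (w ++ [x]) := by
  classical
  have h : chainWords N (x.idx + 1) (k + 1) = chainWords N x.idx (k + 1) ∪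
      (chainWords N (if x.idx % 2 = 0 then x.idx else x.idx + 1) k).image (· ++ [x]) := by
    ext w
    simp only [Finset.mem_union, Finset.mem_image, mem_chainWords]
    constructor
    · rintro ⟨h1, h2, h3⟩
      rcases List.eq_nil_or_concat w with rfl | ⟨w, z, rfl⟩
      · simp at h1
      rw [List.concat_eq_append] at *
      rw [List.pairwise_append] at h2
      have h4 : ∀ a ∈ w, a.Step z := fun a ha => h2.2.2 a ha z (by simp)
      have h5 : z.idx < x.idx + 1 := h3 z (by simp)
      by_cases h6 : z.idx = x.idx
      · obtain rfl := Letter.idx_injective h6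
        exact Or.inr ⟨w, ⟨by simpa using h1, h2.1, fun a ha =>
          Letter.step_iff_idx.1 (h4 a ha)⟩, rfl⟩
      · refine Or.inl ⟨h1, List.pairwise_append.2 h2, fun a ha => ?_⟩
        rcases List.mem_append.1 ha with ha | ha
        · have := Letter.step_iff_idx.1 (h4 a ha)
          split_ifs at this <;> omega
        · obtain rfl := List.mem_singleton.1 ha
          omega
    · rintro (⟨h1, h2, h3⟩ | ⟨w, ⟨h1, h2, h3⟩, rfl⟩)
      · exact ⟨h1, h2, fun a ha => (h3 a ha).trans (Nat.lt_succ_self _)⟩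
      · refine ⟨by simpa using h1, List.pairwise_append.2 ⟨h2, by simp, fun a ha b hb => ?_⟩,
          fun a ha => ?_⟩
        · obtain rfl := List.mem_singleton.1 hb
          exact Letter.step_iff_idx.2 (h3 a ha)
        · rcases List.mem_append.1 ha with ha | ha
          · have := h3 a ha
            split_ifs at this <;> omega
          · obtain rfl := List.mem_singleton.1 ha
            omega
  rw [h, Finset.sum_union, Finset.sum_image]
  · intro a _ b _ hab
    exact List.append_cancel_right hab
  · rw [Finset.disjoint_left]
    intro w hw hw'
    obtain ⟨w', _, rfl⟩ := Finset.mem_image.1 hw'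
    exact lt_irrefl _ ((mem_chainWords.1 hw).2.2 x (by simp))

theorem chainWords_zero_right (n : ℕ) : chainWords N n 0 = {[]} := by
  ext w
  rw [mem_chainWords, List.length_eq_zero_iff, Finset.mem_singleton]
  refine ⟨fun h => h.1, ?_⟩
  rintro rfl
  simp

theorem chainWords_zero_left (k : ℕ) : chainWords N 0 (k + 1) = ∅ := by
  refine Finset.eq_empty_of_forall_notMem fun w hw => ?_
  obtain ⟨h1, -, h2⟩ := mem_chainWords.1 hw
  rcases w with _ | ⟨a, w⟩
  · simp at h1
  · exact absurd (h2 a (by simp)) (Nat.not_lt_zero _)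

theorem csumNat_letterSeq_u (n k : ℕ) :
    csumNat (letterSeq (u (N := N))) n k = ∑ w ∈ chainWords N n k, wordMonomial w := by
  induction n generalizing k with
  | zero =>
    cases k with
    | zero => rw [chainWords_zero_right, Finset.sum_singleton, wordMonomial_nil,
        csumNat_zero_right]
    | succ k => rw [chainWords_zero_left, Finset.sum_empty, csumNat]
  | succ n ih =>
    induction k with
    | zero => rw [chainWords_zero_right, Finset.sum_singleton, wordMonomial_nil,
        csumNat_zero_right]
    | succ k ihk =>
      rw [csumNat]
      by_cases h : ∃ x : Letter N, x.idx = n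
      · obtain ⟨x, rfl⟩ := h
        rw [sum_chainWords_succ, ih, letterSeq_idx]
        congr 1
        simp only [wordMonomial_append, wordMonomial_singleton, ← Finset.sum_mul]
        congr 1
        split_ifs
        · exact ih k
        · exact ihk
      · rw [chainWords_succ_of_forall_ne fun x hx => h ⟨x, hx⟩, ih,
          letterSeq_of_not _ fun h' => h (Letter.exists_idx_eq h'.1 h'.2), mul_zero, add_zero]

/-- The list with `m i` entries `i` for each `i < r`, in increasing order. -/
def contentList (m : ℕ → ℕ) : ℕ → List ℕ
  | 0 => []
  | r + 1 => contentList m r ++ List.replicate (m r) r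

theorem lt_of_mem_contentList {m : ℕ → ℕ} {r i : ℕ} (h : i ∈ contentList m r) : i < r := by
  induction r with
  | zero => simp [contentList] at h
  | succ r ih =>
    rcases List.mem_append.1 h with h | h
    · exact (ih h).trans (Nat.lt_succ_self r)
    · rw [List.eq_of_mem_replicate h]
      exact Nat.lt_succ_self r

theorem pairwise_contentList (m : ℕ → ℕ) (r : ℕ) : (contentList m r).Pairwise (· ≤ ·) := by
  induction r with
  | zero => simp [contentList]
  | succ r ih =>
    refine List.pairwise_append.2 ⟨ih, by simp, fun a ha b hb => ?_⟩
    rw [List.eq_of_mem_replicate hb]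
    exact (lt_of_mem_contentList ha).le

theorem count_contentList (m : ℕ → ℕ) (r i : ℕ) :
    (contentList m r).count i = if i < r then m i else 0 := by
  induction r with
  | zero => simp [contentList]
  | succ r ih =>
    rw [contentList, List.count_append, ih, List.count_replicate]
    by_cases h : i = r
    · subst h
      simp
    · have h' : ¬ r = i := fun e => h e.symm
      simp only [beq_iff_eq, h', if_false, add_zero]
      exact if_congr (by omega) rfl rfl

/-- The lexicographic version of `Letter.Step`. -/
def LexStep (p q : Letter N × ℕ) : Prop := p.2 < q.2 ∨ (p.2 = q.2 ∧ p.1.Step q.1)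

instance : IsTrans (Letter N × ℕ) LexStep := ⟨fun a b c h h' => by
  rcases h with h | ⟨h, h1⟩ <;> rcases h' with h' | ⟨h', h2⟩
  · exact Or.inl (h.trans h')
  · exact Or.inl (h' ▸ h)
  · exact Or.inl (h ▸ h')
  · exact Or.inr ⟨h.trans h', h1.trans h2⟩⟩

/-- The concatenations of words without descents of lengths `m 0, …, m (r - 1)`. -/
noncomputable def blockWords (N : ℕ) (m : ℕ → ℕ) (r : ℕ) : Finset (List (Letter N)) :=
  open Classical in (List.finite_length_eq (Letter N) (contentList m r).length).toFinset.filter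
    fun w => (w.zip (contentList m r)).Pairwise LexStep

theorem mem_blockWords {m : ℕ → ℕ} {r : ℕ} {w : List (Letter N)} : w ∈ blockWords N m r ↔
    w.length = (contentList m r).length ∧ (w.zip (contentList m r)).Pairwise LexStep := by
  simp [blockWords]

theorem pairwise_zip_replicate_iff {w : List (Letter N)} {k : ℕ} (r : ℕ) (h : w.length = k) :
    (w.zip (List.replicate k r)).Pairwise LexStep ↔ w.Pairwise Letter.Step := by
  have : w.zip (List.replicate k r) = w.map fun a => (a, r) := by
    subst h
    induction w with
    | nil => rfl
    | cons a w ih => simp [List.replicate_succ, ih]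
  rw [this, List.pairwise_map]
  simp [LexStep]

/-- Between two blocks the index sequence strictly increases, so no condition links the last letter
of one to the first letter of the next. -/
theorem append_mem_blockWords {m : ℕ → ℕ} {r : ℕ} {w w' : List (Letter N)}
    (h : w.length = (contentList m r).length) :
    w ++ w' ∈ blockWords N m (r + 1) ↔
      w ∈ blockWords N m r ∧ w' ∈ chainWords N (2 * (N + 1)) (m r) := by
  rw [mem_blockWords, mem_blockWords, mem_chainWords, contentList, List.zip_append h,
    List.pairwise_append, List.length_append, List.length_append, List.length_replicate]
  constructor
  · rintro ⟨h1, h2, h3, -⟩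
    have h4 : w'.length = m r := by omega
    exact ⟨⟨h, h2⟩, h4, (pairwise_zip_replicate_iff r h4).1 h3, fun x _ => by
      have := x.idx_le
      omega⟩
  · rintro ⟨⟨-, h2⟩, h3, h4, -⟩
    refine ⟨by omega, h2, (pairwise_zip_replicate_iff r h3).2 h4, fun p hp q hq => Or.inl ?_⟩
    obtain ⟨a, i⟩ := p
    obtain ⟨b, j⟩ := q
    have h5 := lt_of_mem_contentList (List.of_mem_zip hp).2
    have h6 := List.eq_of_mem_replicate (List.of_mem_zip hq).2
    dsimp only
    omega

theorem csumProd_letterSeq_u (m : ℕ → ℕ) (r : ℕ) :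
    csumProd (letterSeq (u (N := N))) (2 * (N + 1)) m r =
      ∑ w ∈ blockWords N m r, wordMonomial w := by
  induction r with
  | zero =>
    have : blockWords N m 0 = {[]} := by
      ext w
      rw [mem_blockWords, contentList, List.length_nil, List.length_eq_zero_iff,
        Finset.mem_singleton]
      refine ⟨fun h => h.1, ?_⟩
      rintro rfl
      simp
    rw [this, Finset.sum_singleton, wordMonomial_nil, csumProd_zero]
  | succ r ih =>
    rw [csumProd_succ, ih, csum_natCast, csumNat_letterSeq_u, Finset.sum_mul_sum,
      ← Finset.sum_product']
    refine Finset.sum_bij' (fun p _ => p.1 ++ p.2)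
      (fun w _ => (w.take (contentList m r).length, w.drop (contentList m r).length))
      (fun p hp => ?_) (fun w hw => ?_) (fun p hp => ?_) (fun w hw => ?_) (fun p hp => ?_)
    · have hp' := Finset.mem_product.1 hp
      exact (append_mem_blockWords (mem_blockWords.1 hp'.1).1).2 hp'
    · rw [Finset.mem_product, ← append_mem_blockWords, List.take_append_drop]
      · exact hw
      · have h1 := (mem_blockWords.1 hw).1
        rw [contentList, List.length_append] at h1
        rw [List.length_take]
        omega
    · have h1 := (mem_blockWords.1 (Finset.mem_product.1 hp).1).1
      rw [← h1, List.take_left, List.drop_left]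
    · exact List.take_append_drop _ _
    · exact (wordMonomial_append _ _).symm

end Words


/-! ### Coefficients of the quasisymmetric generating function -/

section QuasiGen

variable {N : ℕ}

theorem sum_single_eq_iff {t r : ℕ} {m : ℕ →₀ ℕ} (hm : ∀ i, r ≤ i → m i = 0) {i : Fin t → ℕ} :
    ∑ k, Finsupp.single (i k) 1 = m ↔ (List.ofFn i).Perm (contentList m r) := by
  have h1 : ∀ c, (List.ofFn i).count c = (∑ k, Finsupp.single (i k) 1 : ℕ →₀ ℕ) c := fun c => by
    induction t with
    | zero => simp
    | succ t ih =>
      rw [List.ofFn_succ, List.count_cons, ih, Fin.sum_univ_succ, Finsupp.add_apply, add_comm,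
        Finsupp.single_apply]
      simp
  rw [List.perm_iff_count, Finsupp.ext_iff]
  refine forall_congr' fun c => ?_
  rw [h1, count_contentList]
  split_ifs with h
  · rfl
  · rw [hm c (by omega)]

/-- `LexStep` is transitive, so only neighbours matter; for a weakly increasing index sequence it
then fails exactly at a descent with equal indices. -/
theorem pairwise_zip_ofFn_iff {t : ℕ} {w : List (Letter N)} (hw : w.length = t) {i : Fin t → ℕ}
    (hi : Monotone i) : (w.zip (List.ofFn i)).Pairwise LexStep ↔
      i ∈ gesselSeqs t (descents (FreeMonoid.ofList w)) := by
  subst hw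
  rw [← List.isChain_iff_pairwise, List.isChain_iff_getElem]
  simp only [List.length_zip, List.length_ofFn, min_self, List.getElem_zip, List.getElem_ofFn,
    LexStep, gesselSeqs, Set.mem_ofPred_eq, hi, true_and]
  refine forall_congr' fun j => forall_congr' fun hj => ?_
  have hle : i ⟨j, Nat.lt_of_succ_lt hj⟩ ≤ i ⟨j + 1, hj⟩ := hi (Nat.le_succ j)
  have hdes : j ∈ descents (FreeMonoid.ofList w) ↔ ¬ (w[j]).Step (w[j + 1]) := by
    rw [Letter.not_step_iff]
    exact ⟨fun h => h.2, fun h => ⟨hj, h⟩⟩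
  rw [hdes]
  constructor
  · rintro (h | ⟨-, h⟩) h'
    · exact h
    · exact absurd h h'
  · intro h
    rcases hle.lt_or_eq with h' | h'
    · exact Or.inl h'
    · exact Or.inr ⟨h', by_contra fun h2 => (h h2).ne h'⟩

/-- A monomial determines its weakly increasing index sequence, namely `contentList m r`, so the
coefficient is 0 or 1 according to whether this sequence is admissible for the word. -/
theorem coeff_fundamentalQSym {r : ℕ} {m : ℕ →₀ ℕ} (hm : ∀ i, r ≤ i → m i = 0)
    (w : ColoredWord N) :
    MvPowerSeries.coeff m (fundamentalQSym w.toList.length (descents w)) =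
      open Classical in if w.toList ∈ blockWords N m r then 1 else 0 := by
  classical
  change (({i ∈ gesselSeqs w.toList.length (descents w) |
    ∑ k, Finsupp.single (i k) 1 = m}.ncard : ℕ) : ℤ) = _
  have hofFn : ∀ i ∈ gesselSeqs w.toList.length (descents w), ∑ k, Finsupp.single (i k) 1 = m →
      List.ofFn i = contentList m r := fun i hi h =>
    ((sum_single_eq_iff hm).1 h).eq_of_pairwise' hi.1.sortedLE_ofFn.pairwise
      (pairwise_contentList m r)
  split_ifs with hw
  · obtain ⟨h1, h2⟩ := mem_blockWords.1 hw
    rw [Nat.cast_eq_one, Set.ncard_eq_one]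
    have h3 : List.ofFn (fun k : Fin w.toList.length => (contentList m r)[k]) =
        contentList m r := by
      apply List.ext_getElem <;> simp [h1]
    have h4 : Monotone fun k : Fin w.toList.length => (contentList m r)[k] := by
      rw [← List.sortedLE_ofFn_iff, h3]
      exact (pairwise_contentList m r).sortedLE
    refine ⟨fun k => (contentList m r)[k], Set.eq_singleton_iff_unique_mem.2
      ⟨⟨(pairwise_zip_ofFn_iff rfl h4).1 (by rwa [h3]), (sum_single_eq_iff hm).2 (by rw [h3])⟩,
        fun i hi => List.ofFn_injective ((hofFn i hi.1 hi.2).trans h3.symm)⟩⟩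
  · rw [Nat.cast_eq_zero]
    refine (congrArg Set.ncard (Set.eq_empty_of_forall_notMem fun i hi => hw ?_)).trans
      (Set.ncard_empty _)
    have h1 := hofFn i hi.1 hi.2
    rw [mem_blockWords, ← h1]
    exact ⟨(List.length_ofFn).symm, (pairwise_zip_ofFn_iff rfl hi.1.1).2 hi.1⟩

/-- The admissible words are those of `blockWords`, which are also the words in the product of
complete sums. This turns coefficients into pairings. -/
theorem coeff_quasiGen (γ : ColoredWord N → ℤ) {r : ℕ} {m : ℕ →₀ ℕ}
    (hm : ∀ i, r ≤ i → m i = 0) : MvPowerSeries.coeff m (quasiGen γ) =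
      pairingHom γ (csumProd (letterSeq u) (2 * (N + 1)) m r) := by
  classical
  rw [csumProd_letterSeq_u, map_sum]
  simp only [wordMonomial, pairingHom_of]
  change ∑ᶠ w : ColoredWord N, _ = _
  simp only [coeff_fundamentalQSym hm]
  rw [finsum_eq_sum_of_support_subset (s := (blockWords N m r).map
    FreeMonoid.ofList.toEmbedding)]
  · rw [Finset.sum_map]
    exact Finset.sum_congr rfl fun w hw => by simp [hw]
  · intro w hw
    have h : w.toList ∈ blockWords N m r := by
      by_contra h
      exact hw (by simp [h])
    exact Finset.mem_coe.2 (Finset.mem_map.2 ⟨w.toList, h, rfl⟩)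

theorem pairingHom_tableauSum (W : Set (ColoredWord N)) (ν : YoungDiagram) :
    pairingHom (wordSum W) (tableauSum u ν) = {T : ColoredTableau N ν | T.sqread ∈ W}.ncard := by
  classical
  have h : ∀ w : ColoredWord N, FreeMonoid.lift u w = MonoidAlgebra.of ℤ (ColoredWord N) w :=
    fun w => by
      rw [show (u : Letter N → FreeU N) = MonoidAlgebra.of ℤ (ColoredWord N) ∘ FreeMonoid.of
        from rfl, ← FreeMonoid.lift_restrict (MonoidAlgebra.of ℤ (ColoredWord N))]
      simp
  rw [tableauSum, map_sum]
  simp only [h, pairingHom_of, wordSum, Set.indicator_apply, Pi.one_apply]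
  rw [Finset.sum_boole, ← Set.ncard_coe_finset]
  simp

/-- The coefficients of the generating function of a set of words orthogonal to `I_kron`. -/
theorem coeff_quasiGen_wordSum {W : Set (ColoredWord N)} (hW : wordSum W ∈ kronPerp N)
    (m : ℕ →₀ ℕ) : MvPowerSeries.coeff m (quasiGen (wordSum W)) =
      ∑ ν ∈ (finite_youngDiagram_card m.degree).toFinset,
        ({T : ColoredTableau N ν | T.sqread ∈ W}.ncard : ℤ) * kostka ν m := by
  obtain ⟨r, hr⟩ : ∃ r, ∀ i, r ≤ i → m i = 0 :=
    ⟨m.support.sup id + 1, fun i hi => by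
      by_contra h
      have := Finset.le_sup (f := id) (Finsupp.mem_support_iff.2 h)
      simp only [id] at this
      omega⟩
  -- The expansion holds only in the quotient, where the letters satisfy the Kronecker relations;
  -- orthogonality of `wordSum W` carries it back to the pairing.
  have h : (Ikron N).ringCon.mk' (csumProd (letterSeq u) (2 * (N + 1)) m r) =
      (Ikron N).ringCon.mk' (∑ ν ∈ (finite_youngDiagram_card m.degree).toFinset,
        kostka ν m • tableauSum u ν) := by
    rw [map_csumProd, comp_letterSeq, map_sum]
    simp only [map_nsmul, map_tableauSum]
    exact csumProd_eq_sum kronLetters_kronLetter r hr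
  rw [coeff_quasiGen _ hr, pairingHom_eq_of_mk_eq hW h, map_sum]
  refine Finset.sum_congr rfl fun ν _ => ?_
  rw [map_nsmul, pairingHom_tableauSum, nsmul_eq_mul, mul_comm]

end QuasiGen


/-! ### Uniqueness of Schur expansions -/

theorem isSchurExpansion_iff {f : MvPowerSeries ℕ ℤ} {c : YoungDiagram → ℤ} :
    IsSchurExpansion f c ↔ ∀ m : ℕ →₀ ℕ, MvPowerSeries.coeff m f =
      ∑ ν ∈ (finite_youngDiagram_card m.degree).toFinset, c ν * kostka ν m := by
  refine forall_congr' fun m => ?_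
  rw [finsum_eq_sum_of_support_subset]
  · rfl
  · intro ν hν
    have h1 : kostka ν m ≠ 0 := fun h => hν (by
      change c ν * (kostka ν m : ℤ) = 0
      rw [h, Nat.cast_zero, mul_zero])
    obtain ⟨T, hT⟩ := Set.nonempty_of_ncard_ne_zero h1
    rw [Set.Finite.coe_toFinset]
    exact (degree_ssytWeight T).symm.trans (congrArg _ hT)

namespace SemistandardYoungTableau

variable {ν lam : YoungDiagram}

theorem row_le (T : SemistandardYoungTableau ν) {i j : ℕ} (h : (i, j) ∈ ν) : i ≤ T i j := by
  induction i with
  | zero => exact Nat.zero_le _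
  | succ i ih =>
    exact (ih (ν.up_left_mem (Nat.le_succ i) le_rfl h)).trans_lt
      (T.col_strict (Nat.lt_succ_self i) h)

theorem weight_ssytWeight (T : SemistandardYoungTableau ν) :
    Finsupp.weight (id : ℕ → ℕ) (ssytWeight T) = ∑ c ∈ ν.cells, T c.1 c.2 := by
  simp [ssytWeight, map_sum, Finsupp.weight_single]

theorem sum_highestWeight : ∑ c ∈ ν.cells, highestWeight ν c.1 c.2 = ∑ c ∈ ν.cells, c.1 :=
  Finset.sum_congr rfl fun c hc => by
    rw [highestWeight_apply, if_pos ((YoungDiagram.mem_cells c).1 hc)]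

theorem ssytWeight_highestWeight (ν : YoungDiagram) (i : ℕ) :
    ssytWeight (highestWeight ν) i = ν.rowLen i := by
  rw [ssytWeight_apply, YoungDiagram.rowLen_eq_card]
  congr 1
  refine Finset.filter_congr fun c hc => ?_
  rw [highestWeight_apply, if_pos ((YoungDiagram.mem_cells c).1 hc)]

/-- Triangularity of the Kostka numbers. -/
theorem sum_row_lt_or_eq (T : SemistandardYoungTableau ν)
    (h : ssytWeight T = ssytWeight (highestWeight lam)) :
    ∑ c ∈ ν.cells, c.1 < ∑ c ∈ lam.cells, c.1 ∨ ν = lam := by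
  have h1 : ∑ c ∈ ν.cells, T c.1 c.2 = ∑ c ∈ lam.cells, c.1 := by
    rw [← weight_ssytWeight, h, weight_ssytWeight, sum_highestWeight]
  have h2 : ∀ c ∈ ν.cells, c.1 ≤ T c.1 c.2 := fun c hc =>
    T.row_le ((YoungDiagram.mem_cells c).1 hc)
  -- Entries in row i are at least i, while equal weights have equal entry sums. Equality of the row
  -- sums forces T to be the highest weight tableau, whose weight determines the shape.
  rcases (h1 ▸ Finset.sum_le_sum h2 : ∑ c ∈ ν.cells, c.1 ≤ _).lt_or_eq with h3 | h3
  · exact Or.inl h3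
  · right
    have h4 := (Finset.sum_eq_sum_iff_of_le h2).1 (h3.trans h1.symm)
    have h5 : T = highestWeight ν := by
      ext i j
      rw [highestWeight_apply]
      split_ifs with hc
      · exact (h4 (i, j) ((YoungDiagram.mem_cells _).2 hc)).symm
      · exact T.zeros hc
    refine YoungDiagram.ext_rowLen fun i => ?_
    rw [← ssytWeight_highestWeight, ← h5, h, ssytWeight_highestWeight]

end SemistandardYoungTableau

open SemistandardYoungTableau in
-- Induction on the sum of the row indices of the cells: at the weight of the highest weight tableau
-- of `lam`, every other shape with a nonzero Kostka number has a smaller sum, and the Kostka number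
-- of `lam` itself is nonzero and can be cancelled.
theorem IsSchurExpansion.unique {f : MvPowerSeries ℕ ℤ} {c d : YoungDiagram → ℤ}
    (hc : IsSchurExpansion f c) (hd : IsSchurExpansion f d) (lam : YoungDiagram) :
    c lam = d lam := by
  classical
  rw [isSchurExpansion_iff] at hc hd
  induction hn : ∑ z ∈ lam.cells, z.1 using Nat.strong_induction_on generalizing lam with
  | _ n ih =>
    subst hn
    set m := ssytWeight (highestWeight lam) with hm
    have h1 := (hc m).symm.trans (hd m)
    have hlam : lam ∈ (finite_youngDiagram_card m.degree).toFinset := by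
      simp [hm, degree_ssytWeight]
    rw [← Finset.add_sum_erase _ _ hlam, ← Finset.add_sum_erase _ _ hlam] at h1
    have h2 : ∀ ν ∈ (finite_youngDiagram_card m.degree).toFinset.erase lam,
        c ν * (kostka ν m : ℤ) = d ν * kostka ν m := by
      intro ν hν
      by_cases h3 : kostka ν m = 0
      · rw [h3, Nat.cast_zero, mul_zero, mul_zero]
      · obtain ⟨T, hT⟩ := Set.nonempty_of_ncard_ne_zero h3
        rcases T.sum_row_lt_or_eq hT with h4 | h4
        · rw [ih _ h4 ν rfl]
        · exact absurd h4 (Finset.mem_erase.1 hν).1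
    rw [Finset.sum_congr rfl h2, add_left_inj] at h1
    refine mul_right_cancel₀ ?_ h1
    rw [Nat.cast_ne_zero]
    exact Set.ncard_ne_zero_of_mem (a := highestWeight lam) rfl (finite_ssytOfWeight lam m)

theorem corollary2p4 (N : ℕ) (W : Set (ColoredWord N)) (hW : wordSum W ∈ kronPerp N) :
    IsSchurExpansion (quasiGen (wordSum W))
        (fun ν => (({T : ColoredTableau N ν | T.sqread ∈ W}.ncard : ℕ) : ℤ)) ∧
      ∀ c : YoungDiagram → ℤ, IsSchurExpansion (quasiGen (wordSum W)) c →
        ∀ ν : YoungDiagram, c ν = (({T : ColoredTableau N ν | T.sqread ∈ W}.ncard : ℕ) : ℤ) := by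
  have h : IsSchurExpansion (quasiGen (wordSum W))
      (fun ν => (({T : ColoredTableau N ν | T.sqread ∈ W}.ncard : ℕ) : ℤ)) :=
    isSchurExpansion_iff.2 fun m => coeff_quasiGen_wordSum hW m
  exact ⟨h, fun c hc ν => hc.unique h ν⟩
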